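/- Notation. For $z=(x,\xi)\in\mathbb R^{2d}$ and $\varphi\in\mathcal S(\mathbb R^d)$ put $\pi(z)\varphi(t)=e^{2\pi i\xi\cdot t}\varphi(t-x)$; for $f\in\mathcal S'(\mathbb R^d)$ let $V_\varphi f(z)=\langle f,\pi(z)\varphi\rangle$, where $\langle\cdot,\cdot\rangle$ extends the sesquilinear inner product of $L^2$. Let $v$ be a positive, continuous, submultiplicative weight on $\mathbb R^{2d}$ of at most polynomial growth, i.e. $v(z)\le C(1+|z|)^N$ for some $C,N$. Let $\mathcal M_v$ be the set of positive continuous weights $m$ on $\mathbb R^{2d}$ with $m(z+w)\le C\,v(z)m(w)$ for all $z,w$ and some $C>0$. For $0<p,q\le\infty$, $L^{p,q}_m(\mathbb R^{2d})$ is the space of measurable $F$ with $$\Big(\int_{\mathbb R^d}\Big(\int_{\mathbb R^d}|F(x,\xi)|^p m(x,\xi)^p\,dx\Big)^{q/p}d\xi\Big)^{1/q}<\infty$$ (usual changes if $p=\infty$ or $q=\infty$); a tempered distribution belongs to $L^{p,q}_m$ if it is given by integration against such a function $F$, the product of $F$ with every Schwartz function being integrable. Fix a window $\varphi\in\mathcal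 S(\mathbb R^d)\setminus\{0\}$ and let $M^{p,q}_m(\mathbb R^d)=\{f\in\mathcal S'(\mathbb R^d): V_\varphi f\in L^{p,q}_m(\mathbb R^{2d})\}$ and $M^1_v=M^{1,1}_v$. For a symplectic $2n\times 2n$ matrix $\mathcal A$, $\mu(\mathcal A)$ denotes the metaplectic operator: a unitary operator on $L^2(\mathbb R^n)$, unique up to a phase factor, with $\mu(\mathcal A)\rho(z)=\rho(\mathcal Az)\mu(\mathcal A)$ for all $z\in\mathbb R^{2n}$, where $\rho(x,\xi)=e^{-\pi i x\cdot\xi}\pi(x,\xi)$. It acts on $\mathcal S'(\mathbb R^n)$ by $\langle\mu(\mathcal A)T,\mu(\mathcal A)\Psi\rangle=\langle T,\Psi\rangle$, $\Psi\in\mathcal S(\mathbb R^n)$. For $n=2d$ and $f,g\in\mathcal S'(\mathbb R^d)$ let $W_{\mathcal A}(f,g)=\mu(\mathcal A)(f\otimes\bar g)\in\mathcal S'(\mathbb R^{2d})$. (A change of the phase factor affects nothing below.) Let $\mathcal A\in Sp(2d,\mathbb R)$ be totally Wigner-decomposable: $\mathcal A=\mathcal A_{FT2}\mathcal D_L$ with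 $L\in GL(2d,\mathbb R)$, where $$\mathcal A_{FT2}=\begin{pmatrix}I&0&0&0\\0&0&0&I\\0&0&I&0\\0&-I&0&0\end{pmatrix},\qquad \mathcal D_L=\begin{pmatrix}L^{-1}&0\\0&L^T\end{pmatrix},$$ the blocks of $\mathcal A_{FT2}$ being $d\times d$. Write $\mathcal A=(A_{ij})_{i,j=1}^4$ with $d\times d$ blocks. Assume that $L=\begin{pmatrix}L_{11}&L_{12}\\L_{21}&L_{22}\end{pmatrix}$ is right-regular, i.e. $L_{12}=A_{23}^T$ and $L_{22}=A_{24}^T$ are invertible. **Theorem.** Let $0<p,q\le\infty$ and let $m\in\mathcal M_v$ satisfy, for some constants $0<c\le C$ and all $(x,\xi)\in\mathbb R^{2d}$, $$c\,m(x,\xi)\le m\big((A_{33}^T-A_{23}^T(A_{24}^T)^{-1}A_{34}^T)x,\;A_{23}^{-1}\xi\big)\le C\,m(x,\xi).$$ Then for every $g\in\mathcal S(\mathbb R^d)\setminus\{0\}$ and every $f\in\mathcal S'(\mathbb R^d)$, $$f\in M^{p,q}_m(\mathbb R^d)\iff W_{\mathcal A}(f,g)\in L^{p,q}_m(\mathbb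 R^{2d}).$$ Moreover, if $1\le p,q\le\infty$, if $v$ is even up to a constant, i.e. $v(-z)\le C\,v(z)$ for all $z$ and some $C$, and if there are $0<C_1\le C_2$ such that for all $(x,\xi)\in\mathbb R^{2d}$ $$C_1v(x,\xi)\le v\big(A_{23}^T(A_{24}^T)^{-1}x,\;A_{23}^{-1}A_{24}\xi\big)\le C_2v(x,\xi),$$ then the same equivalence holds for every $g\in M^1_v(\mathbb R^d)\setminus\{0\}$ and every $f\in\mathcal S'(\mathbb R^d)$. -/

import Mathlib

open MeasureTheory
open scoped ENNReal SchwartzMap Matrix RealInnerProductSpace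

/-- `ℝᵈ` with its Euclidean structure. -/
abbrev Rd (d : ℕ) : Type := EuclideanSpace ℝ (Fin d)

/-- `ℝ²ᵈ`, with coordinates split into two groups of `d`. -/
abbrev R2d (d : ℕ) : Type := EuclideanSpace ℝ (Fin d ⊕ Fin d)

/-- The point `(x, y)` of `ℝ²ᵈ`. -/
noncomputable abbrev joinPt {d : ℕ} (x y : Rd d) : R2d d :=
  EuclideanSpace.sumEquivProd.symm (x, y)

/-! ### Time-frequency shifts and the sesquilinear pairing -/

section Shifts

variable {n : Type*} [Fintype n]

/-- The function `t ↦ e^{2πi ξ·t}`. -/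
noncomputable def modChar (ξ t : EuclideanSpace ℝ n) : ℂ :=
  Complex.exp (((2 * Real.pi * ⟪ξ, t⟫ : ℝ) : ℂ) * Complex.I)

lemma hasTemperateGrowth_exp_mul_I :
    Function.HasTemperateGrowth (fun s : ℝ => Complex.exp ((s : ℂ) * Complex.I)) := by
  have hd : ∀ k : ℕ, iteratedDeriv k (fun s : ℝ => Complex.exp ((s : ℂ) * Complex.I)) =
      fun s : ℝ => Complex.I ^ k * Complex.exp ((s : ℂ) * Complex.I) := by
    intro k
    induction k with
    | zero => simp
    | succ k ih =>
      rw [iteratedDeriv_succ, ih]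
      funext s
      have h1 : HasDerivAt (fun s : ℝ => (s : ℂ) * Complex.I) (1 * Complex.I) s :=
        (Complex.ofRealCLM.hasDerivAt (x := s)).mul_const Complex.I
      have h2 := (h1.cexp).const_mul (Complex.I ^ k)
      rw [h2.deriv]
      ring
  refine ⟨?_, fun k => ⟨0, 1, fun s => ?_⟩⟩
  · exact (Complex.ofRealCLM.contDiff.mul contDiff_const).cexp
  · rw [norm_iteratedFDeriv_eq_norm_iteratedDeriv, hd]
    simp [Complex.norm_exp_ofReal_mul_I]

lemma modChar_hasTemperateGrowth (ξ : EuclideanSpace ℝ n) :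
    Function.HasTemperateGrowth (modChar ξ) := by
  have h : Function.HasTemperateGrowth (fun t : EuclideanSpace ℝ n => 2 * Real.pi * ⟪ξ, t⟫) :=
    (Function.HasTemperateGrowth.const (2 * Real.pi)).mul
      (Function.hasTemperateGrowth_inner_right ξ)
  exact hasTemperateGrowth_exp_mul_I.comp h

/-- The time-frequency shift `π(x, ξ)φ = M_ξ T_x φ`, i.e. `t ↦ e^{2πi ξ·t} φ(t - x)`,
of a Schwartz function. -/
noncomputable def tfShift (x ξ : EuclideanSpace ℝ n) (φ : 𝓢(EuclideanSpace ℝ n, ℂ)) :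
    𝓢(EuclideanSpace ℝ n, ℂ) :=
  SchwartzMap.smulLeftCLM ℂ (modChar ξ) (SchwartzMap.compSubConstCLM ℂ x φ)

lemma tfShift_apply (x ξ : EuclideanSpace ℝ n) (φ : 𝓢(EuclideanSpace ℝ n, ℂ))
    (t : EuclideanSpace ℝ n) : tfShift x ξ φ t = modChar ξ t * φ (t - x) := by
  simp [tfShift, SchwartzMap.smulLeftCLM_apply_apply (modChar_hasTemperateGrowth ξ)]

/-- The complex conjugate of a Schwartz function. -/
noncomputable def conjSchwartz (φ : 𝓢(EuclideanSpace ℝ n, ℂ)) : 𝓢(EuclideanSpace ℝ n, ℂ) :=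
  SchwartzMap.postcompCLM (𝕜 := ℝ) (Complex.conjCLE : ℂ →L[ℝ] ℂ) φ

lemma conjSchwartz_apply (φ : 𝓢(EuclideanSpace ℝ n, ℂ)) (t : EuclideanSpace ℝ n) :
    conjSchwartz φ t = (starRingEnd ℂ) (φ t) := by
  simp [conjSchwartz]

/-- The sesquilinear pairing `⟨f, φ⟩` of a tempered distribution with a Schwartz function, which
extends `⟨f, φ⟩ = ∫ f(t) conj(φ(t)) dt`. -/
noncomputable def sesq (f : 𝓢'(EuclideanSpace ℝ n, ℂ)) (φ : 𝓢(EuclideanSpace ℝ n, ℂ)) : ℂ :=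
  f (conjSchwartz φ)

/-- The short-time Fourier transform `V_φ f (x, ξ) = ⟨f, π(x, ξ)φ⟩` of a tempered distribution
with Schwartz window. -/
noncomputable def stft (φ : 𝓢(EuclideanSpace ℝ n, ℂ)) (f : 𝓢'(EuclideanSpace ℝ n, ℂ))
    (z : EuclideanSpace ℝ n × EuclideanSpace ℝ n) : ℂ :=
  sesq f (tfShift z.1 z.2 φ)

end Shifts

/-! ### Weights, mixed-norm spaces, modulation spaces -/

section Spaces

variable {d : ℕ}

/-- A positive, continuous, submultiplicative weight on `ℝ²ᵈ`. -/
structure IsSubmultiplicativeWeight (v : Rd d × Rd d → ℝ) : Prop where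
  continuous : Continuous v
  pos : ∀ z, 0 < v z
  submul : ∀ z w, v (z + w) ≤ v z * v w

/-- The weight `v` grows at most polynomially. -/
def HasPolynomialGrowth (v : Rd d × Rd d → ℝ) : Prop :=
  ∃ (C : ℝ) (N : ℕ), ∀ z, v z ≤ C * (1 + ‖z‖) ^ N

/-- `m ∈ 𝓜_v`: a positive, continuous, `v`-moderate weight on `ℝ²ᵈ`. -/
structure IsModerateWeight (v m : Rd d × Rd d → ℝ) : Prop where
  continuous : Continuous m
  pos : ∀ z, 0 < m z
  moderate : ∃ C > 0, ∀ z w, m (z + w) ≤ C * v z * m w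

/-- `a ≍ b` for real-valued functions. -/
def WeightEquiv {α : Type*} (a b : α → ℝ) : Prop :=
  ∃ C₁ C₂ : ℝ, 0 < C₁ ∧ C₁ ≤ C₂ ∧ ∀ z, C₁ * b z ≤ a z ∧ a z ≤ C₂ * b z

/-- The weighted mixed (quasi-)norm of `L^{p,q}_m(ℝ²ᵈ)`, with values in `[0, ∞]`:
the `Lᵖ` norm in `x` is taken first, then the `L^q` norm in `ξ`. -/
noncomputable def mixedNorm (p q : ℝ≥0∞) (m : Rd d × Rd d → ℝ) (F : Rd d × Rd d → ℂ) : ℝ≥0∞ :=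
  eLpNorm (fun ξ : Rd d => eLpNorm (fun x : Rd d => F (x, ξ) * (m (x, ξ) : ℂ)) p volume) q volume

/-- The (measurable) function `F` on `ℝ²ᵈ` belongs to `L^{p,q}_m(ℝ²ᵈ)`. -/
def MemMixedLp (p q : ℝ≥0∞) (m : Rd d × Rd d → ℝ) (F : Rd d × Rd d → ℂ) : Prop :=
  AEStronglyMeasurable F volume ∧ mixedNorm p q m F < ∞

/-- The tempered distribution `W` on `ℝ²ᵈ` belongs to `L^{p,q}_m(ℝ²ᵈ)`: it is integration against
a function `F ∈ L^{p,q}_m(ℝ²ᵈ)`. -/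
def DistribMemMixedLp (p q : ℝ≥0∞) (m : Rd d × Rd d → ℝ) (W : 𝓢'(R2d d, ℂ)) : Prop :=
  ∃ F : Rd d × Rd d → ℂ, MemMixedLp p q m F ∧ ∀ Φ : 𝓢(R2d d, ℂ),
    Integrable (fun z : Rd d × Rd d => F z * Φ (joinPt z.1 z.2)) ∧
    W Φ = ∫ z : Rd d × Rd d, F z * Φ (joinPt z.1 z.2)

/-- `f ∈ M^{p,q}_m(ℝᵈ)`, the modulation space being defined by means of the window `φ`. -/
def MemModulation (φ : 𝓢(Rd d, ℂ)) (p q : ℝ≥0∞) (m : Rd d × Rd d → ℝ) (f : 𝓢'(Rd d, ℂ)) : Prop :=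
  MemMixedLp p q m (stft φ f)

end Spaces

/-! ### Metaplectic operators -/

section Metaplectic

variable {n : Type*} [Fintype n] [DecidableEq n]

/-- The Schrödinger representation (symmetric time-frequency shift)
`ρ(x, ξ) = e^{-πi x·ξ} M_ξ T_x`, on functions. -/
noncomputable def schrodingerRep (x ξ : EuclideanSpace ℝ n) (F : EuclideanSpace ℝ n → ℂ) :
    EuclideanSpace ℝ n → ℂ :=
  fun t => Complex.exp (((-(Real.pi * ⟪x, ξ⟫) : ℝ) : ℂ) * Complex.I) * modChar ξ t * F (t - x)

/-- The upper half of `A (x, ξ)`. -/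
noncomputable def phaseFst (A : Matrix (n ⊕ n) (n ⊕ n) ℝ) (x ξ : EuclideanSpace ℝ n) :
    EuclideanSpace ℝ n :=
  WithLp.toLp 2 (A.toBlocks₁₁ *ᵥ x.ofLp + A.toBlocks₁₂ *ᵥ ξ.ofLp)

/-- The lower half of `A (x, ξ)`. -/
noncomputable def phaseSnd (A : Matrix (n ⊕ n) (n ⊕ n) ℝ) (x ξ : EuclideanSpace ℝ n) :
    EuclideanSpace ℝ n :=
  WithLp.toLp 2 (A.toBlocks₂₁ *ᵥ x.ofLp + A.toBlocks₂₂ *ᵥ ξ.ofLp)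

/-- `U` is a metaplectic operator `μ(A)` associated with the symplectic matrix `A`: a unitary
operator on `L²(ℝⁿ)` such that `U ρ(z) = ρ(Az) U` for all `z = (x, ξ)` in phase space. By the
Stone-von Neumann theorem this determines `U` up to a phase factor. With these conventions the
Fourier transform is `μ(J)`, `J = (0, I; -I, 0)`, multiplication by `e^{πi Ct·t}` is
`μ((I, 0; C, I))`, and `F ↦ |det L|^{1/2} F(L ·)` is `μ((L⁻¹, 0; 0, Lᵀ))`. -/
def IsMetaplectic (A : Matrix (n ⊕ n) (n ⊕ n) ℝ)
    (U : Lp ℂ 2 (volume : Measure (EuclideanSpace ℝ n)) ≃ₗᵢ[ℂ]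
      Lp ℂ 2 (volume : Measure (EuclideanSpace ℝ n))) : Prop :=
  A ∈ Matrix.symplecticGroup n ℝ ∧
  ∀ (x ξ : EuclideanSpace ℝ n) (F G : Lp ℂ 2 (volume : Measure (EuclideanSpace ℝ n))),
    G =ᵐ[volume] schrodingerRep x ξ F →
    U G =ᵐ[volume] schrodingerRep (phaseFst A x ξ) (phaseSnd A x ξ) (U F)

/-- `W = U T`, where the metaplectic operator `U` acts on tempered distributions by duality:
`⟨U T, U Ψ⟩ = ⟨T, Ψ⟩` for Schwartz functions `Ψ` (whose images `U Ψ` are all the Schwartz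
functions). -/
def IsMetaplecticImage
    (U : Lp ℂ 2 (volume : Measure (EuclideanSpace ℝ n)) ≃ₗᵢ[ℂ]
      Lp ℂ 2 (volume : Measure (EuclideanSpace ℝ n)))
    (T W : 𝓢'(EuclideanSpace ℝ n, ℂ)) : Prop :=
  ∀ Ψ Φ : 𝓢(EuclideanSpace ℝ n, ℂ), Φ.toLp 2 volume = U (Ψ.toLp 2 volume) → sesq W Φ = sesq T Ψ

end Metaplectic

/-! ### Metaplectic Wigner distributions -/

section Wigner

variable {d : ℕ}

/-- `T = f ⊗ ḡ`, the tensor product of `f` with the complex conjugate of `g`: the tempered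
distribution on `ℝ²ᵈ` with `T(φ ⊗ ψ) = f(φ) ḡ(ψ)`, where `ḡ(ψ) = conj(g(conj ψ))`. -/
def IsTensorConj (f g : 𝓢'(Rd d, ℂ)) (T : 𝓢'(R2d d, ℂ)) : Prop :=
  ∀ (φ ψ : 𝓢(Rd d, ℂ)) (Θ : 𝓢(R2d d, ℂ)), (∀ x y, Θ (joinPt x y) = φ x * ψ y) →
    T Θ = f φ * (starRingEnd ℂ) (g (conjSchwartz ψ))

/-- `W = W_A(f, g) = μ(A)(f ⊗ ḡ)`, the metaplectic Wigner distribution of the tempered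
distributions `f` and `g`, for the metaplectic operator `U = μ(A)` on `ℝ²ᵈ`. -/
def IsWignerDistribution
    (U : Lp ℂ 2 (volume : Measure (R2d d)) ≃ₗᵢ[ℂ] Lp ℂ 2 (volume : Measure (R2d d)))
    (f g : 𝓢'(Rd d, ℂ)) (W : 𝓢'(R2d d, ℂ)) : Prop :=
  ∃ T : 𝓢'(R2d d, ℂ), IsTensorConj f g T ∧ IsMetaplecticImage U T W

/-- `W_A(f, g) ∈ L^{p,q}_m(ℝ²ᵈ)`, where `U = μ(A)`. -/
def WignerMemMixedLp
    (U : Lp ℂ 2 (volume : Measure (R2d d)) ≃ₗᵢ[ℂ] Lp ℂ 2 (volume : Measure (R2d d)))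
    (p q : ℝ≥0∞) (m : Rd d × Rd d → ℝ) (f g : 𝓢'(Rd d, ℂ)) : Prop :=
  ∃ W : 𝓢'(R2d d, ℂ), IsWignerDistribution U f g W ∧ DistribMemMixedLp p q m W

/-- `4d × 4d` matrices, written as `4 × 4` block matrices with `d × d` blocks. -/
abbrev Mat4 (d : ℕ) : Type :=
  Matrix ((Fin d ⊕ Fin d) ⊕ (Fin d ⊕ Fin d)) ((Fin d ⊕ Fin d) ⊕ (Fin d ⊕ Fin d)) ℝ

/-- The symplectic matrix `A_{FT2}` of the partial Fourier transform in the second variable. -/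
def matFT2 (d : ℕ) : Mat4 d :=
  Matrix.fromBlocks
    (Matrix.fromBlocks 1 0 0 0) (Matrix.fromBlocks 0 0 0 1)
    (Matrix.fromBlocks 0 0 0 (-1)) (Matrix.fromBlocks 1 0 0 0)

/-- The symplectic matrix `D_L = (L⁻¹, 0; 0, Lᵀ)`. -/
noncomputable def matD (L : GL (Fin d ⊕ Fin d) ℝ) : Mat4 d :=
  Matrix.fromBlocks (L⁻¹).val 0 0 (L.val)ᵀ

/-- `A` is totally Wigner-decomposable, with `A = A_{FT2} D_L`. -/
def IsTotallyWignerDecomposable (A : Mat4 d) (L : GL (Fin d ⊕ Fin d) ℝ) : Prop :=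
  A ∈ Matrix.symplecticGroup (Fin d ⊕ Fin d) ℝ ∧ A = matFT2 d * matD L

/-- `L = (L₁₁, L₁₂; L₂₁, L₂₂)` is right-regular: `L₁₂` and `L₂₂` are invertible. -/
def IsBlockRightRegular (L : GL (Fin d ⊕ Fin d) ℝ) : Prop :=
  IsUnit L.val.toBlocks₁₂ ∧ IsUnit L.val.toBlocks₂₂

/-- The block `A₂₃`. -/
def blk23 (A : Mat4 d) : Matrix (Fin d) (Fin d) ℝ := A.toBlocks₁₂.toBlocks₂₁

/-- The block `A₂₄`. -/
def blk24 (A : Mat4 d) : Matrix (Fin d) (Fin d) ℝ := A.toBlocks₁₂.toBlocks₂₂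

/-- The block `A₃₃`. -/
def blk33 (A : Mat4 d) : Matrix (Fin d) (Fin d) ℝ := A.toBlocks₂₂.toBlocks₁₁

/-- The block `A₃₄`. -/
def blk34 (A : Mat4 d) : Matrix (Fin d) (Fin d) ℝ := A.toBlocks₂₂.toBlocks₁₂

/-- The linear map `x ↦ B x` of `ℝᵈ`. -/
noncomputable def applyMat (B : Matrix (Fin d) (Fin d) ℝ) (x : Rd d) : Rd d :=
  WithLp.toLp 2 (B *ᵥ x.ofLp)

end Wigner

/-! ### Integrals of Schwartz functions depending on a parameter -/

section Interchange

open scoped BoundedContinuousFunction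

/-! Formally, `μ(A)(f ⊗ ḡ)(x, ξ)` is a constant times `∫ f(L₁₁x + L₁₂y) conj(g(L₂₁x + L₂₂y)) e^{-2πi
ξ·y} dy`. As `L₁₂` is invertible, substitute `t = L₁₁x + L₁₂y` and put `R = L₁₁`, `D = L₂₂L₁₂⁻¹`, `Q
= L₁₂⁻ᵀ`, `P = L₁₁ - L₁₂L₂₂⁻¹L₂₁`. The argument of `g` becomes `D(t - Px)`, and the distribution is
`κ e^{2πi Qξ·Rx} V_{g∘D} f(Px, Qξ)`. The chirp has modulus one, and the hypothesis on `m` says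
precisely that the substitution `(P, Q)` respects the weight. So `W_A(f, g)` lies in `L^{p,q}_m` if
and only if `V_{g∘D} f` does. For a Schwartz window it only remains to know that modulation spaces
do not depend on the window.

The operator is given only by its intertwining relation, so the formula is proved weakly. The main
tool is Moyal's formula for a tempered distribution (`integral_stft_mul_conj_stft`). It shows that a
distribution is determined by its values on the orbit of one nonzero Schwartz function under
time-frequency shifts. Hence the action of `U` is known once a single pair `Φ = UΨ` is known
(`IsMetaplectic.isMetaplecticImage`). Here `Ψ` is a tensor product of Gaussians and `Φ` a chirped
Gaussian. Their ambiguity functions correspond under `A` up to a constant, which forces `UΨ` to be a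
multiple of `Φ` by the equality case of Cauchy-Schwarz (`IsMetaplectic.exists_smul_eq`,
`WignerData.exists_gaussian_pair`).

Independence of the window for all positive `p, q` rests on `|V_ψ f|^r ≤ C |V_φ f|^r * ⟨·⟩^{-Nr}`
with `r = min(1, p, q)`. For `r = 1` this is the reproducing formula, and it improves itself to
smaller `r` (`rpow_le_lintegral_of_le_lintegral`). Young's inequality with the exponents `p/r, q/r ≥
1` finishes the argument.

For `g ∈ M¹_v` the hypotheses on `v` put `g∘D` in `M¹_v`, and `V_{g∘D} f` is constructed as an
integral of translates of `V_{φ₀} f` against `V_{φ₀}(g∘D)` (`MemModulation.exists_isWeakStft`).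
Conversely, pairing `W_A(f, g)` with the orbit of `Φ` gives `V f(Px, Qξ)` times a value of `g` on an
orbit. Keeping the coordinates that belong to `g` at a point where this value is nonzero dominates
`V f` by a convolution of `W_A(f, g)` with a Schwartz function (`WignerData.exists_enorm_stft_le`).
-/

lemma SchwartzMap.seminorm_fderivCLM_le {V F : Type*} [NormedAddCommGroup V] [NormedSpace ℝ V]
    [NormedAddCommGroup F] [NormedSpace ℝ F] (k l : ℕ) (φ : 𝓢(V, F)) :
    SchwartzMap.seminorm ℝ k l (SchwartzMap.fderivCLM ℝ V F φ) ≤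
      SchwartzMap.seminorm ℝ k (l + 1) φ := by
  refine SchwartzMap.seminorm_le_bound ℝ k l _ (apply_nonneg _ _) fun x => ?_
  have h : (⇑(SchwartzMap.fderivCLM ℝ V F φ) : V → V →L[ℝ] F) = fderiv ℝ φ := by
    ext1 y; simp
  rw [h, norm_iteratedFDeriv_fderiv]
  exact SchwartzMap.le_seminorm ℝ k (l + 1) φ x

/-- A functional dominated by the norm of an injective map into a normed space factors through
that map. -/
lemma exists_clm_of_norm_le {W E : Type*} [AddCommGroup W] [Module ℂ W] [NormedAddCommGroup E]
    [NormedSpace ℂ E] (ι : W →ₗ[ℂ] E) (hinj : Function.Injective ι) (f : W →ₗ[ℂ] ℂ) (C : ℝ)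
    (hfb : ∀ φ, ‖f φ‖ ≤ C * ‖ι φ‖) : ∃ g : E →L[ℂ] ℂ, ∀ φ, g (ι φ) = f φ := by
  let e := LinearEquiv.ofInjective ι hinj
  let f0 : StrongDual ℂ (LinearMap.range ι) :=
    (f ∘ₗ e.symm.toLinearMap).mkContinuous C (fun w => by
      have := hfb (e.symm w)
      have h2 : ι (e.symm w) = w := by
        rw [← LinearEquiv.ofInjective_apply (h := hinj) ι]; simp [e]
      rw [h2] at this
      exact this)
  obtain ⟨g, hg, -⟩ := exists_extension_norm_eq (LinearMap.range ι) f0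
  refine ⟨g, fun φ => ?_⟩
  have := hg (e φ)
  have h2 : ((e φ : LinearMap.range ι) : E) = ι φ := LinearEquiv.ofInjective_apply (h := hinj) ι φ
  rw [h2] at this
  rw [this]
  change f (e.symm (e φ)) = f φ
  rw [e.symm_apply_apply]

variable {Z : Type*} [TopologicalSpace Z] [MeasurableSpace Z] [OpensMeasurableSpace Z]
  [SecondCountableTopology Z] {μ : Measure Z}

lemma SchwartzMap.continuous_eval {V F : Type*} [NormedAddCommGroup V] [NormedSpace ℝ V]
    [NormedAddCommGroup F] [NormedSpace ℝ F] (x : V) : Continuous fun φ : 𝓢(V, F) => φ x := by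
  have : (fun φ : 𝓢(V, F) => φ x) = fun φ => (SchwartzMap.toBoundedContinuousFunctionCLM ℝ V F φ) x := by
    ext; simp
  rw [this]
  exact (BoundedContinuousFunction.evalCLM ℝ x).continuous.comp
    (SchwartzMap.toBoundedContinuousFunctionCLM ℝ V F).continuous

/-- The derivatives of an integral of Schwartz functions are the integrals of the derivatives. -/
lemma SchwartzMap.iteratedFDeriv_integral {V : Type} [NormedAddCommGroup V] [NormedSpace ℝ V]
    (l : ℕ) : ∀ {F : Type} [NormedAddCommGroup F] [NormedSpace ℝ F] [CompleteSpace F]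
    (h : Z → 𝓢(V, F)) (_ : Continuous h)
    (_ : ∀ j, Integrable (fun z => SchwartzMap.seminorm ℝ 0 j (h z)) μ)
    (ψ : 𝓢(V, F)) (_ : ∀ x, ∫ z, h z x ∂μ = ψ x) (x : V),
    Integrable (fun z => iteratedFDeriv ℝ l (h z) x) μ ∧
    ∫ z, iteratedFDeriv ℝ l (h z) x ∂μ = iteratedFDeriv ℝ l ψ x := by
  have int0 : ∀ {F : Type} [NormedAddCommGroup F] [NormedSpace ℝ F]
      (h : Z → 𝓢(V, F)) (_ : Continuous h)
      (_ : ∀ j, Integrable (fun z => SchwartzMap.seminorm ℝ 0 j (h z)) μ) (x : V),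
      Integrable (fun z => h z x) μ := by
    intro F _ _ h hc hi x
    refine (hi 0).mono' ((SchwartzMap.continuous_eval x).comp hc).aestronglyMeasurable
      (Filter.Eventually.of_forall fun z => SchwartzMap.norm_le_seminorm ℝ _ _)
  induction l with
  | zero =>
    intro F _ _ _ h hc hi ψ hψ x
    have e : ∀ φ : 𝓢(V, F), iteratedFDeriv ℝ 0 φ x =
        (continuousMultilinearCurryFin0 ℝ V F).symm (φ x) := fun φ => by
      rw [iteratedFDeriv_zero_eq_comp]; rfl
    simp only [e]
    have i0 := int0 h hc hi x
    refine ⟨(continuousMultilinearCurryFin0 ℝ V F).symm.toContinuousLinearEquiv.toContinuousLinearMap.integrable_comp i0, ?_⟩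
    rw [← hψ]
    exact ((continuousMultilinearCurryFin0 ℝ V F).symm.toContinuousLinearEquiv).integral_comp_comm _
  | succ l ih =>
    intro F _ _ _ h hc hi ψ hψ x
    have hf : ∀ φ : 𝓢(V, F), (⇑(SchwartzMap.fderivCLM ℝ V F φ) : V → V →L[ℝ] F) = fderiv ℝ φ :=
      fun φ => by ext1 y; simp
    have hc' : Continuous fun z => SchwartzMap.fderivCLM ℝ V F (h z) :=
      (SchwartzMap.fderivCLM ℝ V F).continuous.comp hc
    have hi' : ∀ j, Integrable (fun z => SchwartzMap.seminorm ℝ 0 j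
        (SchwartzMap.fderivCLM ℝ V F (h z))) μ := by
      intro j
      refine (hi (j + 1)).mono' ?_ (Filter.Eventually.of_forall fun z => ?_)
      · exact (((schwartz_withSeminorms ℝ V (V →L[ℝ] F)).continuous_seminorm (0, j)).comp
          hc').aestronglyMeasurable
      · rw [Real.norm_of_nonneg (apply_nonneg _ _)]
        exact SchwartzMap.seminorm_fderivCLM_le 0 j (h z)
    have hψ' : ∀ y, ∫ z, SchwartzMap.fderivCLM ℝ V F (h z) y ∂μ =
        SchwartzMap.fderivCLM ℝ V F ψ y := by
      intro y
      have key : HasFDerivAt (fun y => ∫ z, h z y ∂μ)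
          (∫ z, SchwartzMap.fderivCLM ℝ V F (h z) y ∂μ) y := by
        refine hasFDerivAt_integral_of_dominated_of_fderiv_le (𝕜 := ℝ)
          (F' := fun y z => SchwartzMap.fderivCLM ℝ V F (h z) y)
          (bound := fun z => SchwartzMap.seminorm ℝ 0 1 (h z)) Filter.univ_mem
          (Filter.Eventually.of_forall fun y => (int0 h hc hi y).aestronglyMeasurable)
          (int0 h hc hi y) (int0 _ hc' hi' y).aestronglyMeasurable
          (Filter.Eventually.of_forall fun z y _ => ?_) (hi 1)
          (Filter.Eventually.of_forall fun z y _ => ?_)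
        · exact (SchwartzMap.norm_le_seminorm ℝ _ _).trans (SchwartzMap.seminorm_fderivCLM_le 0 0 (h z))
        · rw [hf]; exact (h z).differentiableAt.hasFDerivAt
      have : (fun y => ∫ z, h z y ∂μ) = ψ := funext hψ
      rw [this] at key
      rw [hf, key.fderiv]
    obtain ⟨h1, h2⟩ := ih _ hc' hi' _ hψ' x
    simp only [hf] at h1 h2
    obtain ⟨T, e⟩ : ∃ T : (V [×l]→L[ℝ] (V →L[ℝ] F)) →L[ℝ] (V [×(l + 1)]→L[ℝ] F),
        ∀ φ : 𝓢(V, F), iteratedFDeriv ℝ (l + 1) φ x = T (iteratedFDeriv ℝ l (fderiv ℝ φ) x) :=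
      ⟨(continuousMultilinearCurryRightEquiv' ℝ l V F).symm.toContinuousLinearEquiv.toContinuousLinearMap,
        fun φ => by rw [iteratedFDeriv_succ_eq_comp_right]; rfl⟩
    simp only [e]
    refine ⟨T.integrable_comp h1, ?_⟩
    rw [← h2]
    exact T.integral_comp_comm h1

/-- Bounded continuous functions with values in the `l`-linear maps. -/
def BddMultilinear (V : Type) [NormedAddCommGroup V] [NormedSpace ℝ V] (l : ℕ) : Type :=
  V →ᵇ (V [×l]→L[ℝ] ℂ)

noncomputable instance {V : Type} [NormedAddCommGroup V] [NormedSpace ℝ V] (l : ℕ) :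
    NormedAddCommGroup (BddMultilinear V l) :=
  inferInstanceAs (NormedAddCommGroup (V →ᵇ (V [×l]→L[ℝ] ℂ)))

noncomputable instance {V : Type} [NormedAddCommGroup V] [NormedSpace ℝ V] (l : ℕ) :
    NormedSpace ℂ (BddMultilinear V l) :=
  inferInstanceAs (NormedSpace ℂ (V →ᵇ (V [×l]→L[ℝ] ℂ)))

instance {V : Type} [NormedAddCommGroup V] [NormedSpace ℝ V] (l : ℕ) :
    CompleteSpace (BddMultilinear V l) :=
  inferInstanceAs (CompleteSpace (V →ᵇ (V [×l]→L[ℝ] ℂ)))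

/-- Evaluation at a point. -/
noncomputable def BddMultilinear.eval {V : Type} [NormedAddCommGroup V] [NormedSpace ℝ V] {l : ℕ}
    (x : V) : BddMultilinear V l →L[ℂ] (V [×l]→L[ℝ] ℂ) :=
  (BoundedContinuousFunction.evalCLM ℂ x : (V →ᵇ (V [×l]→L[ℝ] ℂ)) →L[ℂ] (V [×l]→L[ℝ] ℂ))

lemma BddMultilinear.ext {V : Type} [NormedAddCommGroup V] [NormedSpace ℝ V] {l : ℕ}
    {u w : BddMultilinear V l} (h : ∀ x, BddMultilinear.eval x u = BddMultilinear.eval x w) :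
    u = w :=
  BoundedContinuousFunction.ext h

lemma BddMultilinear.norm_le {V : Type} [NormedAddCommGroup V] [NormedSpace ℝ V] {l : ℕ}
    (u : BddMultilinear V l) {C : ℝ} (hC : 0 ≤ C) :
    ‖u‖ ≤ C ↔ ∀ x, ‖BddMultilinear.eval x u‖ ≤ C :=
  BoundedContinuousFunction.norm_le (f := (u : V →ᵇ (V [×l]→L[ℝ] ℂ))) hC

/-- The weighted derivative `x ↦ ‖x‖ᵏ Dˡφ(x)` of a Schwartz function, as a bounded function. -/
noncomputable def SchwartzMap.weightedDerivFun {V : Type} [NormedAddCommGroup V]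
    [NormedSpace ℝ V] (k l : ℕ) (φ : 𝓢(V, ℂ)) : BddMultilinear V l :=
  (BoundedContinuousFunction.ofNormedAddCommGroup
    (fun x => ((‖x‖ ^ k : ℝ) : ℂ) • iteratedFDeriv ℝ l φ x)
    (by
      have := (φ.smooth ⊤).continuous_iteratedFDeriv (m := l) (mod_cast le_top)
      fun_prop)
    (SchwartzMap.seminorm ℝ k l φ) (fun x => by
      rw [norm_smul]; simpa using SchwartzMap.le_seminorm ℝ k l φ x) : V →ᵇ (V [×l]→L[ℝ] ℂ))

lemma SchwartzMap.weightedDerivFun_apply {V : Type} [NormedAddCommGroup V] [NormedSpace ℝ V]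
    (k l : ℕ) (φ : 𝓢(V, ℂ)) (x : V) :
    BddMultilinear.eval x (SchwartzMap.weightedDerivFun k l φ) =
      ((‖x‖ ^ k : ℝ) : ℂ) • iteratedFDeriv ℝ l φ x := rfl

/-- The linear map given by `SchwartzMap.weightedDerivFun`. -/
noncomputable def SchwartzMap.weightedDeriv {V : Type} [NormedAddCommGroup V] [NormedSpace ℝ V]
    (k l : ℕ) : 𝓢(V, ℂ) →ₗ[ℂ] BddMultilinear V l where
  toFun φ := SchwartzMap.weightedDerivFun k l φ
  map_add' φ ψ := BddMultilinear.ext fun x => by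
    have : iteratedFDeriv ℝ l (φ + ψ) x = _ := iteratedFDeriv_add_apply (𝕜 := ℝ) (i := l)
      (f := φ) (g := ψ) (x := x) ((φ.smooth l).contDiffAt) ((ψ.smooth l).contDiffAt)
    rw [map_add]
    simp only [SchwartzMap.weightedDerivFun_apply]
    rw [this, smul_add]
  map_smul' c φ := BddMultilinear.ext fun x => by
    have : iteratedFDeriv ℝ l (c • φ) x = _ := iteratedFDeriv_const_smul_apply (𝕜 := ℝ) (i := l)
      (f := φ) (x := x) (a := c) ((φ.smooth l).contDiffAt)
    rw [RingHom.id_apply, map_smul]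
    simp only [SchwartzMap.weightedDerivFun_apply]
    rw [smul_comm, ← this]

lemma SchwartzMap.weightedDeriv_apply {V : Type} [NormedAddCommGroup V] [NormedSpace ℝ V]
    (k l : ℕ) (φ : 𝓢(V, ℂ)) (x : V) :
    BddMultilinear.eval x (SchwartzMap.weightedDeriv k l φ) =
      ((‖x‖ ^ k : ℝ) : ℂ) • iteratedFDeriv ℝ l φ x := rfl

lemma SchwartzMap.norm_weightedDeriv {V : Type} [NormedAddCommGroup V] [NormedSpace ℝ V]
    (k l : ℕ) (φ : 𝓢(V, ℂ)) :
    ‖SchwartzMap.weightedDeriv k l φ‖ = SchwartzMap.seminorm ℂ k l φ := by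
  apply le_antisymm
  · refine (BddMultilinear.norm_le _ (apply_nonneg _ _)).2 fun x => ?_
    rw [SchwartzMap.weightedDeriv_apply, norm_smul]
    simpa using SchwartzMap.le_seminorm ℂ k l φ x
  · refine SchwartzMap.seminorm_le_bound ℂ k l _ (norm_nonneg _) fun x => ?_
    have := (BddMultilinear.norm_le _ (norm_nonneg _)).1 (le_refl ‖SchwartzMap.weightedDeriv k l φ‖) x
    rw [SchwartzMap.weightedDeriv_apply, norm_smul] at this
    simpa using this

/-- A continuous functional may be applied under the integral sign. -/
theorem SchwartzMap.integral_clm_comp {V : Type} [NormedAddCommGroup V] [NormedSpace ℝ V]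
    (h : Z → 𝓢(V, ℂ)) (hc : Continuous h)
    (hi : ∀ k l, Integrable (fun z => SchwartzMap.seminorm ℝ k l (h z)) μ)
    (ψ : 𝓢(V, ℂ)) (hψ : ∀ x, ∫ z, h z x ∂μ = ψ x)
    (f : 𝓢(V, ℂ) →ₗ[ℂ] ℂ) (hf : Continuous f) :
    Integrable (fun z => f (h z)) μ ∧ ∫ z, f (h z) ∂μ = f ψ := by
  classical
  obtain ⟨s0, C, -, hC⟩ := Seminorm.bound_of_continuous (schwartz_withSeminorms ℂ V ℂ)
    ((normSeminorm ℂ ℂ).comp f) hf.norm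
  -- The functional `f` is bounded by finitely many seminorms, hence factors through a Banach space
  -- of weighted derivatives, where Bochner integration applies. The index `(0, 0)` is added to make
  -- the map into that space injective.
  set s := insert (0, 0) s0
  let ι : 𝓢(V, ℂ) →ₗ[ℂ] (∀ i : s, BddMultilinear V i.1.2) :=
    LinearMap.pi fun i => SchwartzMap.weightedDeriv i.1.1 i.1.2
  have hιapp : ∀ φ i, ι φ i = SchwartzMap.weightedDeriv i.1.1 i.1.2 φ := fun _ _ => rfl
  have hιc : Continuous ι := by
    refine continuous_pi fun i => ?_
    refine (schwartz_withSeminorms ℂ V ℂ).continuous_normedSpace_rng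
      (BddMultilinear V i.1.2) (SchwartzMap.weightedDeriv (V := V) i.1.1 i.1.2) ⟨{i.1}, 1, fun φ => ?_⟩
    rw [one_smul, Finset.sup_singleton]
    exact (SchwartzMap.norm_weightedDeriv i.1.1 i.1.2 φ).le
  have hinj : Function.Injective ι := by
    intro φ φ' he
    have h0 := congrFun he ⟨(0, 0), Finset.mem_insert_self _ _⟩
    ext x
    have h1 := congrArg (fun g => BddMultilinear.eval x g) h0
    simp only [hιapp, SchwartzMap.weightedDeriv_apply] at h1
    have h2 := congrArg (fun g => g 0) h1
    simpa using h2
  have hfb : ∀ φ, ‖f φ‖ ≤ C * ‖ι φ‖ := by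
    intro φ
    refine (hC φ).trans ?_
    simp only [smul_apply]
    rw [NNReal.smul_def, smul_eq_mul]
    gcongr
    refine Seminorm.finset_sup_apply_le (norm_nonneg _) fun i hi => ?_
    have := norm_le_pi_norm (ι φ) ⟨i, Finset.mem_insert_of_mem hi⟩
    rwa [hιapp, SchwartzMap.norm_weightedDeriv] at this
  obtain ⟨g, hgι⟩ := exists_clm_of_norm_le ι hinj f C hfb
  have hιi : Integrable (fun z => ι (h z)) μ := by
    refine Integrable.mono' (g := fun z => ∑ i : s, SchwartzMap.seminorm ℝ i.1.1 i.1.2 (h z))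
      (integrable_finsetSum _ fun i _ => hi _ _) (hιc.comp hc).aestronglyMeasurable
      (Filter.Eventually.of_forall fun z => ?_)
    refine (pi_norm_le_iff_of_nonneg (Finset.sum_nonneg fun i _ => apply_nonneg _ _)).2 fun i => ?_
    rw [hιapp, SchwartzMap.norm_weightedDeriv]
    exact Finset.single_le_sum (f := fun i : s => SchwartzMap.seminorm ℝ i.1.1 i.1.2 (h z))
      (fun i _ => apply_nonneg _ _) (Finset.mem_univ i)
  -- Tested in each component and at each point, this is differentiation under the integral sign.
  have hιψ : ∫ z, ι (h z) ∂μ = ι ψ := by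
    funext i
    refine BddMultilinear.ext fun x => ?_
    have e1 := ((BddMultilinear.eval x ∘L
      (ContinuousLinearMap.proj (R := ℂ) (φ := fun i : s => BddMultilinear V i.1.2) i))).integral_comp_comm hιi
    simp only [ContinuousLinearMap.comp_apply, ContinuousLinearMap.proj_apply] at e1
    rw [← e1]
    simp only [hιapp, SchwartzMap.weightedDeriv_apply]
    rw [integral_smul, (SchwartzMap.iteratedFDeriv_integral i.1.2 h hc (hi 0) ψ hψ x).2]
  have h3 := g.integrable_comp hιi
  have h4 := g.integral_comp_comm hιi
  simp only [hgι] at h3 h4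
  rw [hιψ, hgι] at h4
  exact ⟨h3, h4⟩

end Interchange

/-! ### Translations and modulations on the Schwartz space -/

section Translations

open scoped FourierTransform

lemma one_add_pow_le (k : ℕ) {s : ℝ} (hs : 0 ≤ s) : (1 + s) ^ k ≤ 2 ^ k * (s ^ k + 1) := by
  calc (1 + s) ^ k ≤ 2 ^ (k - 1) * (1 ^ k + s ^ k) := add_pow_le zero_le_one hs k
    _ ≤ 2 ^ k * (s ^ k + 1) := by
      rw [one_pow, add_comm]
      gcongr
      · norm_num
      · omega

lemma one_add_norm_le_mul {V : Type*} [SeminormedAddCommGroup V] (a b : V) :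
    1 + ‖a + b‖ ≤ (1 + ‖a‖) * (1 + ‖b‖) := by
  nlinarith [norm_add_le a b, norm_nonneg a, norm_nonneg b, mul_nonneg (norm_nonneg a) (norm_nonneg b)]

variable {V : Type*} [NormedAddCommGroup V] [NormedSpace ℝ V]

lemma SchwartzMap.one_add_norm_pow_mul_le (k l : ℕ) (φ : 𝓢(V, ℂ)) (t : V) :
    (1 + ‖t‖) ^ k * ‖iteratedFDeriv ℝ l φ t‖ ≤
      2 ^ k * (SchwartzMap.seminorm ℂ k l φ + SchwartzMap.seminorm ℂ 0 l φ) := by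
  calc (1 + ‖t‖) ^ k * ‖iteratedFDeriv ℝ l φ t‖
      ≤ (2 ^ k * (‖t‖ ^ k + 1)) * ‖iteratedFDeriv ℝ l φ t‖ := by
        gcongr; exact one_add_pow_le k (norm_nonneg t)
    _ = 2 ^ k * (‖t‖ ^ k * ‖iteratedFDeriv ℝ l φ t‖ + ‖t‖ ^ 0 * ‖iteratedFDeriv ℝ l φ t‖) := by ring
    _ ≤ _ := by
        gcongr
        · exact SchwartzMap.le_seminorm ℂ k l φ t
        · exact SchwartzMap.le_seminorm ℂ 0 l φ t

lemma SchwartzMap.iteratedFDeriv_compSubConst (l : ℕ) (a : V) (φ : 𝓢(V, ℂ)) (t : V) :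
    iteratedFDeriv ℝ l (SchwartzMap.compSubConstCLM ℂ a φ) t = iteratedFDeriv ℝ l φ (t - a) := by
  have : ⇑(SchwartzMap.compSubConstCLM ℂ a φ) = fun z => φ (z - a) := rfl
  rw [this, iteratedFDeriv_comp_sub]

lemma SchwartzMap.seminorm_compSubConst_le (k l : ℕ) (a : V) (φ : 𝓢(V, ℂ)) :
    SchwartzMap.seminorm ℂ k l (SchwartzMap.compSubConstCLM ℂ a φ) ≤
      (1 + ‖a‖) ^ k * (2 ^ k * (SchwartzMap.seminorm ℂ k l φ + SchwartzMap.seminorm ℂ 0 l φ)) := by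
  refine SchwartzMap.seminorm_le_bound ℂ k l _ (by positivity) fun t => ?_
  rw [SchwartzMap.iteratedFDeriv_compSubConst]
  have h1 : ‖t‖ ≤ (1 + ‖a‖) * (1 + ‖t - a‖) := by
    have := one_add_norm_le_mul a (t - a)
    rw [add_sub_cancel] at this
    linarith [norm_nonneg t]
  calc ‖t‖ ^ k * ‖iteratedFDeriv ℝ l φ (t - a)‖
      ≤ ((1 + ‖a‖) * (1 + ‖t - a‖)) ^ k * ‖iteratedFDeriv ℝ l φ (t - a)‖ := by gcongr
    _ = (1 + ‖a‖) ^ k * ((1 + ‖t - a‖) ^ k * ‖iteratedFDeriv ℝ l φ (t - a)‖) := by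
        rw [mul_pow, mul_assoc]
    _ ≤ _ := mul_le_mul_of_nonneg_left (SchwartzMap.one_add_norm_pow_mul_le k l φ _)
        (by positivity)

/-- From `‖t‖ ≤ (1 + ‖a‖)(1 + ‖t - a‖)`, a translation costs at most a power of `1 + ‖a‖` in each
Schwartz seminorm. A continuous seminorm is dominated by finitely many of these. -/
lemma SchwartzMap.exists_seminorm_compSubConst_le (p : Seminorm ℂ 𝓢(V, ℂ)) (hp : Continuous p) :
    ∃ (N : ℕ) (q : Seminorm ℂ 𝓢(V, ℂ)), Continuous q ∧
      ∀ a φ, p (SchwartzMap.compSubConstCLM ℂ a φ) ≤ (1 + ‖a‖) ^ N * q φ := by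
  classical
  obtain ⟨s, C, -, hC⟩ := Seminorm.bound_of_continuous (schwartz_withSeminorms ℂ V ℂ) p hp
  have hcs : ∀ k l, Continuous (SchwartzMap.seminorm ℂ k l : Seminorm ℂ 𝓢(V, ℂ)) := fun k l =>
    (schwartz_withSeminorms ℂ V ℂ).continuous_seminorm (k, l)
  let q0 : ℕ × ℕ → Seminorm ℂ 𝓢(V, ℂ) := fun i =>
    ((2 : NNReal) ^ i.1) • (SchwartzMap.seminorm ℂ i.1 i.2 + SchwartzMap.seminorm ℂ 0 i.2)
  have hq0 : ∀ i φ, q0 i φ =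
      2 ^ i.1 * (SchwartzMap.seminorm ℂ i.1 i.2 φ + SchwartzMap.seminorm ℂ 0 i.2 φ) := by
    intro i φ
    simp [q0, NNReal.smul_def, mul_add]
  have hsum : ∀ φ, (∑ i ∈ s, q0 i) φ = ∑ i ∈ s, q0 i φ := fun φ => by
    clear hC
    induction s using Finset.induction_on with
    | empty => simp
    | insert i s hi ih => rw [Finset.sum_insert hi, Finset.sum_insert hi, add_apply, ih]
  refine ⟨s.sup Prod.fst, C • ∑ i ∈ s, q0 i, ?_, fun a φ => ?_⟩
  · have : ⇑(C • ∑ i ∈ s, q0 i) = fun φ => (C : ℝ) * ∑ i ∈ s, q0 i φ := by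
      funext φ; simp [NNReal.smul_def, hsum]
    rw [this]
    refine continuous_const.mul (continuous_finsetSum _ fun i _ => ?_)
    have : ⇑(q0 i) = fun φ => 2 ^ i.1 * (SchwartzMap.seminorm ℂ i.1 i.2 φ + SchwartzMap.seminorm ℂ 0 i.2 φ) :=
      funext (hq0 i)
    rw [this]
    exact continuous_const.mul ((hcs _ _).add (hcs _ _))
  · refine (hC _).trans ?_
    rw [smul_apply, smul_apply, hsum, NNReal.smul_def, NNReal.smul_def, smul_eq_mul, smul_eq_mul,
      mul_left_comm]
    gcongr
    rw [Finset.mul_sum]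
    refine Seminorm.finset_sup_apply_le (Finset.sum_nonneg fun i _ => by positivity) fun i hi => ?_
    refine le_trans ?_ (Finset.single_le_sum (f := fun i => (1 + ‖a‖) ^ (s.sup Prod.fst) * q0 i φ)
      (fun i _ => by positivity) hi)
    refine (SchwartzMap.seminorm_compSubConst_le i.1 i.2 a φ).trans ?_
    rw [hq0]
    gcongr
    · linarith [norm_nonneg a]
    · exact Finset.le_sup (f := Prod.fst) hi

/-- This is the mean value inequality on the unit ball around `t`, with the weight `‖t‖ ^ k` frozen.
In that ball `‖t‖ ≤ 2(1 + ‖y‖)`, whence the additional factor `2 ^ k`. -/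
lemma SchwartzMap.seminorm_compSubConst_sub_le (k l : ℕ) (φ : 𝓢(V, ℂ)) (a : V) (ha : ‖a‖ ≤ 1) :
    SchwartzMap.seminorm ℂ k l (SchwartzMap.compSubConstCLM ℂ a φ - φ) ≤
      2 ^ k * (2 ^ k * (SchwartzMap.seminorm ℂ k (l + 1) φ + SchwartzMap.seminorm ℂ 0 (l + 1) φ))
        * ‖a‖ := by
  refine SchwartzMap.seminorm_le_bound ℂ k l _ (by positivity) fun t => ?_
  have e : iteratedFDeriv ℝ l (⇑(SchwartzMap.compSubConstCLM ℂ a φ - φ)) t =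
      iteratedFDeriv ℝ l φ (t - a) - iteratedFDeriv ℝ l φ t := by
    have : iteratedFDeriv ℝ l (⇑(SchwartzMap.compSubConstCLM ℂ a φ - φ)) t = _ :=
      iteratedFDeriv_sub_apply (𝕜 := ℝ) (i := l) (f := SchwartzMap.compSubConstCLM ℂ a φ) (g := φ)
        (x := t) ((SchwartzMap.smooth _ l).contDiffAt) ((SchwartzMap.smooth _ l).contDiffAt)
    rw [this, SchwartzMap.iteratedFDeriv_compSubConst]
  rw [e]
  set K := 2 ^ k * (SchwartzMap.seminorm ℂ k (l + 1) φ + SchwartzMap.seminorm ℂ 0 (l + 1) φ)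
  have hK : 0 ≤ K := by positivity
  have hd : Differentiable ℝ (iteratedFDeriv ℝ l φ) :=
    (φ.smooth ⊤).differentiable_iteratedFDeriv (mod_cast (ENat.natCast_lt_top l))
  have hmv : ‖(‖t‖ ^ k) • (iteratedFDeriv ℝ l φ (t - a)) - (‖t‖ ^ k) • (iteratedFDeriv ℝ l φ t)‖ ≤
      (2 ^ k * K) * ‖(t - a) - t‖ := by
    refine (convex_closedBall t 1).norm_image_sub_le_of_norm_fderiv_le (𝕜 := ℝ)
      (f := fun y => (‖t‖ ^ k) • (iteratedFDeriv ℝ l φ y))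
      (fun y _ => (hd y).fun_const_smul _) (fun y hy => ?_) (by simp) (by simpa using ha)
    have : fderiv ℝ (fun y => (‖t‖ ^ k) • (iteratedFDeriv ℝ l φ y)) y =
        (‖t‖ ^ k) • fderiv ℝ (iteratedFDeriv ℝ l φ) y := fderiv_fun_const_smul (hd y) _
    rw [this, norm_smul, norm_fderiv_iteratedFDeriv, norm_pow, norm_norm]
    have h1 : ‖t‖ ≤ 2 * (1 + ‖y‖) := by
      rw [Metric.mem_closedBall, dist_eq_norm] at hy
      have := norm_sub_norm_le t y
      rw [norm_sub_rev] at this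
      linarith [norm_nonneg y]
    calc ‖t‖ ^ k * ‖iteratedFDeriv ℝ (l + 1) φ y‖
        ≤ (2 * (1 + ‖y‖)) ^ k * ‖iteratedFDeriv ℝ (l + 1) φ y‖ := by gcongr
      _ = 2 ^ k * ((1 + ‖y‖) ^ k * ‖iteratedFDeriv ℝ (l + 1) φ y‖) := by rw [mul_pow, mul_assoc]
      _ ≤ _ := mul_le_mul_of_nonneg_left (SchwartzMap.one_add_norm_pow_mul_le k (l + 1) φ y)
        (by positivity)
  rw [← smul_sub, norm_smul, norm_pow, norm_norm, sub_sub_cancel_left, norm_neg] at hmv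
  exact hmv

/-- Continuity at the origin is the preceding estimate. The group law `T_a = T_b T_{a-b}` carries it
to every point. -/
lemma SchwartzMap.continuous_compSubConst (φ : 𝓢(V, ℂ)) :
    Continuous fun a : V => SchwartzMap.compSubConstCLM ℂ a φ := by
  have h0 : Filter.Tendsto (fun a : V => SchwartzMap.compSubConstCLM ℂ a φ) (nhds 0) (nhds φ) := by
    rw [(schwartz_withSeminorms ℂ V ℂ).tendsto_nhds]
    rintro ⟨k, l⟩ ε hε
    set K := 2 ^ k * (2 ^ k * (SchwartzMap.seminorm ℂ k (l + 1) φ +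
      SchwartzMap.seminorm ℂ 0 (l + 1) φ))
    have hlim : Filter.Tendsto (fun a : V => K * ‖a‖) (nhds 0) (nhds 0) := by
      have : Continuous fun a : V => K * ‖a‖ := by fun_prop
      simpa using this.tendsto 0
    filter_upwards [hlim.eventually (gt_mem_nhds hε), Metric.ball_mem_nhds (0 : V) zero_lt_one]
      with a ha hb
    exact (SchwartzMap.seminorm_compSubConst_sub_le k l φ a (by simpa using (mem_ball_zero_iff.1 hb).le)).trans_lt ha
  rw [continuous_iff_continuousAt]
  intro b
  have e : (fun a : V => SchwartzMap.compSubConstCLM ℂ a φ) =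
      fun a => SchwartzMap.compSubConstCLM ℂ b (SchwartzMap.compSubConstCLM ℂ (a - b) φ) := by
    funext a
    rw [SchwartzMap.compSubConstCLM_comp, sub_add_cancel]
  rw [ContinuousAt, e]
  have h1 : Filter.Tendsto (fun a : V => a - b) (nhds b) (nhds 0) := by
    have : Continuous fun a : V => a - b := by fun_prop
    simpa using this.tendsto b
  exact ((SchwartzMap.compSubConstCLM ℂ b).continuous.tendsto _).comp (h0.comp h1)

variable {n : Type*} [Fintype n]

lemma norm_modChar (ξ t : EuclideanSpace ℝ n) : ‖modChar ξ t‖ = 1 := by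
  rw [modChar, Complex.norm_exp_ofReal_mul_I]

lemma fourierChar_eq_modChar (t η : EuclideanSpace ℝ n) :
    ((Real.fourierChar (-⟪t, η⟫) : Circle) : ℂ) = modChar (-η) t := by
  rw [Real.fourierChar_apply, modChar, inner_neg_left, real_inner_comm]

lemma modChar_add (ξ η t : EuclideanSpace ℝ n) : modChar (ξ + η) t = modChar ξ t * modChar η t := by
  rw [modChar, modChar, modChar, ← Complex.exp_add, inner_add_left]
  push_cast; ring_nf

lemma modChar_add_right (ξ s t : EuclideanSpace ℝ n) :
    modChar ξ (s + t) = modChar ξ s * modChar ξ t := by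
  rw [modChar, modChar, modChar, ← Complex.exp_add, inner_add_right]
  push_cast; ring_nf

lemma SchwartzMap.fourier_apply_eq_modChar (φ : 𝓢(EuclideanSpace ℝ n, ℂ)) (η : EuclideanSpace ℝ n) :
    𝓕 φ η = ∫ t, modChar (-η) t * φ t := by
  rw [SchwartzMap.fourier_coe, Real.fourier_eq]
  congr 1; ext t
  rw [Circle.smul_def, fourierChar_eq_modChar, smul_eq_mul]

/-- The modulation `φ ↦ e^{2πi ξ·t} φ(t)` as a map of Schwartz functions. -/
noncomputable def modShift (ξ : EuclideanSpace ℝ n) :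
    𝓢(EuclideanSpace ℝ n, ℂ) →L[ℂ] 𝓢(EuclideanSpace ℝ n, ℂ) :=
  SchwartzMap.smulLeftCLM ℂ (modChar ξ)

lemma modShift_apply (ξ : EuclideanSpace ℝ n) (φ : 𝓢(EuclideanSpace ℝ n, ℂ))
    (t : EuclideanSpace ℝ n) : modShift ξ φ t = modChar ξ t * φ t := by
  simp [modShift, SchwartzMap.smulLeftCLM_apply_apply (modChar_hasTemperateGrowth ξ)]

lemma tfShift_eq (x ξ : EuclideanSpace ℝ n) (φ : 𝓢(EuclideanSpace ℝ n, ℂ)) :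
    tfShift x ξ φ = modShift ξ (SchwartzMap.compSubConstCLM ℂ x φ) := rfl

lemma fourier_modShift (ξ : EuclideanSpace ℝ n) (φ : 𝓢(EuclideanSpace ℝ n, ℂ)) :
    𝓕 (modShift ξ φ) = SchwartzMap.compSubConstCLM ℂ ξ (𝓕 φ) := by
  ext η
  rw [SchwartzMap.compSubConstCLM_apply, SchwartzMap.fourier_apply_eq_modChar,
    SchwartzMap.fourier_apply_eq_modChar]
  congr 1; ext t
  rw [modShift_apply, ← mul_assoc, ← modChar_add]
  congr 2; abel

lemma modShift_eq_fourierInv (ξ : EuclideanSpace ℝ n) (φ : 𝓢(EuclideanSpace ℝ n, ℂ)) :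
    modShift ξ φ = 𝓕⁻ (SchwartzMap.compSubConstCLM ℂ ξ (𝓕 φ)) := by
  rw [← fourier_modShift, FourierTransform.fourierInv_fourier_eq]

/-- The Fourier transform conjugates modulations into translations, so the bound for translations is
reused and no derivative of the character has to be estimated. -/
lemma exists_seminorm_modShift_le (p : Seminorm ℂ 𝓢(EuclideanSpace ℝ n, ℂ)) (hp : Continuous p) :
    ∃ (N : ℕ) (q : Seminorm ℂ 𝓢(EuclideanSpace ℝ n, ℂ)), Continuous q ∧
      ∀ ξ φ, p (modShift ξ φ) ≤ (1 + ‖ξ‖) ^ N * q φ := by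
  let Fi := FourierTransform.fourierInvCLM ℂ 𝓢(EuclideanSpace ℝ n, ℂ)
  let Fo := FourierTransform.fourierCLM ℂ 𝓢(EuclideanSpace ℝ n, ℂ)
  obtain ⟨N, q, hq, h⟩ := SchwartzMap.exists_seminorm_compSubConst_le (p.comp Fi.toLinearMap)
    (hp.comp Fi.continuous)
  refine ⟨N, q.comp Fo.toLinearMap, hq.comp Fo.continuous, fun ξ φ => ?_⟩
  rw [modShift_eq_fourierInv]
  exact h ξ (𝓕 φ)

lemma continuous_modShift (φ : 𝓢(EuclideanSpace ℝ n, ℂ)) :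
    Continuous fun ξ : EuclideanSpace ℝ n => modShift ξ φ := by
  simp only [modShift_eq_fourierInv]
  exact (FourierTransform.fourierInvCLM ℂ 𝓢(EuclideanSpace ℝ n, ℂ)).continuous.comp
    (SchwartzMap.continuous_compSubConst _)

/-- Write the increment as `M_ξ(T_x φ - T_{x₀} φ) + (M_ξ - M_{ξ₀}) T_{x₀} φ`. Polynomial control of
the modulations handles the first term, strong continuity the second. -/
lemma continuous_tfShift (φ : 𝓢(EuclideanSpace ℝ n, ℂ)) :
    Continuous fun z : EuclideanSpace ℝ n × EuclideanSpace ℝ n => tfShift z.1 z.2 φ := by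
  rw [continuous_iff_continuousAt]
  rintro ⟨x₀, ξ₀⟩
  rw [ContinuousAt, (schwartz_withSeminorms ℂ _ ℂ).tendsto_nhds]
  intro i ε hε
  have hpc := (schwartz_withSeminorms ℂ (EuclideanSpace ℝ n) ℂ).continuous_seminorm i
  set p := schwartzSeminormFamily ℂ (EuclideanSpace ℝ n) ℂ i
  obtain ⟨N, q, hq, h⟩ := exists_seminorm_modShift_le p hpc
  set ψ := SchwartzMap.compSubConstCLM ℂ x₀ φ
  have hcont : Continuous fun z : EuclideanSpace ℝ n × EuclideanSpace ℝ n =>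
      (1 + ‖z.2‖) ^ N * q (SchwartzMap.compSubConstCLM ℂ z.1 φ - ψ) +
        p (modShift z.2 ψ - modShift ξ₀ ψ) := by
    have c1 := (SchwartzMap.continuous_compSubConst φ).comp
      (continuous_fst : Continuous (Prod.fst : EuclideanSpace ℝ n × EuclideanSpace ℝ n → _))
    have c2 := (continuous_modShift ψ).comp
      (continuous_snd : Continuous (Prod.snd : EuclideanSpace ℝ n × EuclideanSpace ℝ n → _))
    exact ((continuous_const.add continuous_snd.norm).pow N |>.mul
      (hq.comp (c1.sub continuous_const))).add (hpc.comp (c2.sub continuous_const))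
  have hlim := hcont.tendsto (x₀, ξ₀)
  simp only [ψ, sub_self, map_zero, mul_zero, add_zero] at hlim
  filter_upwards [hlim.eventually (gt_mem_nhds hε)] with z hz
  refine lt_of_le_of_lt ?_ hz
  have e : tfShift z.1 z.2 φ - tfShift x₀ ξ₀ φ =
      modShift z.2 (SchwartzMap.compSubConstCLM ℂ z.1 φ - ψ) + (modShift z.2 ψ - modShift ξ₀ ψ) := by
    rw [tfShift_eq, tfShift_eq, map_sub]; abel
  rw [e]
  exact (map_add_le_add p _ _).trans (add_le_add_left (h _ _) _)

lemma exists_seminorm_tfShift_le (p : Seminorm ℂ 𝓢(EuclideanSpace ℝ n, ℂ)) (hp : Continuous p) :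
    ∃ (N : ℕ) (q : Seminorm ℂ 𝓢(EuclideanSpace ℝ n, ℂ)), Continuous q ∧
      ∀ (z : EuclideanSpace ℝ n × EuclideanSpace ℝ n) φ,
        p (tfShift z.1 z.2 φ) ≤ (1 + ‖z‖) ^ N * q φ := by
  obtain ⟨N, q, hq, h⟩ := exists_seminorm_modShift_le p hp
  obtain ⟨N', q', hq', h'⟩ := SchwartzMap.exists_seminorm_compSubConst_le q hq
  refine ⟨N + N', q', hq', fun z φ => ?_⟩
  calc p (tfShift z.1 z.2 φ) ≤ (1 + ‖z.2‖) ^ N * ((1 + ‖z.1‖) ^ N' * q' φ) := by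
        rw [tfShift_eq]
        exact (h _ _).trans (by gcongr; exact h' _ _)
    _ ≤ (1 + ‖z‖) ^ N * ((1 + ‖z‖) ^ N' * q' φ) := by
        gcongr
        · exact norm_snd_le z
        · exact norm_fst_le z
    _ = _ := by ring

end Translations

/-! ### The short-time Fourier transform of tempered distributions -/

section STFT

open scoped FourierTransform ComplexConjugate

variable {n : Type} [Fintype n]

instance : (volume : Measure (EuclideanSpace ℝ n × EuclideanSpace ℝ n)).HasTemperateGrowth := by
  rw [Measure.volume_eq_prod]
  have : (volume.prod volume : Measure (EuclideanSpace ℝ n × EuclideanSpace ℝ n)).IsAddHaarMeasure :=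
    inferInstance
  exact Measure.IsAddHaarMeasure.instHasTemperateGrowth

/-- A Schwartz function, as a tempered distribution. -/
noncomputable abbrev asDist (ψ : 𝓢(EuclideanSpace ℝ n, ℂ)) : 𝓢'(EuclideanSpace ℝ n, ℂ) :=
  SchwartzMap.toTemperedDistributionCLM (EuclideanSpace ℝ n) ℂ volume ψ

/-- The `L²` inner product `∫ ψ(t) conj(γ(t)) dt` of Schwartz functions. -/
noncomputable def schwartzInner (ψ γ : 𝓢(EuclideanSpace ℝ n, ℂ)) : ℂ := ∫ t, ψ t * conj (γ t)

lemma sesq_asDist (ψ γ : 𝓢(EuclideanSpace ℝ n, ℂ)) : sesq (asDist ψ) γ = schwartzInner ψ γ := by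
  rw [sesq, asDist, SchwartzMap.toTemperedDistributionCLM_apply_apply volume ψ (conjSchwartz γ), schwartzInner]
  congr 1; ext t
  rw [conjSchwartz_apply, smul_eq_mul, mul_comm]

lemma conjSchwartz_conjSchwartz (φ : 𝓢(EuclideanSpace ℝ n, ℂ)) :
    conjSchwartz (conjSchwartz φ) = φ := by
  ext t; simp [conjSchwartz_apply]

lemma conjSchwartz_smul (c : ℂ) (φ : 𝓢(EuclideanSpace ℝ n, ℂ)) :
    conjSchwartz (c • φ) = conj c • conjSchwartz φ := by
  ext t; simp [conjSchwartz_apply]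

lemma conj_modChar (ξ t : EuclideanSpace ℝ n) : conj (modChar ξ t) = modChar (-ξ) t := by
  rw [modChar, modChar, ← Complex.exp_conj, inner_neg_left, map_mul, Complex.conj_ofReal,
    Complex.conj_I]
  congr 1
  push_cast; ring

lemma conjSchwartz_tfShift (x ξ : EuclideanSpace ℝ n) (φ : 𝓢(EuclideanSpace ℝ n, ℂ)) :
    conjSchwartz (tfShift x ξ φ) = tfShift x (-ξ) (conjSchwartz φ) := by
  ext t
  simp [conjSchwartz_apply, tfShift_apply, conj_modChar]

lemma continuous_conjSchwartz :
    Continuous (conjSchwartz : 𝓢(EuclideanSpace ℝ n, ℂ) → 𝓢(EuclideanSpace ℝ n, ℂ)) :=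
  (SchwartzMap.postcompCLM (𝕜 := ℝ) (Complex.conjCLE : ℂ →L[ℝ] ℂ)).continuous

lemma sesq_smul (f : 𝓢'(EuclideanSpace ℝ n, ℂ)) (c : ℂ) (φ : 𝓢(EuclideanSpace ℝ n, ℂ)) :
    sesq f (c • φ) = conj c * sesq f φ := by
  rw [sesq, conjSchwartz_smul, map_smul, smul_eq_mul, sesq]

lemma continuous_stft (φ : 𝓢(EuclideanSpace ℝ n, ℂ)) (f : 𝓢'(EuclideanSpace ℝ n, ℂ)) :
    Continuous (stft φ f) :=
  (f.continuous.comp continuous_conjSchwartz).comp (continuous_tfShift φ)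

lemma exists_norm_stft_le (φ : 𝓢(EuclideanSpace ℝ n, ℂ)) (f : 𝓢'(EuclideanSpace ℝ n, ℂ)) :
    ∃ (C : ℝ) (N : ℕ), 0 ≤ C ∧ ∀ z, ‖stft φ f z‖ ≤ C * (1 + ‖z‖) ^ N := by
  obtain ⟨N, q, -, hq⟩ := exists_seminorm_tfShift_le ((normSeminorm ℂ ℂ).comp f.toLinearMap)
    f.continuous.norm
  refine ⟨q (conjSchwartz φ), N, apply_nonneg _ _, fun z => ?_⟩
  have h := hq (z.1, -z.2) (conjSchwartz φ)
  have e : ‖(z.1, -z.2)‖ = ‖z‖ := by simp [Prod.norm_def]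
  rw [e, mul_comm] at h
  rw [stft, sesq, conjSchwartz_tfShift]
  exact h

/-- Weighted bound for correlations of Schwartz functions. -/
lemma exists_seminorm_correlation_le (N : ℕ) (γ : 𝓢(EuclideanSpace ℝ n, ℂ)) :
    ∃ q : Seminorm ℂ 𝓢(EuclideanSpace ℝ n, ℂ), Continuous q ∧
      ∀ ψ x, (1 + ‖x‖) ^ N * ∫ t, ‖ψ t‖ * ‖γ (t - x)‖ ≤ q ψ := by
  obtain ⟨M, hM⟩ := (inferInstance :
    (volume : Measure (EuclideanSpace ℝ n)).HasTemperateGrowth).exists_integrable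
  set J := ∫ t : EuclideanSpace ℝ n, (1 + ‖t‖) ^ (-(M : ℝ))
  have hJ : 0 ≤ J := integral_nonneg fun t => by positivity
  set K := 2 ^ N * (SchwartzMap.seminorm ℂ N 0 γ + SchwartzMap.seminorm ℂ 0 0 γ)
  have hK0 : 0 ≤ K := by positivity
  have hK : ∀ t, (1 + ‖t‖) ^ N * ‖γ t‖ ≤ K := fun t => by
    simpa using SchwartzMap.one_add_norm_pow_mul_le N 0 γ t
  let c : NNReal := ⟨K * J * 2 ^ (N + M), by positivity⟩
  have hcs : ∀ k l, Continuous
      (SchwartzMap.seminorm ℂ k l : Seminorm ℂ 𝓢(EuclideanSpace ℝ n, ℂ)) := fun k l =>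
    (schwartz_withSeminorms ℂ _ ℂ).continuous_seminorm (k, l)
  have hval : ∀ ψ, (c • (SchwartzMap.seminorm ℂ (N + M) 0 + SchwartzMap.seminorm ℂ 0 0) :
      Seminorm ℂ 𝓢(EuclideanSpace ℝ n, ℂ)) ψ =
      K * J * (2 ^ (N + M) * (SchwartzMap.seminorm ℂ (N + M) 0 ψ + SchwartzMap.seminorm ℂ 0 0 ψ)) := by
    intro ψ
    have hc : (c : ℝ) = K * J * 2 ^ (N + M) := rfl
    rw [smul_apply, add_apply, NNReal.smul_def, smul_eq_mul, hc]
    ring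
  refine ⟨c • (SchwartzMap.seminorm ℂ (N + M) 0 + SchwartzMap.seminorm ℂ 0 0), ?_, fun ψ x => ?_⟩
  · have := funext hval
    rw [this]
    exact continuous_const.mul (continuous_const.mul ((hcs _ _).add (hcs _ _)))
  · rw [hval, ← integral_const_mul]
    set S := 2 ^ (N + M) * (SchwartzMap.seminorm ℂ (N + M) 0 ψ + SchwartzMap.seminorm ℂ 0 0 ψ)
    have hS0 : 0 ≤ S := by positivity
    have hS : ∀ t, (1 + ‖t‖) ^ (N + M) * ‖ψ t‖ ≤ S := fun t => by
      simpa using SchwartzMap.one_add_norm_pow_mul_le (N + M) 0 ψ t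
    calc ∫ t, (1 + ‖x‖) ^ N * (‖ψ t‖ * ‖γ (t - x)‖)
        ≤ ∫ t, K * S * (1 + ‖t‖) ^ (-(M : ℝ)) := by
          refine integral_mono_of_nonneg (Filter.Eventually.of_forall fun t => by positivity)
            (hM.const_mul _) (Filter.Eventually.of_forall fun t => ?_)
          have h1 : 1 + ‖x‖ ≤ (1 + ‖t‖) * (1 + ‖t - x‖) := by
            have := one_add_norm_le_mul t (x - t)
            rwa [add_sub_cancel, norm_sub_rev x t] at this
          have h2 : ‖ψ t‖ * (1 + ‖t‖) ^ N ≤ S * (1 + ‖t‖) ^ (-(M : ℝ)) := by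
            rw [Real.rpow_neg (by positivity), Real.rpow_natCast, ← div_eq_mul_inv,
              le_div_iff₀ (by positivity)]
            calc ‖ψ t‖ * (1 + ‖t‖) ^ N * (1 + ‖t‖) ^ M = (1 + ‖t‖) ^ (N + M) * ‖ψ t‖ := by
                  rw [pow_add]; ring
              _ ≤ S := hS t
          calc (1 + ‖x‖) ^ N * (‖ψ t‖ * ‖γ (t - x)‖)
              ≤ ((1 + ‖t‖) * (1 + ‖t - x‖)) ^ N * (‖ψ t‖ * ‖γ (t - x)‖) := by gcongr
            _ = (‖ψ t‖ * (1 + ‖t‖) ^ N) * ((1 + ‖t - x‖) ^ N * ‖γ (t - x)‖) := by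
                rw [mul_pow]; ring
            _ ≤ (S * (1 + ‖t‖) ^ (-(M : ℝ))) * K :=
                mul_le_mul h2 (hK _) (by positivity) (by positivity)
            _ = K * S * (1 + ‖t‖) ^ (-(M : ℝ)) := by ring
      _ = K * J * S := by rw [integral_const_mul]; ring

lemma stft_asDist (φ ψ : 𝓢(EuclideanSpace ℝ n, ℂ))
    (z : EuclideanSpace ℝ n × EuclideanSpace ℝ n) :
    stft φ (asDist ψ) z = schwartzInner ψ (tfShift z.1 z.2 φ) := sesq_asDist _ _

lemma norm_schwartzInner_le (ψ γ : 𝓢(EuclideanSpace ℝ n, ℂ)) :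
    ‖schwartzInner ψ γ‖ ≤ ∫ t, ‖ψ t‖ * ‖γ t‖ := by
  refine (norm_integral_le_integral_norm _).trans (le_of_eq ?_)
  congr 1; ext t
  rw [norm_mul, RCLike.norm_conj]

lemma schwartzInner_fourier (ψ γ : 𝓢(EuclideanSpace ℝ n, ℂ)) :
    schwartzInner (𝓕 ψ) (𝓕 γ) = schwartzInner ψ γ := by
  have := SchwartzMap.integral_sesq_fourier_fourier γ ψ (innerSL ℂ : ℂ →L⋆[ℂ] ℂ →L[ℂ] ℂ)
  simpa [schwartzInner, mul_comm] using this

lemma norm_tfShift_apply (x ξ : EuclideanSpace ℝ n) (φ : 𝓢(EuclideanSpace ℝ n, ℂ))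
    (t : EuclideanSpace ℝ n) : ‖tfShift x ξ φ t‖ = ‖φ (t - x)‖ := by
  rw [tfShift_apply, norm_mul, norm_modChar, one_mul]

lemma norm_fourier_compSubConst (x : EuclideanSpace ℝ n) (φ : 𝓢(EuclideanSpace ℝ n, ℂ))
    (η : EuclideanSpace ℝ n) :
    ‖𝓕 (SchwartzMap.compSubConstCLM ℂ x φ) η‖ = ‖𝓕 φ η‖ := by
  rw [SchwartzMap.fourier_apply_eq_modChar, SchwartzMap.fourier_apply_eq_modChar]
  have : ∀ t, modChar (-η) t * SchwartzMap.compSubConstCLM ℂ x φ t =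
      modChar (-η) x * (modChar (-η) (t - x) * φ (t - x)) := by
    intro t
    rw [SchwartzMap.compSubConstCLM_apply, ← mul_assoc, ← modChar_add_right, add_sub_cancel]
  simp_rw [this]
  rw [integral_const_mul, integral_sub_right_eq_self (fun t => modChar (-η) t * φ t), norm_mul,
    norm_modChar, one_mul]

/-- Rapid decay of the short-time Fourier transform of Schwartz functions. -/
lemma exists_seminorm_stft_le (N : ℕ) (γ : 𝓢(EuclideanSpace ℝ n, ℂ)) :
    ∃ q : Seminorm ℂ 𝓢(EuclideanSpace ℝ n, ℂ), Continuous q ∧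
      ∀ ψ z, (1 + ‖z‖) ^ N * ‖stft γ (asDist ψ) z‖ ≤ q ψ := by
  obtain ⟨q₁, hq₁, h₁⟩ := exists_seminorm_correlation_le N γ
  obtain ⟨q₂, hq₂, h₂⟩ := exists_seminorm_correlation_le N (𝓕 γ)
  let Fo := FourierTransform.fourierCLM ℂ 𝓢(EuclideanSpace ℝ n, ℂ)
  refine ⟨q₁ + q₂.comp Fo.toLinearMap, hq₁.add (hq₂.comp Fo.continuous), fun ψ z => ?_⟩
  have e : (q₁ + q₂.comp Fo.toLinearMap) ψ = q₁ ψ + q₂ (𝓕 ψ) := rfl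
  rw [e, stft_asDist]
  have b₁ : (1 + ‖z.1‖) ^ N * ‖schwartzInner ψ (tfShift z.1 z.2 γ)‖ ≤ q₁ ψ := by
    refine le_trans ?_ (h₁ ψ z.1)
    gcongr
    refine (norm_schwartzInner_le _ _).trans (le_of_eq ?_)
    simp_rw [norm_tfShift_apply]
  -- Decay in frequency is decay in time for the Fourier transforms: Parseval exchanges the two
  -- roles.
  have b₂ : (1 + ‖z.2‖) ^ N * ‖schwartzInner ψ (tfShift z.1 z.2 γ)‖ ≤ q₂ (𝓕 ψ) := by
    refine le_trans ?_ (h₂ (𝓕 ψ) z.2)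
    gcongr
    rw [← schwartzInner_fourier]
    refine (norm_schwartzInner_le _ _).trans (le_of_eq ?_)
    simp_rw [tfShift_eq, fourier_modShift, SchwartzMap.compSubConstCLM_apply,
      norm_fourier_compSubConst]
  -- The norm of a pair is the larger of the two norms, so one of the two decay estimates is enough.
  rcases max_choice ‖z.1‖ ‖z.2‖ with h | h
  · rw [Prod.norm_def, h]; linarith [apply_nonneg q₂ (𝓕 ψ)]
  · rw [Prod.norm_def, h]; linarith [apply_nonneg q₁ ψ]

lemma exists_norm_stft_asDist_le (N : ℕ) (γ ψ : 𝓢(EuclideanSpace ℝ n, ℂ)) :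
    ∃ C : ℝ, 0 ≤ C ∧ ∀ z, ‖stft γ (asDist ψ) z‖ ≤ C * (1 + ‖z‖) ^ (-(N : ℝ)) := by
  obtain ⟨q, -, hq⟩ := exists_seminorm_stft_le N γ
  refine ⟨q ψ, apply_nonneg _ _, fun z => ?_⟩
  rw [Real.rpow_neg (by positivity), Real.rpow_natCast, ← div_eq_mul_inv, le_div_iff₀ (by positivity),
    mul_comm]
  exact hq ψ z

/-- A continuous function of polynomial growth is integrable against rapidly decaying ones. -/
lemma integrable_mul_of_growth_of_decay {V : Type*} [NormedAddCommGroup V] [NormedSpace ℝ V]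
    [FiniteDimensional ℝ V] [MeasurableSpace V] [BorelSpace V] {μ : Measure V}
    [μ.HasTemperateGrowth] {F G : V → ℂ}
    (hF : AEStronglyMeasurable F μ) (hG : AEStronglyMeasurable G μ)
    (hFg : ∃ (C : ℝ) (N : ℕ), 0 ≤ C ∧ ∀ z, ‖F z‖ ≤ C * (1 + ‖z‖) ^ N)
    (hGd : ∀ N : ℕ, ∃ C : ℝ, 0 ≤ C ∧ ∀ z, ‖G z‖ ≤ C * (1 + ‖z‖) ^ (-(N : ℝ))) :
    Integrable (fun z => F z * G z) μ := by
  obtain ⟨C, N, hC, hF'⟩ := hFg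
  obtain ⟨M, hM⟩ := (inferInstance : μ.HasTemperateGrowth).exists_integrable
  obtain ⟨D, hD, hG'⟩ := hGd (N + M)
  refine Integrable.mono' (hM.const_mul (C * D)) (hF.mul hG)
    (Filter.Eventually.of_forall fun z => ?_)
  have h : (1 + ‖z‖) ^ (-((N + M : ℕ) : ℝ)) * (1 + ‖z‖) ^ N = (1 + ‖z‖) ^ (-(M : ℝ)) := by
    rw [← Real.rpow_natCast, ← Real.rpow_add (by positivity)]
    congr 1; push_cast; ring
  calc ‖F z * G z‖ ≤ (C * (1 + ‖z‖) ^ N) * (D * (1 + ‖z‖) ^ (-((N + M : ℕ) : ℝ))) := by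
        rw [norm_mul]; exact mul_le_mul (hF' z) (hG' z) (norm_nonneg _) (by positivity)
    _ = C * D * ((1 + ‖z‖) ^ (-((N + M : ℕ) : ℝ)) * (1 + ‖z‖) ^ N) := by ring
    _ = _ := by rw [h]

lemma schwartz_mul_conj_shift (ψ γ : 𝓢(EuclideanSpace ℝ n, ℂ)) (x : EuclideanSpace ℝ n) :
    ∃ θ : 𝓢(EuclideanSpace ℝ n, ℂ), ∀ t, θ t = conj (γ (t - x)) * ψ t := by
  let g := conjSchwartz (SchwartzMap.compSubConstCLM ℂ x γ)
  refine ⟨SchwartzMap.smulLeftCLM ℂ g ψ, fun t => ?_⟩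
  rw [SchwartzMap.smulLeftCLM_apply_apply g.hasTemperateGrowth]
  simp [g, conjSchwartz_apply]

/-- Pointwise inversion of the short-time Fourier transform of Schwartz functions. -/
lemma integral_stft_mul_tfShift (γ φ ψ : 𝓢(EuclideanSpace ℝ n, ℂ)) (t : EuclideanSpace ℝ n) :
    ∫ z, stft γ (asDist ψ) z * tfShift z.1 z.2 φ t = ψ t * schwartzInner φ γ := by
  have hcont : Continuous fun z : EuclideanSpace ℝ n × EuclideanSpace ℝ n => tfShift z.1 z.2 φ t :=
    (SchwartzMap.continuous_eval t).comp (continuous_tfShift φ)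
  have hint : Integrable fun z => tfShift z.1 z.2 φ t * stft γ (asDist ψ) z := by
    refine integrable_mul_of_growth_of_decay (hcont.aestronglyMeasurable)
      (continuous_stft _ _).aestronglyMeasurable
      ⟨SchwartzMap.seminorm ℂ 0 0 φ, 0, apply_nonneg _ _, fun z => ?_⟩
      (fun N => exists_norm_stft_asDist_le N γ ψ)
    rw [norm_tfShift_apply]
    simpa using SchwartzMap.norm_le_seminorm ℂ φ _
  simp_rw [mul_comm (tfShift _ _ φ t)] at hint
  rw [Measure.volume_eq_prod, integral_prod _ hint]
  -- For fixed `x` the transform is the Fourier transform of `s ↦ conj(γ(s - x)) ψ(s)`. Fourier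
  -- inversion in `ξ` thus leaves an elementary integral over `x`.
  have inner_eq : ∀ x, ∫ ξ, stft γ (asDist ψ) (x, ξ) * tfShift x ξ φ t =
      φ (t - x) * conj (γ (t - x)) * ψ t := by
    intro x
    obtain ⟨θ, hθ⟩ := schwartz_mul_conj_shift ψ γ x
    have hs : ∀ ξ, stft γ (asDist ψ) (x, ξ) = 𝓕 θ ξ := by
      intro ξ
      rw [stft_asDist, SchwartzMap.fourier_apply_eq_modChar, schwartzInner]
      congr 1; ext s
      rw [hθ, tfShift_apply, map_mul, conj_modChar]; ring
    have hi : 𝓕⁻ (𝓕 θ) t = θ t := by rw [FourierTransform.fourierInv_fourier_eq]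
    have hinv : ∫ ξ, 𝓕 θ ξ * modChar ξ t = θ t := by
      rw [← hi, SchwartzMap.fourierInv_coe, Real.fourierInv_eq]
      congr 1; ext ξ
      rw [Circle.smul_def, smul_eq_mul, mul_comm, modChar, Real.fourierChar_apply]
    simp_rw [hs, tfShift_apply, ← mul_assoc]
    rw [integral_mul_const, hinv, hθ]; ring
  simp_rw [inner_eq]
  rw [integral_mul_const, integral_sub_left_eq_self (fun s => φ s * conj (γ s)), schwartzInner,
    mul_comm]

/-- Moyal's formula for a tempered distribution and Schwartz functions. -/
theorem integral_stft_mul_conj_stft (f : 𝓢'(EuclideanSpace ℝ n, ℂ))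
    (φ γ ψ : 𝓢(EuclideanSpace ℝ n, ℂ)) :
    Integrable (fun z => stft φ f z * conj (stft γ (asDist ψ) z)) ∧
    ∫ z, stft φ f z * conj (stft γ (asDist ψ) z) = sesq f ψ * schwartzInner γ φ := by
  -- The inversion formula expresses a multiple of `conj ψ` as the integral of this Schwartz-valued
  -- function. It converges in every seminorm, since shifts grow polynomially while the transform of
  -- `ψ` decays rapidly, and `f` may be applied under the integral.
  let h : EuclideanSpace ℝ n × EuclideanSpace ℝ n → 𝓢(EuclideanSpace ℝ n, ℂ) := fun z =>
    conj (stft γ (asDist ψ) z) • conjSchwartz (tfShift z.1 z.2 φ)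
  have hc : Continuous h := by
    have h1 : Continuous fun z => conj (stft γ (asDist ψ) z) :=
      Complex.continuous_conj.comp (continuous_stft γ (asDist ψ))
    exact h1.smul (continuous_conjSchwartz.comp (continuous_tfShift φ))
  have hi : ∀ k l, Integrable fun z => SchwartzMap.seminorm ℝ k l (h z) := by
    intro k l
    have hpc := (schwartz_withSeminorms ℂ (EuclideanSpace ℝ n) ℂ).continuous_seminorm (k, l)
    obtain ⟨N, q, -, hq⟩ := exists_seminorm_tfShift_le _ hpc
    have hg : Integrable fun z => ((SchwartzMap.seminorm ℂ k l (conjSchwartz (tfShift z.1 z.2 φ)) : ℝ) : ℂ) *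
        conj (stft γ (asDist ψ) z) := by
      refine integrable_mul_of_growth_of_decay ?_ ?_
        ⟨q (conjSchwartz φ), N, apply_nonneg _ _, fun z => ?_⟩ (fun N => ?_)
      · exact (Complex.continuous_ofReal.comp
          (hpc.comp (continuous_conjSchwartz.comp (continuous_tfShift φ)))).aestronglyMeasurable
      · exact (Complex.continuous_conj.comp (continuous_stft γ (asDist ψ))).aestronglyMeasurable
      · have e : ‖(z.1, -z.2)‖ = ‖z‖ := by simp [Prod.norm_def]
        have := hq (z.1, -z.2) (conjSchwartz φ)
        rw [e, mul_comm] at this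
        rw [conjSchwartz_tfShift, Complex.norm_real, Real.norm_of_nonneg (apply_nonneg _ _)]
        exact this
      · obtain ⟨C, hC, hb⟩ := exists_norm_stft_asDist_le N γ ψ
        exact ⟨C, hC, fun z => by rw [RCLike.norm_conj]; exact hb z⟩
    refine hg.norm.congr (Filter.Eventually.of_forall fun z => ?_)
    simp only [norm_mul, Complex.norm_real, Real.norm_of_nonneg (apply_nonneg _ _)]
    have e2 : SchwartzMap.seminorm ℝ k l (h z) = SchwartzMap.seminorm ℂ k l (h z) := rfl
    rw [e2, map_smul_eq_mul, mul_comm]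
  have hψ : ∀ t, ∫ z, h z t = (schwartzInner γ φ • conjSchwartz ψ) t := by
    intro t
    have e : ∀ z, h z t = conj (stft γ (asDist ψ) z * tfShift z.1 z.2 φ t) := by
      intro z; simp [h, conjSchwartz_apply]
    simp_rw [e]
    rw [integral_conj, integral_stft_mul_tfShift, smul_apply, smul_eq_mul, map_mul,
      conjSchwartz_apply, mul_comm]
    congr 1
    rw [schwartzInner, schwartzInner, ← integral_conj]
    congr 1; ext s; simp [mul_comm]
  obtain ⟨h1, h2⟩ := SchwartzMap.integral_clm_comp h hc hi _ hψ f.toLinearMap f.continuous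
  have e : ∀ z, f.toLinearMap (h z) = stft φ f z * conj (stft γ (asDist ψ) z) := by
    intro z
    simp only [h, map_smul, smul_eq_mul, mul_comm]
    rfl
  simp_rw [e] at h1 h2
  refine ⟨h1, h2.trans ?_⟩
  rw [map_smul, smul_eq_mul, mul_comm]
  rfl

end STFT

/-! ### Mixed norms -/

section Minkowski

variable {X Y : Type*} [MeasurableSpace X] [MeasurableSpace Y] {μ : Measure Y} {ν : Measure X}

lemma eLpNorm_ennreal_eq {p : ℝ≥0∞} (h0 : p ≠ 0) (ht : p ≠ ∞) (f : X → ℝ≥0∞) :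
    eLpNorm f p ν = (∫⁻ x, f x ^ p.toReal ∂ν) ^ (1 / p.toReal) := by
  rw [eLpNorm_eq_lintegral_rpow_enorm_toReal h0 ht]
  simp only [enorm_eq_self]

lemma ae_le_eLpNorm_top (f : X → ℝ≥0∞) : ∀ᵐ x ∂ν, f x ≤ eLpNorm f ∞ ν := by
  rw [eLpNorm_exponent_top]
  filter_upwards [enorm_ae_le_eLpNormEssSup f ν] with x hx
  simpa using hx

lemma eLpNorm_top_le_iff (f : X → ℝ≥0∞) (a : ℝ≥0∞) :
    eLpNorm f ∞ ν ≤ a ↔ ∀ᵐ x ∂ν, f x ≤ a := by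
  constructor
  · intro h
    filter_upwards [ae_le_eLpNorm_top f] with x hx using hx.trans h
  · intro h
    rw [eLpNorm_exponent_top, eLpNormEssSup]
    exact essSup_le_of_ae_le _ (h.mono fun x hx => by simpa using hx)

lemma eLpNorm_const_mul_le {p : ℝ≥0∞} (c : ℝ≥0∞) {f : X → ℝ≥0∞} (hf : AEMeasurable f ν) :
    eLpNorm (fun x => c * f x) p ν ≤ c * eLpNorm f p ν :=
  eLpNorm_le_mul_eLpNorm_of_ae_le_mul'' p hf.aestronglyMeasurable
    (Filter.Eventually.of_forall fun x => by simp)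

lemma eLpNorm_mono_ennreal {p : ℝ≥0∞} {f g : X → ℝ≥0∞} (h : ∀ᵐ x ∂ν, f x ≤ g x) :
    eLpNorm f p ν ≤ eLpNorm g p ν :=
  eLpNorm_mono_enorm_ae (h.mono fun x hx => by simpa using hx)

/-- A form of Hölder's inequality for a bounded integrable kernel. -/
lemma lintegral_mul_le_eLpNorm_mul {p : ℝ≥0∞} (hp : 1 ≤ p) {f k : X → ℝ≥0∞} (hf : Measurable f)
    (hk : Measurable k) (hk1 : ∀ x, k x ≤ 1) :
    ∫⁻ x, f x * k x ∂ν ≤ eLpNorm f p ν * (∫⁻ x, k x ∂ν) ^ (1 - 1 / p.toReal) := by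
  have hle : ν.withDensity k ≤ ν := by
    conv_rhs => rw [← withDensity_one (μ := ν)]
    exact withDensity_mono (Filter.Eventually.of_forall hk1)
  -- The `L¹` and `Lᵖ` norms are compared for the measure with density `k`, which lies below `ν`
  -- because `k ≤ 1`. At `p = ∞` the conventions `toReal = 0` and `1 / 0 = 0` produce the correct
  -- exponent 1.
  have h := eLpNorm_le_eLpNorm_mul_rpow_measure_univ (μ := ν.withDensity k) hp hf.aestronglyMeasurable
  rw [eLpNorm_one_eq_lintegral_enorm, lintegral_withDensity_eq_lintegral_mul _ hk hf.enorm] at h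
  simp only [Pi.mul_apply, enorm_eq_self, ENNReal.toReal_one, div_one, MeasurableSet.univ,
    withDensity_apply, Measure.restrict_univ] at h
  simp_rw [mul_comm (f _)]
  refine h.trans ?_
  gcongr

variable [SFinite μ] [SFinite ν]

/-- For `p = ∞` the sublevel set at `a` consists of those `y` for which the section of `{F > a}` is
a null set, and the measure of a section is a measurable function. -/
lemma measurable_eLpNorm_left {p : ℝ≥0∞} (hp : p ≠ 0) {F : Y → X → ℝ≥0∞}
    (hF : Measurable (Function.uncurry F)) : Measurable fun y => eLpNorm (F y) p ν := by
  by_cases ht : p = ∞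
  · subst ht
    refine measurable_of_Iic fun a => ?_
    have : (fun y => eLpNorm (F y) ∞ ν) ⁻¹' Set.Iic a =
        (fun y => ν (Prod.mk y ⁻¹' {z | a < Function.uncurry F z})) ⁻¹' {0} := by
      ext y
      simp only [Set.mem_preimage, Set.mem_Iic, Set.mem_singleton_iff]
      rw [eLpNorm_top_le_iff, ae_iff]
      simp [Set.preimage, not_le]
    rw [this]
    exact measurable_measure_prodMk_left (measurableSet_lt measurable_const hF)
      (measurableSet_singleton 0)
  · simp_rw [eLpNorm_ennreal_eq hp ht]
    exact (Measurable.lintegral_prod_right' (f := fun z => Function.uncurry F z ^ p.toReal)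
      (hF.pow_const _)).pow_const _

/-- Minkowski's integral inequality. -/
theorem eLpNorm_lintegral_le {p : ℝ≥0∞} (hp : 1 ≤ p) {F : Y → X → ℝ≥0∞}
    (hF : Measurable (Function.uncurry F)) :
    eLpNorm (fun x => ∫⁻ y, F y x ∂μ) p ν ≤ ∫⁻ y, eLpNorm (F y) p ν ∂μ := by
  have hp0 : p ≠ 0 := (zero_lt_one.trans_le hp).ne'
  set a : Y → ℝ≥0∞ := fun y => eLpNorm (F y) p ν
  have ha : Measurable a := measurable_eLpNorm_left hp0 hF
  by_cases ht : p = ∞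
  · rw [ht, eLpNorm_top_le_iff]
    have h1 : ∀ᵐ y ∂μ, ∀ᵐ x ∂ν, F y x ≤ a y := Filter.Eventually.of_forall fun y => by
      have := ae_le_eLpNorm_top (ν := ν) (F y)
      simpa only [a, ht] using this
    rw [Measure.ae_ae_comm (p := fun y x => F y x ≤ a y)
      (measurableSet_le hF (ha.comp measurable_fst))] at h1
    filter_upwards [h1] with x hx using lintegral_mono_ae hx
  have hpr : 0 < p.toReal := ENNReal.toReal_pos hp0 ht
  have hpr1 : 1 ≤ p.toReal := by
    rw [← ENNReal.toReal_one]; exact ENNReal.toReal_mono ht hp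
  set A := ∫⁻ y, a y ∂μ
  by_cases hA : A = ∞
  · rw [hA]; exact le_top
  have hafin : ∀ᵐ y ∂μ, a y < ∞ := ae_lt_top ha hA
  have hpow : ∀ y, ∫⁻ x, F y x ^ p.toReal ∂ν = a y ^ p.toReal := fun y => by
    simp only [a]
    rw [eLpNorm_ennreal_eq hp0 ht, ← ENNReal.rpow_mul, one_div, inv_mul_cancel₀ hpr.ne',
      ENNReal.rpow_one]
  have hFy : ∀ y, Measurable fun x => F y x ^ p.toReal := fun y =>
    (hF.comp measurable_prodMk_left).pow_const _
  -- The division by `a y` below loses nothing: where `a y = 0`, the function `F y` vanishes almost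
  -- everywhere.
  have hzero : ∀ᵐ x ∂ν, ∀ᵐ y ∂μ, a y = 0 → F y x = 0 := by
    have hms : MeasurableSet {z : Y × X | a z.1 = 0 → F z.1 z.2 = 0} := by
      have : {z : Y × X | a z.1 = 0 → F z.1 z.2 = 0} =
          {z : Y × X | a z.1 = 0}ᶜ ∪ {z | Function.uncurry F z = 0} := by
        ext z; simp [imp_iff_not_or, Function.uncurry]
      rw [this]
      exact ((ha.comp measurable_fst) (measurableSet_singleton 0)).compl.union
        (hF (measurableSet_singleton 0))
    rw [← Measure.ae_ae_comm (p := fun y x => a y = 0 → F y x = 0) hms]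
    refine Filter.Eventually.of_forall fun y => ?_
    by_cases h0 : a y = 0
    · have h1 := hpow y
      rw [h0, ENNReal.zero_rpow_of_pos hpr, lintegral_eq_zero_iff (hFy y)] at h1
      filter_upwards [h1] with x hx _
      simpa [ENNReal.rpow_eq_zero_iff, hpr, hpr.not_gt] using hx
    · exact Filter.Eventually.of_forall fun x h => absurd h h0
  -- For this measure of total mass `A`, the integral of `F` is that of the normalised functions `F
  -- y / a y`, whose `p`-norms are at most one. Comparing `L¹` with `Lᵖ` and applying Tonelli gives
  -- the inequality.
  set κ := μ.withDensity a
  have hκ : κ Set.univ = A := by simp [κ, A]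
  have hG : Measurable fun z : Y × X => F z.1 z.2 / a z.1 := hF.div (ha.comp measurable_fst)
  have hH : ∀ᵐ x ∂ν, ∫⁻ y, F y x ∂μ ≤
      (∫⁻ y, (F y x / a y) ^ p.toReal ∂κ) ^ (1 / p.toReal) * A ^ (1 - 1 / p.toReal) := by
    filter_upwards [hzero] with x hx
    have hGx : Measurable fun y => F y x / a y := hG.comp measurable_prodMk_right
    have e1 : ∫⁻ y, F y x ∂μ = ∫⁻ y, F y x / a y ∂κ := by
      rw [lintegral_withDensity_eq_lintegral_mul _ ha hGx]
      refine lintegral_congr_ae ?_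
      filter_upwards [hx, hafin] with y hy hy'
      by_cases h0 : a y = 0
      · simp [h0, hy h0]
      · simp only [Pi.mul_apply]
        rw [ENNReal.mul_div_cancel h0 hy'.ne]
    have h2 := eLpNorm_le_eLpNorm_mul_rpow_measure_univ (μ := κ) hp hGx.aestronglyMeasurable
    rw [eLpNorm_one_eq_lintegral_enorm, eLpNorm_ennreal_eq hp0 ht, hκ] at h2
    simp only [enorm_eq_self, ENNReal.toReal_one, div_one] at h2
    rw [e1]; exact h2
  have hI : ∫⁻ x, ∫⁻ y, (F y x / a y) ^ p.toReal ∂κ ∂ν ≤ A := by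
    have hm : Measurable fun z : X × Y => (F z.2 z.1 / a z.2) ^ p.toReal :=
      (hG.comp measurable_swap).pow_const _
    rw [lintegral_lintegral_swap (f := fun x y => (F y x / a y) ^ p.toReal) hm.aemeasurable]
    have hm2 : Measurable fun y => ∫⁻ x, (F y x / a y) ^ p.toReal ∂ν :=
      Measurable.lintegral_prod_right' (f := fun z : Y × X => (F z.1 z.2 / a z.1) ^ p.toReal)
        (hG.pow_const _)
    rw [lintegral_withDensity_eq_lintegral_mul _ ha hm2]
    refine lintegral_mono_ae ?_
    filter_upwards [hafin] with y hy
    by_cases h0 : a y = 0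
    · simp [h0]
    · have : ∫⁻ x, (F y x / a y) ^ p.toReal ∂ν = 1 := by
        simp_rw [ENNReal.div_rpow_of_nonneg _ _ hpr.le, div_eq_mul_inv]
        rw [lintegral_mul_const _ (hFy y), hpow]
        refine ENNReal.mul_inv_cancel ?_ ?_
        · simp [ENNReal.rpow_eq_zero_iff, h0, hy.ne]
        · simp [ENNReal.rpow_eq_top_iff, h0, hy.ne]
      simp [this]
  rw [eLpNorm_ennreal_eq hp0 ht]
  calc (∫⁻ x, (∫⁻ y, F y x ∂μ) ^ p.toReal ∂ν) ^ (1 / p.toReal)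
      ≤ (∫⁻ x, (∫⁻ y, (F y x / a y) ^ p.toReal ∂κ) * A ^ (p.toReal - 1) ∂ν) ^ (1 / p.toReal) := by
        refine ENNReal.rpow_le_rpow (lintegral_mono_ae ?_) (by positivity)
        filter_upwards [hH] with x hx
        calc (∫⁻ y, F y x ∂μ) ^ p.toReal
            ≤ ((∫⁻ y, (F y x / a y) ^ p.toReal ∂κ) ^ (1 / p.toReal) *
              A ^ (1 - 1 / p.toReal)) ^ p.toReal := ENNReal.rpow_le_rpow hx hpr.le
          _ = _ := by
            rw [ENNReal.mul_rpow_of_nonneg _ _ hpr.le, ← ENNReal.rpow_mul, ← ENNReal.rpow_mul]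
            congr 1
            · rw [one_div, inv_mul_cancel₀ hpr.ne', ENNReal.rpow_one]
            · congr 1; field_simp
    _ ≤ (A * A ^ (p.toReal - 1)) ^ (1 / p.toReal) := by
        refine ENNReal.rpow_le_rpow ?_ (by positivity)
        rw [lintegral_mul_const]
        · gcongr
        · exact Measurable.lintegral_prod_left' (f := fun z : Y × X => (F z.1 z.2 / a z.1) ^ p.toReal)
            (hG.pow_const _)
    _ = A := by
        by_cases h0 : A = 0
        · simp [h0, hpr]
        · nth_rw 1 [← ENNReal.rpow_one A]
          rw [← ENNReal.rpow_add _ _ h0 hA, add_sub_cancel, ← ENNReal.rpow_mul, mul_one_div,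
            div_self hpr.ne', ENNReal.rpow_one]

end Minkowski

/-! ### Mixed norms on phase space: powers, Young's inequality, linear substitutions -/

section Mixed

variable {d : ℕ}

/-- The mixed norm of a function with values in `[0, ∞]`. -/
noncomputable def mixedENorm (p q : ℝ≥0∞) (B : Rd d × Rd d → ℝ≥0∞) : ℝ≥0∞ :=
  eLpNorm (fun ξ : Rd d => eLpNorm (fun x : Rd d => B (x, ξ)) p volume) q volume

lemma mixedNorm_eq_mixedENorm (p q : ℝ≥0∞) (m : Rd d × Rd d → ℝ) (hm : ∀ z, 0 ≤ m z)
    (F : Rd d × Rd d → ℂ) :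
    mixedNorm p q m F = mixedENorm p q fun z => ‖F z‖ₑ * ENNReal.ofReal (m z) := by
  rw [mixedNorm, mixedENorm]
  congr 1; ext ξ
  rw [← eLpNorm_enorm]
  congr 1; ext x
  rw [enorm_mul, ← ofReal_norm (m (x, ξ) : ℂ), Complex.norm_real,
    Real.norm_of_nonneg (hm (x, ξ))]

variable {p q : ℝ≥0∞} {A B : Rd d × Rd d → ℝ≥0∞}

lemma measurable_inner_eLpNorm (hp : p ≠ 0) (hB : Measurable B) :
    Measurable fun ξ : Rd d => eLpNorm (fun x : Rd d => B (x, ξ)) p volume :=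
  measurable_eLpNorm_left (F := fun ξ x => B (x, ξ)) hp (hB.comp measurable_swap)

lemma mixedENorm_mono (h : ∀ z, A z ≤ B z) : mixedENorm p q A ≤ mixedENorm p q B :=
  eLpNorm_mono_ennreal (Filter.Eventually.of_forall fun _ =>
    eLpNorm_mono_ennreal (Filter.Eventually.of_forall fun _ => h _))

lemma mixedENorm_congr_ae (h : A =ᵐ[volume] B) : mixedENorm p q A = mixedENorm p q B := by
  rw [Measure.volume_eq_prod] at h
  have h2 : ∀ᵐ z : Rd d × Rd d ∂(volume.prod volume), A z.swap = B z.swap :=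
    (Measure.measurePreserving_swap).quasiMeasurePreserving.ae h
  refine eLpNorm_congr_ae ?_
  filter_upwards [Measure.ae_ae_of_ae_prod h2] with ξ hξ
  exact eLpNorm_congr_ae hξ

lemma mixedENorm_const_mul_le (hp : p ≠ 0) (c : ℝ≥0∞) (hB : Measurable B) :
    mixedENorm p q (fun z => c * B z) ≤ c * mixedENorm p q B := by
  refine le_trans (eLpNorm_mono_ennreal (Filter.Eventually.of_forall fun ξ => ?_))
    (eLpNorm_const_mul_le c (measurable_inner_eLpNorm hp hB).aemeasurable)
  exact eLpNorm_const_mul_le c (hB.comp measurable_prodMk_right).aemeasurable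

lemma mixedENorm_lt_top_of_le_mul (hp : p ≠ 0) {c : ℝ≥0∞} (hc : c ≠ ∞) (hB : Measurable B)
    (h : ∀ z, A z ≤ c * B z) (hBf : mixedENorm p q B < ∞) : mixedENorm p q A < ∞ :=
  ((mixedENorm_mono h).trans (mixedENorm_const_mul_le hp c hB)).trans_lt
    (ENNReal.mul_lt_top hc.lt_top hBf)

/-- Taking powers trades a quasi-norm with exponents below one for a norm with exponents at least
one. In this way small `p` and `q` come within reach of Young's inequality. -/
lemma mixedENorm_rpow {r : ℝ} (hr : 0 < r) (B : Rd d × Rd d → ℝ≥0∞) :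
    mixedENorm p q (fun z => B z ^ r) =
      mixedENorm (p * ENNReal.ofReal r) (q * ENNReal.ofReal r) B ^ r := by
  rw [mixedENorm, mixedENorm]
  have h1 : ∀ ξ, eLpNorm (fun x : Rd d => B (x, ξ) ^ r) p volume =
      eLpNorm (fun x : Rd d => B (x, ξ)) (p * ENNReal.ofReal r) volume ^ r := fun ξ => by
    have := eLpNorm_enorm_rpow (p := p) (μ := volume) (fun x : Rd d => B (x, ξ)) hr
    simpa only [enorm_eq_self] using this
  simp_rw [h1]
  have := eLpNorm_enorm_rpow (p := q) (μ := volume) (fun ξ : Rd d =>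
    eLpNorm (fun x : Rd d => B (x, ξ)) (p * ENNReal.ofReal r) volume) hr
  simpa only [enorm_eq_self] using this

lemma eLpNorm_comp_add_right {V : Type*} [NormedAddCommGroup V] [MeasurableSpace V] [BorelSpace V]
    {ν : Measure V} [ν.IsAddRightInvariant] (f : V → ℝ≥0∞) (a : V) :
    eLpNorm (fun x => f (x + a)) p ν = eLpNorm f p ν := by
  conv_rhs => rw [← map_add_right_eq_self ν a]
  rw [(measurableEmbedding_addRight a).eLpNorm_map_measure]
  rfl

/-- Young's inequality for mixed norms. -/
theorem mixedENorm_le_of_le_lintegral (hp : 1 ≤ p) (hq : 1 ≤ q) {k : Rd d × Rd d → ℝ≥0∞}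
    (hk : Measurable k) (hB : Measurable B)
    (h : ∀ z, A z ≤ ∫⁻ u, k u * B (z + u)) :
    mixedENorm p q A ≤ (∫⁻ u, k u) * mixedENorm p q B := by
  have hp0 : p ≠ 0 := (zero_lt_one.trans_le hp).ne'
  set b : Rd d → ℝ≥0∞ := fun ξ => eLpNorm (fun x : Rd d => B (x, ξ)) p volume
  have hb : Measurable b := measurable_inner_eLpNorm hp0 hB
  -- Minkowski's inequality in `x` and translation invariance remove the shift `u.1`. A second
  -- application, in `ξ`, removes `u.2`.
  have h1 : ∀ ξ, eLpNorm (fun x : Rd d => A (x, ξ)) p volume ≤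
      ∫⁻ u : Rd d × Rd d, k u * b (ξ + u.2) := by
    intro ξ
    have hF : Measurable (Function.uncurry fun (u : Rd d × Rd d) (x : Rd d) =>
        k u * B ((x, ξ) + u)) := by
      refine (hk.comp measurable_fst).mul (hB.comp ?_)
      fun_prop
    calc eLpNorm (fun x : Rd d => A (x, ξ)) p volume
        ≤ eLpNorm (fun x : Rd d => ∫⁻ u, k u * B ((x, ξ) + u)) p volume :=
          eLpNorm_mono_ennreal (Filter.Eventually.of_forall fun x => h _)
      _ ≤ ∫⁻ u, eLpNorm (fun x : Rd d => k u * B ((x, ξ) + u)) p volume :=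
          eLpNorm_lintegral_le hp hF
      _ ≤ ∫⁻ u : Rd d × Rd d, k u * b (ξ + u.2) := by
          refine lintegral_mono fun u => ?_
          refine (eLpNorm_const_mul_le (k u) ?_).trans (le_of_eq ?_)
          · exact (hB.comp (by fun_prop : Measurable fun x : Rd d => (x, ξ) + u)).aemeasurable
          · congr 1
            exact eLpNorm_comp_add_right (fun x => B (x, ξ + u.2)) u.1
  have hF : Measurable (Function.uncurry fun (u : Rd d × Rd d) (ξ : Rd d) => k u * b (ξ + u.2)) := by
    refine (hk.comp measurable_fst).mul (hb.comp ?_)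
    fun_prop
  calc mixedENorm p q A
      ≤ eLpNorm (fun ξ => ∫⁻ u : Rd d × Rd d, k u * b (ξ + u.2)) q volume :=
        eLpNorm_mono_ennreal (Filter.Eventually.of_forall h1)
    _ ≤ ∫⁻ u : Rd d × Rd d, eLpNorm (fun ξ => k u * b (ξ + u.2)) q volume :=
        eLpNorm_lintegral_le hq hF
    _ ≤ ∫⁻ u, k u * mixedENorm p q B := by
        refine lintegral_mono fun u => ?_
        refine (eLpNorm_const_mul_le (k u) ?_).trans (le_of_eq ?_)
        · exact (hb.comp (by fun_prop : Measurable fun ξ : Rd d => ξ + u.2)).aemeasurable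
        · rw [eLpNorm_comp_add_right b u.2]; rfl
    _ = _ := lintegral_mul_const _ hk

lemma exists_eLpNorm_comp_linearEquiv_le (p : ℝ≥0∞) (P : Rd d ≃L[ℝ] Rd d) :
    ∃ C : ℝ≥0∞, C ≠ ∞ ∧ ∀ f : Rd d → ℝ≥0∞,
      eLpNorm (fun x => f (P x)) p volume ≤ C * eLpNorm f p volume := by
  have hdet : LinearMap.det (P : Rd d →ₗ[ℝ] Rd d) ≠ 0 :=
    (LinearEquiv.isUnit_det' P.toLinearEquiv).ne_zero
  set c := ENNReal.ofReal |(LinearMap.det (P : Rd d →ₗ[ℝ] Rd d))⁻¹|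
  have hc : c ≠ 0 := by simpa [c] using hdet
  have hmap : Measure.map P (volume : Measure (Rd d)) = c • volume :=
    Measure.map_linearMap_addHaar_eq_smul_addHaar volume hdet
  refine ⟨c ^ (1 / p).toReal, ?_, fun f => ?_⟩
  · exact ENNReal.rpow_ne_top_of_nonneg ENNReal.toReal_nonneg ENNReal.ofReal_ne_top
  · have := (P.toHomeomorph.measurableEmbedding).eLpNorm_map_measure (p := p) (μ := volume) (g := f)
    have h2 : Measure.map P.toHomeomorph (volume : Measure (Rd d)) = c • volume := hmap
    rw [h2, eLpNorm_smul_measure_of_ne_zero hc] at this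
    exact this.symm.le

lemma exists_mixedENorm_comp_linearEquiv_le (p q : ℝ≥0∞) (hp : p ≠ 0) (P Q : Rd d ≃L[ℝ] Rd d) :
    ∃ C : ℝ≥0∞, C ≠ ∞ ∧ ∀ B : Rd d × Rd d → ℝ≥0∞, Measurable B →
      mixedENorm p q (fun z => B (P z.1, Q z.2)) ≤ C * mixedENorm p q B := by
  obtain ⟨C₁, h₁, hC₁⟩ := exists_eLpNorm_comp_linearEquiv_le p P
  obtain ⟨C₂, h₂, hC₂⟩ := exists_eLpNorm_comp_linearEquiv_le q Q
  refine ⟨C₁ * C₂, ENNReal.mul_ne_top h₁ h₂, fun B hB => ?_⟩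
  have hb := measurable_inner_eLpNorm (p := p) hp hB
  calc mixedENorm p q (fun z => B (P z.1, Q z.2))
      ≤ eLpNorm (fun ξ => C₁ * eLpNorm (fun x => B (x, Q ξ)) p volume) q volume :=
        eLpNorm_mono_ennreal (Filter.Eventually.of_forall fun ξ => hC₁ fun x => B (x, Q ξ))
    _ ≤ C₁ * eLpNorm (fun ξ => eLpNorm (fun x => B (x, Q ξ)) p volume) q volume :=
        eLpNorm_const_mul_le _ (hb.comp Q.continuous.measurable).aemeasurable
    _ ≤ C₁ * (C₂ * mixedENorm p q B) := by
        gcongr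
        exact hC₂ fun ξ => eLpNorm (fun x => B (x, ξ)) p volume
    _ = _ := by rw [mul_assoc]

/-- Hölder's inequality in one variable after the other; a product kernel keeps the two steps
separate. It serves to show that weighted short-time Fourier transforms of elements of modulation
spaces are bounded. -/
lemma lintegral_mul_le_mixedENorm (hp : 1 ≤ p) (hq : 1 ≤ q) (hB : Measurable B)
    {k₁ k₂ : Rd d → ℝ≥0∞} (hk₁ : Measurable k₁) (hk₂ : Measurable k₂) (h₁ : ∀ x, k₁ x ≤ 1)
    (h₂ : ∀ x, k₂ x ≤ 1) :
    ∫⁻ z, B z * (k₁ z.1 * k₂ z.2) ≤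
      mixedENorm p q B * ((∫⁻ x, k₁ x) ^ (1 - 1 / p.toReal) * (∫⁻ x, k₂ x) ^ (1 - 1 / q.toReal)) := by
  have hp0 : p ≠ 0 := (zero_lt_one.trans_le hp).ne'
  have hb := measurable_inner_eLpNorm (p := p) hp0 hB
  rw [Measure.volume_eq_prod, lintegral_prod_symm' (fun z => B z * (k₁ z.1 * k₂ z.2))
    (hB.mul ((hk₁.comp measurable_fst).mul (hk₂.comp measurable_snd)))]
  calc ∫⁻ ξ, ∫⁻ x, B (x, ξ) * (k₁ x * k₂ ξ)
      ≤ ∫⁻ ξ, eLpNorm (fun x => B (x, ξ)) p volume * k₂ ξ * (∫⁻ x, k₁ x) ^ (1 - 1 / p.toReal) := by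
        refine lintegral_mono fun ξ => ?_
        simp_rw [← mul_assoc]
        have hBξ : Measurable fun x => B (x, ξ) := hB.comp measurable_prodMk_right
        have hBk : Measurable fun x => B (x, ξ) * k₁ x := hBξ.mul hk₁
        rw [lintegral_mul_const _ hBk, mul_right_comm]
        gcongr
        exact lintegral_mul_le_eLpNorm_mul hp hBξ hk₁ h₁
    _ = (∫⁻ ξ, eLpNorm (fun x => B (x, ξ)) p volume * k₂ ξ) * (∫⁻ x, k₁ x) ^ (1 - 1 / p.toReal) :=
        lintegral_mul_const _ (hb.mul hk₂)
    _ ≤ (mixedENorm p q B * (∫⁻ x, k₂ x) ^ (1 - 1 / q.toReal)) *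
          (∫⁻ x, k₁ x) ^ (1 - 1 / p.toReal) := by
        gcongr
        exact lintegral_mul_le_eLpNorm_mul hq hb hk₂ h₂
    _ = _ := by ring

end Mixed

/-! ### Independence of the window -/

section Bracket

variable {V : Type*} [NormedAddCommGroup V]

/-- The weight `1 + ‖z‖`, with values in `[0, ∞]`. -/
noncomputable def bracket (z : V) : ℝ≥0∞ := ENNReal.ofReal (1 + ‖z‖)

lemma one_le_bracket (z : V) : 1 ≤ bracket z := by
  rw [bracket, ENNReal.one_le_ofReal]; linarith [norm_nonneg z]

lemma bracket_ne_zero (z : V) : bracket z ≠ 0 := (zero_lt_one.trans_le (one_le_bracket z)).ne'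

lemma bracket_ne_top (z : V) : bracket z ≠ ∞ := ENNReal.ofReal_ne_top

lemma bracket_add_le (a b : V) : bracket (a + b) ≤ bracket a * bracket b := by
  rw [bracket, bracket, bracket, ← ENNReal.ofReal_mul (by positivity)]
  exact ENNReal.ofReal_le_ofReal (one_add_norm_le_mul a b)

lemma bracket_neg (a : V) : bracket (-a) = bracket a := by rw [bracket, bracket, norm_neg]

lemma bracket_rpow_neg_le_one (z : V) {s : ℝ} (hs : 0 ≤ s) : bracket z ^ (-s) ≤ 1 := by
  simpa using ENNReal.rpow_le_rpow_of_exponent_le (one_le_bracket z) (neg_nonpos.2 hs)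

lemma bracket_rpow_eq_ofReal (z : V) (s : ℝ) :
    bracket z ^ s = ENNReal.ofReal ((1 + ‖z‖) ^ s) := by
  rw [bracket, ENNReal.ofReal_rpow_of_pos (by positivity)]

lemma bracket_rpow_mul (z : V) (s t : ℝ) : bracket z ^ s * bracket z ^ t = bracket z ^ (s + t) :=
  (ENNReal.rpow_add _ _ (bracket_ne_zero z) (bracket_ne_top z)).symm

lemma bracket_rpow_le_rpow (z : V) {s t : ℝ} (h : s ≤ t) : bracket z ^ s ≤ bracket z ^ t :=
  ENNReal.rpow_le_rpow_of_exponent_le (one_le_bracket z) h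

lemma measurable_bracket [MeasurableSpace V] [BorelSpace V] : Measurable (bracket : V → ℝ≥0∞) :=
  ENNReal.measurable_ofReal.comp (by fun_prop)

lemma exists_lintegral_bracket_lt_top [MeasurableSpace V] (μ : Measure V) [μ.HasTemperateGrowth] :
    ∃ M : ℝ, 0 ≤ M ∧ ∀ s, M ≤ s → ∫⁻ z, bracket z ^ (-s) ∂μ < ∞ := by
  obtain ⟨M, hM⟩ := (inferInstance : μ.HasTemperateGrowth).exists_integrable
  refine ⟨M, by positivity, fun s hs => ?_⟩
  calc ∫⁻ z, bracket z ^ (-s) ∂μ ≤ ∫⁻ z, ‖(1 + ‖z‖) ^ (-(M : ℝ))‖ₑ ∂μ := by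
        refine lintegral_mono fun z => ?_
        rw [Real.enorm_of_nonneg (by positivity), ← bracket_rpow_eq_ofReal]
        exact bracket_rpow_le_rpow z (by linarith)
    _ < ∞ := hM.2

/-- A self-improving estimate: convolution bounds pass to powers `r ≤ 1`. -/
lemma rpow_le_lintegral_of_le_lintegral [MeasurableSpace V] {μ : Measure V} {F G : V → ℝ≥0∞}
    {A C : ℝ≥0∞} {N r : ℝ} (hA : A ≠ ∞) (hN : 0 ≤ N) (hr : 0 < r) (hr1 : r ≤ 1)
    (hFg : ∀ z, F z ≤ A * bracket z ^ N)
    (hF : ∀ z, F z ≤ C * ∫⁻ w, F w * bracket (w - z) ^ (-N) ∂μ)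
    (hG : ∀ z, G z ≤ C * ∫⁻ w, F w * bracket (w - z) ^ (-N) ∂μ) (z : V) :
    G z ^ r ≤ C * ∫⁻ w, F w ^ r * bracket (w - z) ^ (-(N * r)) ∂μ := by
  -- This is a maximal function of Peetre type. The a priori growth of `F`, with the same exponent
  -- `N`, makes it finite, which is what permits cancelling a power of it later.
  set S := ⨆ w, F w * bracket (w - z) ^ (-N)
  set I := ∫⁻ w, F w ^ r * bracket (w - z) ^ (-(N * r)) ∂μ
  have hr1' : 0 ≤ 1 - r := by linarith
  have hFS : ∀ w, F w ≤ S * bracket (w - z) ^ N := fun w => by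
    have h1 : F w = F w * bracket (w - z) ^ (-N) * bracket (w - z) ^ N := by
      rw [mul_assoc, bracket_rpow_mul, neg_add_cancel, ENNReal.rpow_zero, mul_one]
    rw [h1]
    gcongr
    exact le_iSup (fun w => F w * bracket (w - z) ^ (-N)) w
  have hSfin : S ≠ ∞ := by
    refine ne_top_of_le_ne_top (ENNReal.mul_ne_top hA
      (ENNReal.rpow_ne_top_of_nonneg hN (bracket_ne_top z))) (iSup_le fun w => ?_ : S ≤ A * bracket z ^ N)
    calc F w * bracket (w - z) ^ (-N)
        ≤ A * (bracket (w - z) * bracket z) ^ N * bracket (w - z) ^ (-N) := by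
          gcongr
          refine (hFg w).trans ?_
          gcongr
          simpa using bracket_add_le (w - z) z
      _ = A * bracket z ^ N * (bracket (w - z) ^ N * bracket (w - z) ^ (-N)) := by
          rw [ENNReal.mul_rpow_of_nonneg _ _ hN]; ring
      _ = A * bracket z ^ N := by
          rw [bracket_rpow_mul, add_neg_cancel, ENNReal.rpow_zero, mul_one]
  have hpt : ∀ w, F w * bracket (w - z) ^ (-N) ≤
      S ^ (1 - r) * (F w ^ r * bracket (w - z) ^ (-(N * r))) := fun w => by
    have h1 : F w = F w ^ (1 - r) * F w ^ r := by
      rw [← ENNReal.rpow_add_of_nonneg _ _ hr1' hr.le, sub_add_cancel, ENNReal.rpow_one]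
    calc F w * bracket (w - z) ^ (-N)
        = F w ^ (1 - r) * F w ^ r * bracket (w - z) ^ (-N) := by rw [← h1]
      _ ≤ (S * bracket (w - z) ^ N) ^ (1 - r) * F w ^ r * bracket (w - z) ^ (-N) := by
          gcongr
          exact hFS w
      _ = S ^ (1 - r) * (F w ^ r * (bracket (w - z) ^ (N * (1 - r)) * bracket (w - z) ^ (-N))) := by
          rw [ENNReal.mul_rpow_of_nonneg _ _ hr1', ← ENNReal.rpow_mul]; ring
      _ = _ := by
          rw [bracket_rpow_mul]; congr 3; ring_nf
  have hSr : S ^ (1 - r) ≠ ∞ := ENNReal.rpow_ne_top_of_nonneg hr1' hSfin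
  have hIle : ∫⁻ w, F w * bracket (w - z) ^ (-N) ∂μ ≤ S ^ (1 - r) * I := by
    refine (lintegral_mono hpt).trans (le_of_eq ?_)
    exact lintegral_const_mul' _ _ hSr
  -- Since `⟨w-u⟩^{-N} ⟨u-z⟩^{-N} ≤ ⟨w-z⟩^{-N}`, the integral bound for `F` at every point `u`
  -- passes to the supremum centred at `z`.
  have hS1 : S ≤ C * (S ^ (1 - r) * I) := by
    refine iSup_le fun u => ?_
    calc F u * bracket (u - z) ^ (-N)
        ≤ C * (∫⁻ w, F w * bracket (w - u) ^ (-N) ∂μ) * bracket (u - z) ^ (-N) := by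
          gcongr; exact hF u
      _ = C * ∫⁻ w, F w * bracket (w - u) ^ (-N) * bracket (u - z) ^ (-N) ∂μ := by
          rw [mul_assoc, lintegral_mul_const']
          exact ne_top_of_le_ne_top ENNReal.one_ne_top (bracket_rpow_neg_le_one _ hN)
      _ ≤ C * ∫⁻ w, F w * bracket (w - z) ^ (-N) ∂μ := by
          refine mul_le_mul' le_rfl (lintegral_mono fun w => ?_)
          rw [mul_assoc]
          refine mul_le_mul' le_rfl ?_
          rw [ENNReal.rpow_neg, ENNReal.rpow_neg, ENNReal.rpow_neg, ← ENNReal.mul_inv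
            (Or.inl (ENNReal.rpow_pos (bracket_ne_zero _).bot_lt (bracket_ne_top _)).ne')
            (Or.inl (ENNReal.rpow_ne_top_of_nonneg hN (bracket_ne_top _))),
            ← ENNReal.mul_rpow_of_nonneg _ _ hN]
          refine ENNReal.inv_le_inv.2 (ENNReal.rpow_le_rpow ?_ hN)
          simpa using bracket_add_le (w - u) (u - z)
      _ ≤ C * (S ^ (1 - r) * I) := by gcongr
  have hS2 : S ^ r ≤ C * I := by
    by_cases h0 : S = 0
    · rw [h0, ENNReal.zero_rpow_of_pos hr]; exact zero_le
    · have hne : S ^ (1 - r) ≠ 0 := by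
        simp [ENNReal.rpow_eq_zero_iff, h0, hSfin]
      have h1 : S ^ (1 - r) * S ^ r ≤ S ^ (1 - r) * (C * I) := by
        rw [← ENNReal.rpow_add_of_nonneg _ _ hr1' hr.le, sub_add_cancel, ENNReal.rpow_one]
        calc S ≤ _ := hS1
          _ = _ := by ring
      exact (ENNReal.mul_le_mul_iff_right hne hSr).1 h1
  -- Inserting the bound for `S ^ r`, raised to the power `1 - r`, makes the exponents of `C` and of
  -- `I` add up to one.
  calc G z ^ r ≤ (C * (S ^ (1 - r) * I)) ^ r :=
        ENNReal.rpow_le_rpow ((hG z).trans (by gcongr)) hr.le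
    _ = C ^ r * (S ^ r) ^ (1 - r) * I ^ r := by
        rw [ENNReal.mul_rpow_of_nonneg _ _ hr.le, ENNReal.mul_rpow_of_nonneg _ _ hr.le,
          ← ENNReal.rpow_mul, ← ENNReal.rpow_mul, mul_comm (1 - r) r, mul_assoc]
    _ ≤ C ^ r * (C * I) ^ (1 - r) * I ^ r := by gcongr
    _ = (C ^ r * C ^ (1 - r)) * (I ^ (1 - r) * I ^ r) := by
        rw [ENNReal.mul_rpow_of_nonneg _ _ hr1']; ring
    _ = C * I := by
        rw [← ENNReal.rpow_add_of_nonneg _ _ hr.le hr1', ← ENNReal.rpow_add_of_nonneg _ _ hr1' hr.le,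
          sub_add_cancel, add_sub_cancel, ENNReal.rpow_one, ENNReal.rpow_one]

end Bracket

/-! ### Pointwise comparison of transforms with two windows -/

section WindowPointwise

open scoped ComplexConjugate

variable {n : Type} [Fintype n]

lemma schwartzInner_eq_inner (ψ γ : 𝓢(EuclideanSpace ℝ n, ℂ)) :
    schwartzInner ψ γ = inner ℂ (γ.toLp 2 volume) (ψ.toLp 2 volume) := by
  rw [SchwartzMap.inner_toL2_toL2_eq γ ψ volume, schwartzInner]
  rfl

lemma schwartzInner_self_ne_zero {φ : 𝓢(EuclideanSpace ℝ n, ℂ)} (hφ : φ ≠ 0) :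
    schwartzInner φ φ ≠ 0 := by
  rw [schwartzInner_eq_inner, inner_self_ne_zero]
  intro h
  apply hφ
  apply SchwartzMap.injective_toLp 2 volume
  refine h.trans ?_
  exact ((SchwartzMap.toLpCLM ℂ ℂ 2 volume).map_zero).symm

lemma schwartzInner_tfShift_tfShift (ψ φ : 𝓢(EuclideanSpace ℝ n, ℂ)) (y η x ξ : EuclideanSpace ℝ n) :
    schwartzInner (tfShift y η ψ) (tfShift x ξ φ) =
      modChar (η - ξ) y * schwartzInner ψ (tfShift (x - y) (ξ - η) φ) := by
  rw [schwartzInner, schwartzInner,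
    ← integral_add_right_eq_self (fun t => tfShift y η ψ t * conj (tfShift x ξ φ t)) y,
    ← integral_const_mul]
  congr 1; ext s
  simp only [tfShift_apply, map_mul, conj_modChar, modChar_add_right,
    sub_eq_add_neg, modChar_add, neg_add, neg_neg]
  rw [show s + y + -x = s + (-x + y) by abel, show s + y + -y = s by abel]
  ring

lemma norm_stft_tfShift (φ ψ : 𝓢(EuclideanSpace ℝ n, ℂ))
    (z w : EuclideanSpace ℝ n × EuclideanSpace ℝ n) :
    ‖stft φ (asDist (tfShift z.1 z.2 ψ)) w‖ = ‖stft φ (asDist ψ) (w - z)‖ := by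
  rw [stft_asDist, stft_asDist, schwartzInner_tfShift_tfShift, norm_mul, norm_modChar, one_mul]
  rfl

/-- Moyal's formula with both windows equal to `φ`, tested on `π(z)ψ`, reproduces `V_ψ f` from `V_φ
f`. The modulus of its kernel is that of `V_φ ψ` at `w - z`, which decays faster than any power. -/
lemma exists_enorm_stft_le_lintegral (f : 𝓢'(EuclideanSpace ℝ n, ℂ))
    {φ : 𝓢(EuclideanSpace ℝ n, ℂ)} (hφ : φ ≠ 0) (ψ : 𝓢(EuclideanSpace ℝ n, ℂ)) (N : ℕ) :
    ∃ C : ℝ≥0∞, C ≠ ∞ ∧ ∀ z, ‖stft ψ f z‖ₑ ≤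
      C * ∫⁻ w, ‖stft φ f w‖ₑ * bracket (w - z) ^ (-(N : ℝ)) := by
  obtain ⟨C, hC, hb⟩ := exists_norm_stft_asDist_le N φ ψ
  have h0 := schwartzInner_self_ne_zero hφ
  have h0' : ‖schwartzInner φ φ‖ₑ ≠ 0 := by simpa using h0
  refine ⟨‖schwartzInner φ φ‖ₑ⁻¹ * ENNReal.ofReal C,
    ENNReal.mul_ne_top (ENNReal.inv_ne_top.2 h0') ENNReal.ofReal_ne_top, fun z => ?_⟩
  obtain ⟨-, h2⟩ := integral_stft_mul_conj_stft f φ φ (tfShift z.1 z.2 ψ)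
  have e : stft ψ f z = (schwartzInner φ φ)⁻¹ *
      ∫ w, stft φ f w * conj (stft φ (asDist (tfShift z.1 z.2 ψ)) w) := by
    rw [h2, mul_comm (sesq _ _), inv_mul_cancel_left₀ h0]; rfl
  rw [e, enorm_mul, enorm_inv h0, mul_assoc]
  gcongr
  refine (enorm_integral_le_lintegral_enorm _).trans ?_
  rw [← lintegral_const_mul' _ _ ENNReal.ofReal_ne_top]
  refine lintegral_mono fun w => ?_
  rw [enorm_mul, mul_left_comm]
  gcongr
  rw [← ofReal_norm, RCLike.norm_conj, norm_stft_tfShift, bracket_rpow_eq_ofReal,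
    ← ENNReal.ofReal_mul hC]
  exact ENNReal.ofReal_le_ofReal (hb _)

lemma exists_enorm_stft_le_bracket (f : 𝓢'(EuclideanSpace ℝ n, ℂ)) (φ : 𝓢(EuclideanSpace ℝ n, ℂ)) :
    ∃ (A : ℝ≥0∞) (N : ℕ), A ≠ ∞ ∧ ∀ z, ‖stft φ f z‖ₑ ≤ A * bracket z ^ (N : ℝ) := by
  obtain ⟨C, N, hC, h⟩ := exists_norm_stft_le φ f
  refine ⟨ENNReal.ofReal C, N, ENNReal.ofReal_ne_top, fun z => ?_⟩
  rw [bracket_rpow_eq_ofReal, ← ofReal_norm, ← ENNReal.ofReal_mul hC, Real.rpow_natCast]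
  exact ENNReal.ofReal_le_ofReal (h z)

/-- The self-improvement needs decay of at least the growth order of `V_φ f`, so `C` and `N` depend
on `f`. This is harmless because only the finiteness of norms is at stake. -/
lemma exists_enorm_stft_rpow_le_lintegral (f : 𝓢'(EuclideanSpace ℝ n, ℂ))
    {φ : 𝓢(EuclideanSpace ℝ n, ℂ)} (hφ : φ ≠ 0) (ψ : 𝓢(EuclideanSpace ℝ n, ℂ)) {r : ℝ} (hr : 0 < r)
    (hr1 : r ≤ 1) (M : ℝ) :
    ∃ (C : ℝ≥0∞) (N : ℝ), C ≠ ∞ ∧ M ≤ N ∧ ∀ z, ‖stft ψ f z‖ₑ ^ r ≤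
      C * ∫⁻ w, ‖stft φ f w‖ₑ ^ r * bracket (w - z) ^ (-(N * r)) := by
  obtain ⟨A, N₀, hA, hg⟩ := exists_enorm_stft_le_bracket f φ
  -- `N₀` is the growth order of `V_φ f`, required for the supremum to be finite; `M` is the decay
  -- requested from outside.
  set N := max N₀ ⌈M⌉₊
  obtain ⟨C₁, hC₁, h₁⟩ := exists_enorm_stft_le_lintegral f hφ φ N
  obtain ⟨C₂, hC₂, h₂⟩ := exists_enorm_stft_le_lintegral f hφ ψ N
  refine ⟨max C₁ C₂, N, max_lt hC₁.lt_top hC₂.lt_top |>.ne,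
    (Nat.le_ceil M).trans (Nat.cast_le.2 (le_max_right N₀ _)), fun z => ?_⟩
  refine rpow_le_lintegral_of_le_lintegral (F := fun w => ‖stft φ f w‖ₑ)
    (G := fun w => ‖stft ψ f w‖ₑ) hA (by positivity) hr hr1
    (fun w => (hg w).trans ?_) (fun w => (h₁ w).trans ?_) (fun w => (h₂ w).trans ?_) z
  · refine mul_le_mul' le_rfl ?_
    exact bracket_rpow_le_rpow w (Nat.cast_le.2 (le_max_left N₀ _))
  · gcongr; exact le_max_left _ _
  · gcongr; exact le_max_right _ _

end WindowPointwise

/-! ### Change of window in the modulation spaces -/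

section WindowChange

variable {d : ℕ} {v m : Rd d × Rd d → ℝ}

/-- A moderate weight changes by at most a polynomial factor under translation. Such a factor is
absorbed by the rapidly decaying kernels of the window change. -/
lemma IsModerateWeight.exists_ofReal_le (hvg : HasPolynomialGrowth v) (hm : IsModerateWeight v m) :
    ∃ (C : ℝ≥0∞) (K : ℝ), C ≠ ∞ ∧ 0 ≤ K ∧ ∀ z w,
      ENNReal.ofReal (m z) ≤ C * bracket (w - z) ^ K * ENNReal.ofReal (m w) := by
  obtain ⟨C₁, N, h₁⟩ := hvg
  obtain ⟨C₂, hC₂, h₂⟩ := hm.moderate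
  refine ⟨ENNReal.ofReal (C₂ * C₁), N, ENNReal.ofReal_ne_top, by positivity, fun z w => ?_⟩
  have hC₁ : 0 ≤ C₁ := by
    by_contra h
    push Not at h
    have h3 := h₂ 0 0
    have h4 := h₁ 0
    simp only [norm_zero, add_zero, one_pow, mul_one] at h3 h4
    have h5 : v 0 < 0 := lt_of_le_of_lt h4 h
    have := hm.pos 0
    nlinarith [mul_pos hC₂ this]
  rw [bracket_rpow_eq_ofReal, Real.rpow_natCast, ← ENNReal.ofReal_mul (by positivity),
    ← ENNReal.ofReal_mul (by positivity)]
  refine ENNReal.ofReal_le_ofReal ?_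
  have h3 := h₂ (z - w) w
  rw [sub_add_cancel] at h3
  refine h3.trans ?_
  have := h₁ (z - w)
  rw [norm_sub_rev] at this
  have hmw := (hm.pos w).le
  refine mul_le_mul_of_nonneg_right ?_ hmw
  calc C₂ * v (z - w) ≤ C₂ * (C₁ * (1 + ‖w - z‖) ^ N) := by gcongr
    _ = _ := by ring

variable {p q : ℝ≥0∞}

lemma enorm_stft_mul_measurable (hm : IsModerateWeight v m) (φ : 𝓢(Rd d, ℂ)) (f : 𝓢'(Rd d, ℂ)) :
    Measurable fun z => ‖stft φ f z‖ₑ * ENNReal.ofReal (m z) :=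
  (continuous_stft φ f).measurable.enorm.mul
    (ENNReal.measurable_ofReal.comp hm.continuous.measurable)

lemma memModulation_iff (hm : IsModerateWeight v m) (φ : 𝓢(Rd d, ℂ)) (f : 𝓢'(Rd d, ℂ)) :
    MemModulation φ p q m f ↔
      mixedENorm p q (fun z => ‖stft φ f z‖ₑ * ENNReal.ofReal (m z)) < ∞ := by
  rw [MemModulation, MemMixedLp, mixedNorm_eq_mixedENorm p q m fun z => (hm.pos z).le]
  exact and_iff_right (continuous_stft φ f).aestronglyMeasurable

/-- The modulation spaces do not depend on the window. -/
theorem MemModulation.change_window (hp : 0 < p) (hq : 0 < q) (hvg : HasPolynomialGrowth v)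
    (hm : IsModerateWeight v m) {φ : 𝓢(Rd d, ℂ)} (hφ : φ ≠ 0) (ψ : 𝓢(Rd d, ℂ)) {f : 𝓢'(Rd d, ℂ)}
    (hf : MemModulation φ p q m f) : MemModulation ψ p q m f := by
  rw [memModulation_iff hm] at hf ⊢
  -- With this `r` both `p / r` and `q / r` are at least one, so Young's inequality applies to the
  -- `r`-th powers.
  set r := (min 1 (min p q)).toReal
  have hrt : min 1 (min p q) ≠ ∞ := ne_top_of_le_ne_top ENNReal.one_ne_top (min_le_left _ _)
  have hr : 0 < r := ENNReal.toReal_pos (by simp [hp.ne', hq.ne']) hrt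
  have hrE : ENNReal.ofReal r = min 1 (min p q) := ENNReal.ofReal_toReal hrt
  have hr1 : r ≤ 1 := by
    have : ENNReal.ofReal r ≤ 1 := hrE ▸ min_le_left _ _
    simpa using this
  have hr0 : ENNReal.ofReal r ≠ 0 := by simpa using hr
  have hrp : p / ENNReal.ofReal r * ENNReal.ofReal r = p :=
    ENNReal.div_mul_cancel hr0 ENNReal.ofReal_ne_top
  have hrq : q / ENNReal.ofReal r * ENNReal.ofReal r = q :=
    ENNReal.div_mul_cancel hr0 ENNReal.ofReal_ne_top
  have hp1 : 1 ≤ p / ENNReal.ofReal r := by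
    rw [ENNReal.le_div_iff_mul_le (Or.inl hr0) (Or.inl ENNReal.ofReal_ne_top), one_mul, hrE]
    exact (min_le_right _ _).trans (min_le_left _ _)
  have hq1 : 1 ≤ q / ENNReal.ofReal r := by
    rw [ENNReal.le_div_iff_mul_le (Or.inl hr0) (Or.inl ENNReal.ofReal_ne_top), one_mul, hrE]
    exact (min_le_right _ _).trans (min_le_right _ _)
  obtain ⟨C₁, K, hC₁, hK, h₁⟩ := hm.exists_ofReal_le hvg
  obtain ⟨M, hM, hMi⟩ := exists_lintegral_bracket_lt_top (volume : Measure (Rd d × Rd d))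
  -- The weight uses up `K` of the decay. The choice of `K + M / r` leaves `(N - K) r ≥ M`, which
  -- makes the remaining kernel integrable.
  obtain ⟨C₂, N, hC₂, hN, h₂⟩ := exists_enorm_stft_rpow_le_lintegral f hφ ψ hr hr1 (K + M / r)
  set B : Rd d × Rd d → ℝ≥0∞ := fun z => ‖stft φ f z‖ₑ * ENNReal.ofReal (m z)
  have hBm : Measurable B := enorm_stft_mul_measurable hm φ f
  set k : Rd d × Rd d → ℝ≥0∞ := fun u => C₂ * C₁ ^ r * bracket u ^ (-((N - K) * r))
  have hcfin : C₂ * C₁ ^ r ≠ ∞ := ENNReal.mul_ne_top hC₂ (ENNReal.rpow_ne_top_of_nonneg hr.le hC₁)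
  have hkm : Measurable k := (measurable_bracket.pow_const _).const_mul _
  have hki : ∫⁻ u, k u ≠ ∞ := by
    rw [lintegral_const_mul' _ _ hcfin]
    refine ENNReal.mul_ne_top hcfin (hMi _ ?_).ne
    have : M / r ≤ N - K := by linarith
    exact (div_le_iff₀ hr).1 this
  have key : ∀ z, (‖stft ψ f z‖ₑ * ENNReal.ofReal (m z)) ^ r ≤ ∫⁻ u, k u * B (z + u) ^ r := by
    intro z
    rw [ENNReal.mul_rpow_of_nonneg _ _ hr.le]
    calc ‖stft ψ f z‖ₑ ^ r * ENNReal.ofReal (m z) ^ r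
        ≤ (C₂ * ∫⁻ w, ‖stft φ f w‖ₑ ^ r * bracket (w - z) ^ (-(N * r))) *
            ENNReal.ofReal (m z) ^ r := by gcongr; exact h₂ z
      _ = ∫⁻ w, C₂ * (‖stft φ f w‖ₑ ^ r * bracket (w - z) ^ (-(N * r))) *
            ENNReal.ofReal (m z) ^ r := by
          rw [← lintegral_const_mul' _ _ hC₂, lintegral_mul_const']
          exact ENNReal.rpow_ne_top_of_nonneg hr.le ENNReal.ofReal_ne_top
      _ ≤ ∫⁻ w, k (w - z) * B w ^ r := by
          refine lintegral_mono fun w => ?_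
          have e : bracket (w - z) ^ (-((N - K) * r)) =
              bracket (w - z) ^ (-(N * r)) * bracket (w - z) ^ (K * r) := by
            rw [bracket_rpow_mul]; congr 1; ring
          calc C₂ * (‖stft φ f w‖ₑ ^ r * bracket (w - z) ^ (-(N * r))) * ENNReal.ofReal (m z) ^ r
              ≤ C₂ * (‖stft φ f w‖ₑ ^ r * bracket (w - z) ^ (-(N * r))) *
                (C₁ * bracket (w - z) ^ K * ENNReal.ofReal (m w)) ^ r := by
                gcongr; exact h₁ z w
            _ = k (w - z) * B w ^ r := by
                simp only [k, B, e]
                rw [ENNReal.mul_rpow_of_nonneg _ _ hr.le, ENNReal.mul_rpow_of_nonneg _ _ hr.le,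
                  ENNReal.mul_rpow_of_nonneg _ _ hr.le, ← ENNReal.rpow_mul]
                ring
      _ = ∫⁻ u, k u * B (z + u) ^ r := by
          have : (volume : Measure (Rd d × Rd d)).IsAddLeftInvariant := by
            rw [Measure.volume_eq_prod]; infer_instance
          rw [← lintegral_add_left_eq_self (fun w => k (w - z) * B w ^ r) z]
          simp
  have h3 := mixedENorm_le_of_le_lintegral hp1 hq1 hkm (hBm.pow_const r) key
  rw [mixedENorm_rpow hr, mixedENorm_rpow hr, hrp, hrq] at h3
  have h4 := h3.trans_lt (ENNReal.mul_lt_top hki.lt_top (ENNReal.rpow_lt_top_of_nonneg hr.le hf.ne))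
  exact (ENNReal.rpow_lt_top_iff_of_pos hr).1 h4

/-- Boundedness of the short-time Fourier transform on modulation spaces. -/
theorem MemModulation.exists_enorm_le (hp : 1 ≤ p) (hq : 1 ≤ q) (hvg : HasPolynomialGrowth v)
    (hm : IsModerateWeight v m) {φ : 𝓢(Rd d, ℂ)} (hφ : φ ≠ 0) {f : 𝓢'(Rd d, ℂ)}
    (hf : MemModulation φ p q m f) :
    ∃ C : ℝ≥0∞, C ≠ ∞ ∧ ∀ z, ‖stft φ f z‖ₑ * ENNReal.ofReal (m z) ≤ C := by
  rw [memModulation_iff hm] at hf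
  obtain ⟨C₁, K, hC₁, hK, h₁⟩ := hm.exists_ofReal_le hvg
  obtain ⟨M, hM, hMi⟩ := exists_lintegral_bracket_lt_top (volume : Measure (Rd d))
  -- `K` compensates the weight, and the remaining `2 * M` is split into a decay of order `M` in
  -- each of the two variables.
  obtain ⟨C₂, hC₂, h₂⟩ := exists_enorm_stft_le_lintegral f hφ φ ⌈K + 2 * M⌉₊
  set N := ⌈K + 2 * M⌉₊
  have hN : K + 2 * M ≤ N := Nat.le_ceil _
  set B : Rd d × Rd d → ℝ≥0∞ := fun z => ‖stft φ f z‖ₑ * ENNReal.ofReal (m z)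
  have hBm : Measurable B := enorm_stft_mul_measurable hm φ f
  set J := ∫⁻ x : Rd d, bracket x ^ (-M)
  have hJ : J ≠ ∞ := (hMi M le_rfl).ne
  have hexp : ∀ {p : ℝ≥0∞}, 1 ≤ p → 0 ≤ 1 - 1 / p.toReal := by
    intro p hp
    by_cases ht : p = ∞
    · simp [ht]
    · have : 1 ≤ p.toReal := by rw [← ENNReal.toReal_one]; exact ENNReal.toReal_mono ht hp
      rw [sub_nonneg, div_le_one (by linarith)]; exact this
  refine ⟨C₂ * C₁ * (mixedENorm p q B * (J ^ (1 - 1 / p.toReal) * J ^ (1 - 1 / q.toReal))), ?_,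
    fun z => ?_⟩
  · exact ENNReal.mul_ne_top (ENNReal.mul_ne_top hC₂ hC₁) (ENNReal.mul_ne_top hf.ne
      (ENNReal.mul_ne_top (ENNReal.rpow_ne_top_of_nonneg (hexp hp) hJ)
        (ENNReal.rpow_ne_top_of_nonneg (hexp hq) hJ)))
  · have hJz : ∀ a : Rd d, ∫⁻ x, bracket (x - a) ^ (-M) = J := fun a =>
      lintegral_sub_right_eq_self (fun x => bracket x ^ (-M)) a
    have hb : ∀ a : Rd d, Measurable fun x : Rd d => bracket (x - a) ^ (-M) := fun a =>
      (measurable_bracket.comp (by fun_prop : Measurable fun x : Rd d => x - a)).pow_const _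
    calc ‖stft φ f z‖ₑ * ENNReal.ofReal (m z)
        ≤ (C₂ * ∫⁻ w, ‖stft φ f w‖ₑ * bracket (w - z) ^ (-(N : ℝ))) * ENNReal.ofReal (m z) := by
          gcongr; exact h₂ z
      _ = C₂ * ∫⁻ w, ‖stft φ f w‖ₑ * bracket (w - z) ^ (-(N : ℝ)) * ENNReal.ofReal (m z) := by
          rw [mul_assoc, lintegral_mul_const' _ _ ENNReal.ofReal_ne_top]
      _ ≤ C₂ * ∫⁻ w, C₁ * (B w * (bracket (w.1 - z.1) ^ (-M) * bracket (w.2 - z.2) ^ (-M))) := by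
          refine mul_le_mul' le_rfl (lintegral_mono fun w => ?_)
          calc ‖stft φ f w‖ₑ * bracket (w - z) ^ (-(N : ℝ)) * ENNReal.ofReal (m z)
              ≤ ‖stft φ f w‖ₑ * bracket (w - z) ^ (-(N : ℝ)) *
                (C₁ * bracket (w - z) ^ K * ENNReal.ofReal (m w)) := by gcongr; exact h₁ z w
            _ = C₁ * (B w * (bracket (w - z) ^ (-(N : ℝ)) * bracket (w - z) ^ K)) := by
                simp only [B]; ring
            _ ≤ _ := by
                refine mul_le_mul' le_rfl (mul_le_mul' le_rfl ?_)
                rw [bracket_rpow_mul]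
                calc bracket (w - z) ^ (-(N : ℝ) + K) ≤ bracket (w - z) ^ (-M + -M) :=
                      bracket_rpow_le_rpow _ (by linarith)
                  _ = bracket (w - z) ^ (-M) * bracket (w - z) ^ (-M) :=
                      (bracket_rpow_mul _ _ _).symm
                  _ ≤ _ := by
                      refine mul_le_mul' ?_ ?_
                      · rw [ENNReal.rpow_neg, ENNReal.rpow_neg]
                        refine ENNReal.inv_le_inv.2 (ENNReal.rpow_le_rpow ?_ hM)
                        exact ENNReal.ofReal_le_ofReal (add_le_add_right (norm_fst_le (w - z)) 1)
                      · rw [ENNReal.rpow_neg, ENNReal.rpow_neg]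
                        refine ENNReal.inv_le_inv.2 (ENNReal.rpow_le_rpow ?_ hM)
                        exact ENNReal.ofReal_le_ofReal (add_le_add_right (norm_snd_le (w - z)) 1)
      _ = C₂ * C₁ * ∫⁻ w, B w * (bracket (w.1 - z.1) ^ (-M) * bracket (w.2 - z.2) ^ (-M)) := by
          rw [lintegral_const_mul' _ _ hC₁, mul_assoc]
      _ ≤ _ := by
          gcongr
          have := lintegral_mul_le_mixedENorm hp hq hBm (hb z.1) (hb z.2)
            (fun x => bracket_rpow_neg_le_one _ hM) (fun x => bracket_rpow_neg_le_one _ hM)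
          rwa [hJz, hJz] at this

end WindowChange

/-! ### The Schrödinger representation and metaplectic operators -/

section SchrodingerRep

open scoped ComplexConjugate

variable {n : Type} [Fintype n]

/-- The phase factor `e^{-πi x·ξ}`. -/
noncomputable def rhoPhase (x ξ : EuclideanSpace ℝ n) : ℂ :=
  Complex.exp (((-(Real.pi * ⟪x, ξ⟫) : ℝ) : ℂ) * Complex.I)

lemma norm_rhoPhase (x ξ : EuclideanSpace ℝ n) : ‖rhoPhase x ξ‖ = 1 :=
  Complex.norm_exp_ofReal_mul_I _

lemma rhoPhase_mul_conj (x ξ : EuclideanSpace ℝ n) : rhoPhase x ξ * conj (rhoPhase x ξ) = 1 := by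
  rw [Complex.mul_conj, Complex.normSq_eq_norm_sq, norm_rhoPhase]; simp

/-- The Schrödinger representation on Schwartz functions. -/
noncomputable def rhoSchwartz (x ξ : EuclideanSpace ℝ n) (φ : 𝓢(EuclideanSpace ℝ n, ℂ)) :
    𝓢(EuclideanSpace ℝ n, ℂ) := rhoPhase x ξ • tfShift x ξ φ

lemma coe_rhoSchwartz (x ξ : EuclideanSpace ℝ n) (φ : 𝓢(EuclideanSpace ℝ n, ℂ)) :
    ⇑(rhoSchwartz x ξ φ) = schrodingerRep x ξ φ := by
  ext t
  simp [rhoSchwartz, schrodingerRep, tfShift_apply, rhoPhase, mul_assoc]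

lemma norm_schrodingerRep (x ξ : EuclideanSpace ℝ n) (F : EuclideanSpace ℝ n → ℂ)
    (t : EuclideanSpace ℝ n) : ‖schrodingerRep x ξ F t‖ = ‖F (t - x)‖ := by
  rw [schrodingerRep, norm_mul, norm_mul, norm_modChar, Complex.norm_exp_ofReal_mul_I]; simp

lemma continuous_modChar (ξ : EuclideanSpace ℝ n) : Continuous (modChar ξ) :=
  (modChar_hasTemperateGrowth ξ).1.continuous

lemma aestronglyMeasurable_schrodingerRep (x ξ : EuclideanSpace ℝ n) {F : EuclideanSpace ℝ n → ℂ}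
    (hF : AEStronglyMeasurable F volume) :
    AEStronglyMeasurable (schrodingerRep x ξ F) volume :=
  ((continuous_modChar ξ).const_mul _).aestronglyMeasurable.mul
    (hF.comp_measurePreserving (measurePreserving_sub_right volume x))

lemma eLpNorm_schrodingerRep (x ξ : EuclideanSpace ℝ n) {F : EuclideanSpace ℝ n → ℂ}
    (hF : AEStronglyMeasurable F volume) :
    eLpNorm (schrodingerRep x ξ F) 2 volume = eLpNorm F 2 volume := by
  rw [eLpNorm_congr_norm_ae (g := F ∘ fun t => t - x)
    (Filter.Eventually.of_forall fun t => norm_schrodingerRep x ξ F t)]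
  exact eLpNorm_comp_measurePreserving hF (measurePreserving_sub_right volume x)

lemma schrodingerRep_congr_ae (x ξ : EuclideanSpace ℝ n) {F G : EuclideanSpace ℝ n → ℂ}
    (h : F =ᵐ[volume] G) : schrodingerRep x ξ F =ᵐ[volume] schrodingerRep x ξ G := by
  filter_upwards [(measurePreserving_sub_right volume x).quasiMeasurePreserving.ae h] with t ht
  simp [schrodingerRep, ht]

/-- The Schrödinger representation on `L²`. -/
noncomputable def rhoLp (x ξ : EuclideanSpace ℝ n)
    (F : Lp ℂ 2 (volume : Measure (EuclideanSpace ℝ n))) :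
    Lp ℂ 2 (volume : Measure (EuclideanSpace ℝ n)) :=
  MemLp.toLp (schrodingerRep x ξ F)
    ⟨aestronglyMeasurable_schrodingerRep x ξ (Lp.aestronglyMeasurable F), by
      rw [eLpNorm_schrodingerRep x ξ (Lp.aestronglyMeasurable F)]; exact Lp.eLpNorm_lt_top F⟩

lemma coeFn_rhoLp (x ξ : EuclideanSpace ℝ n)
    (F : Lp ℂ 2 (volume : Measure (EuclideanSpace ℝ n))) :
    rhoLp x ξ F =ᵐ[volume] schrodingerRep x ξ F := MemLp.coeFn_toLp _

lemma isometry_rhoLp (x ξ : EuclideanSpace ℝ n) : Isometry (rhoLp x ξ) := by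
  refine Isometry.of_dist_eq fun F G => ?_
  rw [dist_eq_norm, dist_eq_norm, Lp.norm_def, Lp.norm_def]
  congr 1
  rw [← eLpNorm_schrodingerRep x ξ (Lp.aestronglyMeasurable (F - G))]
  refine eLpNorm_congr_ae ?_
  filter_upwards [Lp.coeFn_sub (rhoLp x ξ F) (rhoLp x ξ G), coeFn_rhoLp x ξ F, coeFn_rhoLp x ξ G,
    schrodingerRep_congr_ae x ξ (Lp.coeFn_sub F G)] with t h1 h2 h3 h4
  rw [h1, h4, Pi.sub_apply, h2, h3]
  simp [schrodingerRep, mul_sub]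

lemma rhoLp_zero_zero (F : Lp ℂ 2 (volume : Measure (EuclideanSpace ℝ n))) :
    rhoLp 0 0 F = F := by
  refine Lp.ext ((coeFn_rhoLp 0 0 F).trans (Filter.Eventually.of_forall fun t => ?_))
  simp [schrodingerRep, modChar]

lemma norm_rhoLp (x ξ : EuclideanSpace ℝ n)
    (F : Lp ℂ 2 (volume : Measure (EuclideanSpace ℝ n))) : ‖rhoLp x ξ F‖ = ‖F‖ := by
  rw [Lp.norm_def, Lp.norm_def, eLpNorm_congr_ae (coeFn_rhoLp x ξ F),
    eLpNorm_schrodingerRep x ξ (Lp.aestronglyMeasurable F)]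

lemma rhoLp_toLp (x ξ : EuclideanSpace ℝ n) (φ : 𝓢(EuclideanSpace ℝ n, ℂ)) :
    rhoLp x ξ (φ.toLp 2 volume) = (rhoSchwartz x ξ φ).toLp 2 volume := by
  refine Lp.ext ((coeFn_rhoLp _ _ _).trans ?_)
  refine (schrodingerRep_congr_ae x ξ (φ.coeFn_toLp 2 volume)).trans ?_
  rw [← coe_rhoSchwartz]
  exact ((rhoSchwartz x ξ φ).coeFn_toLp 2 volume).symm

lemma conj_schwartzInner (ψ γ : 𝓢(EuclideanSpace ℝ n, ℂ)) :
    conj (schwartzInner ψ γ) = schwartzInner γ ψ := by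
  rw [schwartzInner_eq_inner, schwartzInner_eq_inner, inner_conj_symm]

lemma schwartzInner_smul_right (c : ℂ) (ψ γ : 𝓢(EuclideanSpace ℝ n, ℂ)) :
    schwartzInner ψ (c • γ) = conj c * schwartzInner ψ γ := by
  rw [← sesq_asDist, sesq_smul, sesq_asDist]

lemma schwartzInner_rhoSchwartz (ψ γ : 𝓢(EuclideanSpace ℝ n, ℂ)) (x ξ : EuclideanSpace ℝ n) :
    schwartzInner ψ (rhoSchwartz x ξ γ) = conj (rhoPhase x ξ) * stft γ (asDist ψ) (x, ξ) := by
  rw [rhoSchwartz, schwartzInner_smul_right, stft_asDist]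

lemma sesq_rhoSchwartz (f : 𝓢'(EuclideanSpace ℝ n, ℂ)) (γ : 𝓢(EuclideanSpace ℝ n, ℂ))
    (x ξ : EuclideanSpace ℝ n) :
    sesq f (rhoSchwartz x ξ γ) = conj (rhoPhase x ξ) * stft γ f (x, ξ) := by
  rw [rhoSchwartz, sesq_smul]; rfl

/-- The phase between `ρ(z)` and `π(z)` has modulus one and enters once together with its conjugate.
Moyal's identity is therefore the same for either kind of shift. -/
lemma sesq_rhoSchwartz_mul_conj (f : 𝓢'(EuclideanSpace ℝ n, ℂ))
    (φ γ ψ : 𝓢(EuclideanSpace ℝ n, ℂ)) (z : EuclideanSpace ℝ n × EuclideanSpace ℝ n) :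
    sesq f (rhoSchwartz z.1 z.2 φ) * conj (schwartzInner ψ (rhoSchwartz z.1 z.2 γ)) =
      stft φ f z * conj (stft γ (asDist ψ) z) := by
  rw [sesq_rhoSchwartz, schwartzInner_rhoSchwartz, map_mul, Complex.conj_conj]
  linear_combination (stft φ f z * conj (stft γ (asDist ψ) z)) * rhoPhase_mul_conj z.1 z.2

/-- Moyal's identity with the Schrödinger representation. -/
lemma integral_sesq_rhoSchwartz (f : 𝓢'(EuclideanSpace ℝ n, ℂ))
    (φ γ ψ : 𝓢(EuclideanSpace ℝ n, ℂ)) :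
    ∫ z : EuclideanSpace ℝ n × EuclideanSpace ℝ n, sesq f (rhoSchwartz z.1 z.2 φ) *
      conj (schwartzInner ψ (rhoSchwartz z.1 z.2 γ)) = sesq f ψ * schwartzInner γ φ := by
  simp only [sesq_rhoSchwartz_mul_conj]
  exact (integral_stft_mul_conj_stft f φ γ ψ).2

/-- A tempered distribution is determined by its values on the orbit of a Schwartz function. -/
lemma sesq_eq_of_rhoSchwartz {W W' : 𝓢'(EuclideanSpace ℝ n, ℂ)} {φ : 𝓢(EuclideanSpace ℝ n, ℂ)}
    (hφ : φ ≠ 0) (h : ∀ x ξ, sesq W (rhoSchwartz x ξ φ) = sesq W' (rhoSchwartz x ξ φ))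
    (ψ : 𝓢(EuclideanSpace ℝ n, ℂ)) : sesq W ψ = sesq W' ψ := by
  refine mul_right_cancel₀ (schwartzInner_self_ne_zero hφ) ?_
  rw [← integral_sesq_rhoSchwartz, ← integral_sesq_rhoSchwartz]
  simp only [h]

/-- Moyal's identity for square integrable functions, one pair being Schwartz. -/
lemma integral_inner_rhoLp (h k : Lp ℂ 2 (volume : Measure (EuclideanSpace ℝ n)))
    (Φ : 𝓢(EuclideanSpace ℝ n, ℂ)) :
    ∫ z : EuclideanSpace ℝ n × EuclideanSpace ℝ n, inner ℂ h (rhoLp z.1 z.2 k) *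
      conj (inner ℂ (Φ.toLp 2 volume) (rhoLp z.1 z.2 (Φ.toLp 2 volume))) =
      inner ℂ h (Φ.toLp 2 volume) * inner ℂ (Φ.toLp 2 volume) k := by
  have hS : ∀ (ψ γ : 𝓢(EuclideanSpace ℝ n, ℂ)) (z : EuclideanSpace ℝ n × EuclideanSpace ℝ n),
      (inner ℂ (ψ.toLp 2 volume) (rhoLp z.1 z.2 (γ.toLp 2 volume)) : ℂ) =
        rhoPhase z.1 z.2 * conj (stft γ (asDist ψ) z) := fun ψ γ z => by
    rw [rhoLp_toLp, ← schwartzInner_eq_inner, ← conj_schwartzInner, schwartzInner_rhoSchwartz,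
      map_mul, Complex.conj_conj]
  set V : EuclideanSpace ℝ n × EuclideanSpace ℝ n → ℂ := fun z => stft Φ (asDist Φ) z
  have hVc : Continuous V := continuous_stft _ _
  have hV : Integrable fun z => ‖V z‖ := by
    have h1 := integrable_mul_of_growth_of_decay (μ := volume) (F := fun _ => (1 : ℂ)) (G := V)
      aestronglyMeasurable_const hVc.aestronglyMeasurable ⟨1, 0, zero_le_one, fun z => by simp⟩
      (fun N => exists_norm_stft_asDist_le N Φ Φ)
    simpa using h1.norm
  have hd := SchwartzMap.denseRange_toLpCLM (E := EuclideanSpace ℝ n) (F := ℂ)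
    (p := 2) (μ := volume) ENNReal.ofNat_ne_top
  have seq : ∀ h : Lp ℂ 2 (volume : Measure (EuclideanSpace ℝ n)),
      ∃ u : ℕ → 𝓢(EuclideanSpace ℝ n, ℂ),
        Filter.Tendsto (fun j => (u j).toLp 2 volume) Filter.atTop (nhds h) := fun h => by
    obtain ⟨x, hx, hlim⟩ := mem_closure_iff_seq_limit.1 (hd h)
    choose u hu using hx
    refine ⟨u, ?_⟩
    rwa [show (fun j => (u j).toLp 2 volume) = x from funext hu]
  obtain ⟨u, hu⟩ := seq h
  obtain ⟨w, hw⟩ := seq k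
  obtain ⟨K, hK⟩ : ∃ K, ∀ j, ‖(u j).toLp 2 volume‖ * ‖(w j).toLp 2 volume‖ ≤ K := by
    obtain ⟨K, hK⟩ := ((hu.norm.mul hw.norm).bddAbove_range)
    exact ⟨K, fun j => hK ⟨j, rfl⟩⟩
  have e1 : ∀ j, ∫ z : EuclideanSpace ℝ n × EuclideanSpace ℝ n,
      inner ℂ ((u j).toLp 2 volume) (rhoLp z.1 z.2 ((w j).toLp 2 volume)) *
        conj (inner ℂ (Φ.toLp 2 volume) (rhoLp z.1 z.2 (Φ.toLp 2 volume))) =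
      inner ℂ ((u j).toLp 2 volume) (Φ.toLp 2 volume) *
        inner ℂ (Φ.toLp 2 volume) ((w j).toLp 2 volume) := fun j => by
    rw [← schwartzInner_eq_inner, ← schwartzInner_eq_inner, ← sesq_asDist,
      ← (integral_stft_mul_conj_stft (asDist Φ) Φ (w j) (u j)).2]
    congr 1; ext z
    rw [hS, hS, map_mul, Complex.conj_conj]
    linear_combination (stft Φ (asDist Φ) z * conj (stft (w j) (asDist (u j)) z)) *
      rhoPhase_mul_conj z.1 z.2
  have l1 : Filter.Tendsto (fun j => (inner ℂ ((u j).toLp 2 volume) (Φ.toLp 2 volume) *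
      inner ℂ (Φ.toLp 2 volume) ((w j).toLp 2 volume) : ℂ)) Filter.atTop
      (nhds (inner ℂ h (Φ.toLp 2 volume) * inner ℂ (Φ.toLp 2 volume) k)) :=
    (hu.inner tendsto_const_nhds).mul (tendsto_const_nhds.inner hw)
  have l2 : Filter.Tendsto (fun j => ∫ z : EuclideanSpace ℝ n × EuclideanSpace ℝ n,
      (inner ℂ ((u j).toLp 2 volume) (rhoLp z.1 z.2 ((w j).toLp 2 volume)) *
        conj (inner ℂ (Φ.toLp 2 volume) (rhoLp z.1 z.2 (Φ.toLp 2 volume))) : ℂ)) Filter.atTop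
      (nhds (∫ z : EuclideanSpace ℝ n × EuclideanSpace ℝ n, inner ℂ h (rhoLp z.1 z.2 k) *
        conj (inner ℂ (Φ.toLp 2 volume) (rhoLp z.1 z.2 (Φ.toLp 2 volume))))) := by
    -- Approximate `h` and `k` by Schwartz functions. The Schwartz pair supplies the integrable
    -- factor, and Cauchy-Schwarz bounds the other factor uniformly along the sequences.
    refine tendsto_integral_of_dominated_convergence (fun z => K * ‖V z‖) (fun j => ?_)
      (hV.const_mul K) (fun j => Filter.Eventually.of_forall fun z => ?_)
      (Filter.Eventually.of_forall fun z => ?_)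
    · have : ∀ z : EuclideanSpace ℝ n × EuclideanSpace ℝ n,
          (inner ℂ ((u j).toLp 2 volume) (rhoLp z.1 z.2 ((w j).toLp 2 volume)) *
          conj (inner ℂ (Φ.toLp 2 volume) (rhoLp z.1 z.2 (Φ.toLp 2 volume))) : ℂ) =
          conj (stft (w j) (asDist (u j)) z) * V z := fun z => by
        rw [hS, hS, map_mul, Complex.conj_conj]
        linear_combination (stft Φ (asDist Φ) z * conj (stft (w j) (asDist (u j)) z)) *
          rhoPhase_mul_conj z.1 z.2
      simp only [this]
      exact (((RCLike.continuous_conj).comp (continuous_stft _ _)).mul hVc).aestronglyMeasurable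
    · rw [norm_mul, RCLike.norm_conj, hS Φ Φ, norm_mul, norm_rhoPhase, one_mul, RCLike.norm_conj]
      refine mul_le_mul_of_nonneg_right ?_ (norm_nonneg _)
      refine (norm_inner_le_norm _ _).trans ?_
      rw [norm_rhoLp]
      exact hK j
    · exact (hu.inner (((isometry_rhoLp z.1 z.2).continuous.tendsto k).comp hw)).mul
        tendsto_const_nhds
  simp only [e1] at l2
  exact tendsto_nhds_unique l2 l1

end SchrodingerRep

/-! ### Linear changes of variables up to a constant -/

section LinearSubstitution

variable {V W : Type*} [NormedAddCommGroup V] [NormedSpace ℝ V] [MeasurableSpace V] [BorelSpace V] [NormedAddCommGroup W] [NormedSpace ℝ W]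
  [FiniteDimensional ℝ W] [MeasurableSpace W] [BorelSpace W]

/-- This is uniqueness of Haar measure. Jacobians enter only as unspecified positive constants;
where the value matters, a test function reveals it. -/
lemma exists_map_eq_smul (μ : Measure V) [μ.IsAddHaarMeasure] (ν : Measure W)
    [ν.IsAddHaarMeasure] (e : V ≃L[ℝ] W) : ∃ c : NNReal, c ≠ 0 ∧ μ.map e = c • ν := by
  have := e.isAddHaarMeasure_map μ
  exact ⟨_, (Measure.addHaarScalarFactor_pos_of_isAddHaarMeasure (μ.map e) ν).ne',
    Measure.isAddLeftInvariant_eq_smul (μ.map e) ν⟩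

lemma exists_integral_comp_linearEquiv (μ : Measure V) [μ.IsAddHaarMeasure] (ν : Measure W)
    [ν.IsAddHaarMeasure] (e : V ≃L[ℝ] W) :
    ∃ c : ℝ, 0 < c ∧ ∀ F : W → ℂ, ∫ z, F (e z) ∂μ = c * ∫ z, F z ∂ν := by
  obtain ⟨c, hc, h⟩ := exists_map_eq_smul μ ν e
  refine ⟨c, by positivity, fun F => ?_⟩
  rw [← e.toHomeomorph.measurableEmbedding.integral_map (f := e) F]
  rw [h, integral_smul_nnreal_measure]
  rfl

lemma exists_lintegral_comp_linearEquiv (μ : Measure V) [μ.IsAddHaarMeasure] (ν : Measure W)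
    [ν.IsAddHaarMeasure] (e : V ≃L[ℝ] W) :
    ∃ c : ℝ≥0∞, c ≠ 0 ∧ c ≠ ∞ ∧ ∀ F : W → ℝ≥0∞, ∫⁻ z, F (e z) ∂μ = c * ∫⁻ z, F z ∂ν := by
  obtain ⟨c, hc, h⟩ := exists_map_eq_smul μ ν e
  refine ⟨c, by positivity, ENNReal.coe_ne_top, fun F => ?_⟩
  rw [← e.toHomeomorph.measurableEmbedding.lintegral_map (g := e) F]
  rw [h, lintegral_smul_measure]
  rfl

lemma quasiMeasurePreserving_linearEquiv (μ : Measure V) [μ.IsAddHaarMeasure] (ν : Measure W)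
    [ν.IsAddHaarMeasure] (e : V ≃L[ℝ] W) : Measure.QuasiMeasurePreserving e μ ν := by
  obtain ⟨c, hc, h⟩ := exists_map_eq_smul μ ν e
  exact ⟨e.continuous.measurable, h ▸ Measure.smul_absolutelyContinuous⟩

instance {V W : Type*} [NormedAddCommGroup V] [NormedSpace ℝ V] [FiniteDimensional ℝ V]
    [MeasureSpace V] [BorelSpace V] [NormedAddCommGroup W] [NormedSpace ℝ W]
    [FiniteDimensional ℝ W] [MeasureSpace W] [BorelSpace W]
    [(volume : Measure V).IsAddHaarMeasure] [(volume : Measure W).IsAddHaarMeasure] :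
    (volume : Measure (V × W)).IsAddHaarMeasure := by
  rw [Measure.volume_eq_prod]; infer_instance

end LinearSubstitution

/-! ### Metaplectic operators on Schwartz functions and on distributions -/

section Metaplectic

open scoped ComplexConjugate

variable {n : Type} [Fintype n]

/-- The linear map `z ↦ A z` of phase space. -/
noncomputable def phaseMap (A : Matrix (n ⊕ n) (n ⊕ n) ℝ) :
    (EuclideanSpace ℝ n × EuclideanSpace ℝ n) →ₗ[ℝ] EuclideanSpace ℝ n × EuclideanSpace ℝ n where
  toFun z := (phaseFst A z.1 z.2, phaseSnd A z.1 z.2)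
  map_add' z w := by
    ext i <;> simp [phaseFst, phaseSnd, Matrix.mulVec_add] <;> ring
  map_smul' c z := by
    ext i <;> simp [phaseFst, phaseSnd, Matrix.mulVec_smul]

lemma phaseMap_apply (A : Matrix (n ⊕ n) (n ⊕ n) ℝ) (z : EuclideanSpace ℝ n × EuclideanSpace ℝ n) :
    phaseMap A z = (phaseFst A z.1 z.2, phaseSnd A z.1 z.2) := rfl

lemma phaseMap_mul (A B : Matrix (n ⊕ n) (n ⊕ n) ℝ)
    (z : EuclideanSpace ℝ n × EuclideanSpace ℝ n) :
    phaseMap (A * B) z = phaseMap A (phaseMap B z) := by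
  have h : A * B = Matrix.fromBlocks A.toBlocks₁₁ A.toBlocks₁₂ A.toBlocks₂₁ A.toBlocks₂₂ *
      Matrix.fromBlocks B.toBlocks₁₁ B.toBlocks₁₂ B.toBlocks₂₁ B.toBlocks₂₂ := by
    rw [Matrix.fromBlocks_toBlocks, Matrix.fromBlocks_toBlocks]
  rw [Matrix.fromBlocks_multiply] at h
  ext i <;> simp [phaseMap_apply, phaseFst, phaseSnd, h, Matrix.mulVec_add, Matrix.add_mulVec,
    Matrix.mulVec_mulVec] <;> ring

variable [DecidableEq n]

lemma phaseMap_one (z : EuclideanSpace ℝ n × EuclideanSpace ℝ n) :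
    phaseMap (1 : Matrix (n ⊕ n) (n ⊕ n) ℝ) z = z := by
  have h : (1 : Matrix (n ⊕ n) (n ⊕ n) ℝ) = Matrix.fromBlocks 1 0 0 1 := Matrix.fromBlocks_one.symm
  ext i <;> simp only [phaseMap_apply, phaseFst, phaseSnd, h, Matrix.toBlocks_fromBlocks₁₁,
    Matrix.toBlocks_fromBlocks₁₂, Matrix.toBlocks_fromBlocks₂₁, Matrix.toBlocks_fromBlocks₂₂] <;>
    simp

/-- The linear automorphism `z ↦ A z` of phase space. -/
noncomputable def phaseEquiv (A : Matrix (n ⊕ n) (n ⊕ n) ℝ) (hA : IsUnit A.det) :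
    (EuclideanSpace ℝ n × EuclideanSpace ℝ n) ≃ₗ[ℝ] EuclideanSpace ℝ n × EuclideanSpace ℝ n :=
  LinearEquiv.ofLinearMap (phaseMap A) (phaseMap A⁻¹)
    (LinearMap.ext fun z => by
      rw [LinearMap.comp_apply, ← phaseMap_mul, Matrix.mul_nonsing_inv _ hA, phaseMap_one]; rfl)
    (LinearMap.ext fun z => by
      rw [LinearMap.comp_apply, ← phaseMap_mul, Matrix.nonsing_inv_mul _ hA, phaseMap_one]; rfl)

variable {A : Matrix (n ⊕ n) (n ⊕ n) ℝ}
  {U : Lp ℂ 2 (volume : Measure (EuclideanSpace ℝ n)) ≃ₗᵢ[ℂ]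
    Lp ℂ 2 (volume : Measure (EuclideanSpace ℝ n))}

lemma IsMetaplectic.map_rhoLp (hU : IsMetaplectic A U) (x ξ : EuclideanSpace ℝ n)
    (F : Lp ℂ 2 (volume : Measure (EuclideanSpace ℝ n))) :
    U (rhoLp x ξ F) = rhoLp (phaseFst A x ξ) (phaseSnd A x ξ) (U F) :=
  Lp.ext ((hU.2 x ξ F _ (coeFn_rhoLp x ξ F)).trans (coeFn_rhoLp _ _ _).symm)

lemma IsMetaplectic.isUnit_det (hU : IsMetaplectic A U) : IsUnit A.det :=
  SymplecticGroup.symplectic_det hU.1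

/-- A metaplectic operator maps `Ψ` to a multiple of `Φ` if the ambiguity functions of `Ψ` and `Φ`
correspond to each other. -/
lemma IsMetaplectic.exists_smul_eq (hU : IsMetaplectic A U) {Ψ Φ : 𝓢(EuclideanSpace ℝ n, ℂ)}
    (hΦ : Φ ≠ 0) {κ : ℂ}
    (h : ∀ x ξ, schwartzInner Φ (rhoSchwartz (phaseFst A x ξ) (phaseSnd A x ξ) Φ) =
      κ * schwartzInner Ψ (rhoSchwartz x ξ Ψ)) :
    ∃ c : ℂ, c ≠ 0 ∧ U (Ψ.toLp 2 volume) = c • Φ.toLp 2 volume := by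
  set a := Φ.toLp 2 volume
  set η := U (Ψ.toLp 2 volume) with hη
  have ha : a ≠ 0 := fun h0 => schwartzInner_self_ne_zero hΦ (by
    rw [schwartzInner_eq_inner]; exact inner_self_eq_zero.2 h0)
  -- As `A` is onto, the hypothesis together with the intertwining relation says that the ambiguity
  -- functions of `a` and `η` are proportional on the whole phase space.
  have h1 : ∀ w : EuclideanSpace ℝ n × EuclideanSpace ℝ n,
      (inner ℂ a (rhoLp w.1 w.2 a) : ℂ) = conj κ * inner ℂ η (rhoLp w.1 w.2 η) := by
    intro w
    obtain ⟨z, rfl⟩ := (phaseEquiv A hU.isUnit_det).surjective w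
    change inner ℂ a (rhoLp (phaseFst A z.1 z.2) (phaseSnd A z.1 z.2) a) =
      conj κ * inner ℂ η (rhoLp (phaseFst A z.1 z.2) (phaseSnd A z.1 z.2) η)
    rw [hη, ← hU.map_rhoLp, U.inner_map_map, rhoLp_toLp, rhoLp_toLp, ← schwartzInner_eq_inner,
      ← schwartzInner_eq_inner, ← conj_schwartzInner, h, map_mul, conj_schwartzInner]
  have h0 : (inner ℂ a a : ℂ) = conj κ * inner ℂ η η := by
    have := h1 (0, 0)
    simpa only [rhoLp_zero_zero] using this
  have haa : (inner ℂ a a : ℂ) ≠ 0 := fun h => ha (inner_self_eq_zero.1 h)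
  have hκ : conj κ ≠ 0 := fun h => haa (by rw [h0, h, zero_mul])
  have hη0 : η ≠ 0 := fun h => haa (by rw [h0, h, inner_zero_left, mul_zero])
  -- Integrating both ambiguity functions against that of `Φ` gives `⟨η, η⟩⟨a, a⟩ = |⟨a, η⟩|²`. This
  -- is equality in Cauchy-Schwarz, so the two vectors are collinear.
  have h2 := integral_inner_rhoLp η η Φ
  have h3 := integral_inner_rhoLp a a Φ
  have h4 : (inner ℂ a a * inner ℂ a a : ℂ) = conj κ * (inner ℂ η a * inner ℂ a η) := by
    rw [← h2, ← h3, ← integral_const_mul]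
    congr 1; ext w
    rw [← mul_assoc, ← h1]
  have h5 : (inner ℂ η η * inner ℂ a a : ℂ) = inner ℂ η a * inner ℂ a η := by
    refine mul_left_cancel₀ hκ ?_
    rw [← h4, ← mul_assoc, ← h0]
  have h6 : ‖(inner ℂ a η : ℂ)‖ = ‖a‖ * ‖η‖ := by
    have h7 := congrArg norm h5
    rw [norm_mul, norm_mul, inner_self_eq_norm_sq_to_K, inner_self_eq_norm_sq_to_K,
      norm_inner_symm η a] at h7
    simp only [norm_pow, RCLike.norm_ofReal, abs_norm] at h7
    have : ‖(inner ℂ a η : ℂ)‖ ^ 2 = (‖a‖ * ‖η‖) ^ 2 := by rw [sq, ← h7]; ring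
    exact (sq_eq_sq₀ (norm_nonneg _) (by positivity)).1 this
  exact (norm_inner_eq_norm_iff ha hη0).1 h6

/-- The action of a metaplectic operator on tempered distributions is determined by the
values on the orbit of a single Schwartz function. -/
lemma IsMetaplectic.isMetaplecticImage (hU : IsMetaplectic A U) {Ψ₀ Φ₀ : 𝓢(EuclideanSpace ℝ n, ℂ)}
    (hΨ₀ : Ψ₀ ≠ 0) (h₀ : Φ₀.toLp 2 volume = U (Ψ₀.toLp 2 volume)) {T W : 𝓢'(EuclideanSpace ℝ n, ℂ)}
    (h : ∀ x ξ, sesq W (rhoSchwartz (phaseFst A x ξ) (phaseSnd A x ξ) Φ₀) =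
      sesq T (rhoSchwartz x ξ Ψ₀)) : IsMetaplecticImage U T W := by
  have hin : ∀ {Ψ Φ : 𝓢(EuclideanSpace ℝ n, ℂ)}, Φ.toLp 2 volume = U (Ψ.toLp 2 volume) → ∀ x ξ,
      schwartzInner Φ (rhoSchwartz (phaseFst A x ξ) (phaseSnd A x ξ) Φ₀) =
        schwartzInner Ψ (rhoSchwartz x ξ Ψ₀) := fun {Ψ Φ} hΦ x ξ => by
    rw [schwartzInner_eq_inner, schwartzInner_eq_inner, ← rhoLp_toLp, ← rhoLp_toLp, hΦ, h₀,
      ← hU.map_rhoLp, U.inner_map_map]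
  have hN : schwartzInner Φ₀ Φ₀ = schwartzInner Ψ₀ Ψ₀ := by
    rw [schwartzInner_eq_inner, schwartzInner_eq_inner, h₀, U.inner_map_map]
  have hN0 := schwartzInner_self_ne_zero hΨ₀
  obtain ⟨c, hc, hcI⟩ := exists_integral_comp_linearEquiv
    (volume : Measure (EuclideanSpace ℝ n × EuclideanSpace ℝ n))
    (volume : Measure (EuclideanSpace ℝ n × EuclideanSpace ℝ n))
    (phaseEquiv A hU.isUnit_det).toContinuousLinearEquiv
  -- Both pairings are expanded by Moyal's identity over the orbits of `Ψ₀` and `Φ₀`. The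
  -- substitution `z ↦ Az` matches the integrands and leaves the Jacobian `c`.
  have key : ∀ {T W : 𝓢'(EuclideanSpace ℝ n, ℂ)},
      (∀ x ξ, sesq W (rhoSchwartz (phaseFst A x ξ) (phaseSnd A x ξ) Φ₀) =
        sesq T (rhoSchwartz x ξ Ψ₀)) →
      ∀ {Ψ Φ : 𝓢(EuclideanSpace ℝ n, ℂ)}, Φ.toLp 2 volume = U (Ψ.toLp 2 volume) →
      sesq T Ψ = c * sesq W Φ := fun {T W} h {Ψ Φ} hΦ => by
    refine mul_right_cancel₀ hN0 ?_
    rw [← integral_sesq_rhoSchwartz, mul_assoc]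
    conv_rhs => rw [← hN, ← integral_sesq_rhoSchwartz, ← hcI]
    congr 1; ext z
    rw [← h, ← hin hΦ]
    rfl
  -- The identity is tested on `Ψ₀` and `Φ₀` themselves, viewed as distributions. They have the same
  -- norm because `U` is isometric, so the determinant of `A` need not be evaluated.
  have hc1 : (c : ℂ) = 1 := by
    have h1 := key (T := asDist Ψ₀) (W := asDist Φ₀)
      (fun x ξ => by rw [sesq_asDist, sesq_asDist, hin h₀]) h₀
    rw [sesq_asDist, sesq_asDist, hN] at h1
    exact mul_right_cancel₀ hN0 (by rw [← h1, one_mul])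
  intro Ψ Φ hΦ
  rw [key h hΦ, hc1, one_mul]

lemma IsMetaplecticImage.sesq_rhoSchwartz (hU : IsMetaplectic A U)
    {Ψ₀ Φ₀ : 𝓢(EuclideanSpace ℝ n, ℂ)} (h₀ : Φ₀.toLp 2 volume = U (Ψ₀.toLp 2 volume))
    {T W : 𝓢'(EuclideanSpace ℝ n, ℂ)} (h : IsMetaplecticImage U T W) (x ξ : EuclideanSpace ℝ n) :
    sesq W (rhoSchwartz (phaseFst A x ξ) (phaseSnd A x ξ) Φ₀) = sesq T (rhoSchwartz x ξ Ψ₀) :=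
  h _ _ (by rw [← rhoLp_toLp, ← rhoLp_toLp, hU.map_rhoLp, h₀])

end Metaplectic

/-! ### The Gaussian -/

section Gaussian

open scoped ComplexConjugate ContDiff

/-- A smooth function which equals `e^{-πs}` for `s ≥ 0` and vanishes for `s ≤ -1`. -/
noncomputable def truncExp (s : ℝ) : ℝ :=
  Real.smoothTransition (s + 1) * Real.exp (-Real.pi * s)

lemma contDiff_truncExp : ContDiff ℝ ∞ truncExp := by
  unfold truncExp
  have h1 : ContDiff ℝ ∞ fun s : ℝ => Real.smoothTransition (s + 1) :=
    Real.smoothTransition.contDiff.comp (contDiff_id.add contDiff_const)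
  exact h1.mul (contDiff_const.mul contDiff_id).exp

lemma truncExp_of_nonneg {s : ℝ} (hs : 0 ≤ s) : truncExp s = Real.exp (-Real.pi * s) := by
  rw [truncExp, Real.smoothTransition.one_of_one_le (by linarith), one_mul]

/-- Left of `-1` the function vanishes, on `[-1, 0]` continuity on a compact set suffices, and for
positive `s` the bound is `s ^ k ≤ k! e^{πs}`, where each derivative contributes a factor `π`. -/
lemma exists_truncExp_decay (k n : ℕ) :
    ∃ C, ∀ s : ℝ, ‖s‖ ^ k * ‖iteratedFDeriv ℝ n truncExp s‖ ≤ C := by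
  obtain ⟨C, hC⟩ := (isCompact_Icc (a := (-1 : ℝ)) (b := 0)).exists_bound_of_continuousOn
    (f := fun s : ℝ => ‖s‖ ^ k * ‖iteratedFDeriv ℝ n truncExp s‖)
    (((continuous_norm.pow k).mul
      (contDiff_truncExp.continuous_iteratedFDeriv (by exact_mod_cast le_top)).norm).continuousOn)
  refine ⟨max C (Real.pi ^ n * k.factorial), fun s => ?_⟩
  rcases lt_or_ge s (-1) with h1 | h1
  · have : truncExp =ᶠ[nhds s] fun _ => 0 := by
      filter_upwards [Iio_mem_nhds h1] with t ht
      rw [truncExp, Real.smoothTransition.zero_of_nonpos (by linarith [Set.mem_Iio.1 ht]), zero_mul]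
    rw [norm_iteratedFDeriv_eq_norm_iteratedDeriv, this.iteratedDeriv_eq n]
    simp only [iteratedDeriv_const]
    refine le_max_of_le_right ?_
    split_ifs <;> simp <;> positivity
  rcases lt_or_ge 0 s with h2 | h2
  · have : truncExp =ᶠ[nhds s] fun t => Real.exp (-Real.pi * t) := by
      filter_upwards [Ioi_mem_nhds h2] with t ht
      exact truncExp_of_nonneg (le_of_lt ht)
    rw [norm_iteratedFDeriv_eq_norm_iteratedDeriv, this.iteratedDeriv_eq n,
      iteratedDeriv_exp_const_mul]
    refine le_max_of_le_right ?_
    rw [norm_mul, norm_pow, Real.norm_eq_abs, Real.norm_eq_abs, Real.norm_eq_abs, abs_neg,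
      abs_of_pos Real.pi_pos, abs_of_pos h2, Real.abs_exp]
    have h3 : s ^ k ≤ k.factorial * Real.exp (Real.pi * s) := by
      have := Real.pow_div_factorial_le_exp s h2.le k
      rw [div_le_iff₀ (by positivity)] at this
      refine this.trans ?_
      rw [mul_comm]
      gcongr
      nlinarith [Real.pi_gt_three]
    calc s ^ k * (Real.pi ^ n * Real.exp (-Real.pi * s))
        ≤ (k.factorial * Real.exp (Real.pi * s)) * (Real.pi ^ n * Real.exp (-Real.pi * s)) := by
          gcongr
      _ = Real.pi ^ n * k.factorial * (Real.exp (Real.pi * s) * Real.exp (-Real.pi * s)) := by ring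
      _ = _ := by rw [← Real.exp_add]; simp
  · refine le_max_of_le_left ((le_abs_self _).trans (hC s ⟨h1, h2⟩))

/-- `truncExp` as a Schwartz function. -/
noncomputable def truncExpSchwartz : 𝓢(ℝ, ℝ) where
  toFun := truncExp
  smooth' := contDiff_truncExp
  decay' := exists_truncExp_decay

variable {n : Type} [Fintype n]

/-- The Gaussian `t ↦ e^{-π|t|²}` as a Schwartz function. -/
noncomputable def gaussSchwartz (n : Type) [Fintype n] : 𝓢(EuclideanSpace ℝ n, ℂ) :=
  SchwartzMap.postcompCLM (𝕜 := ℝ) Complex.ofRealCLM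
    (SchwartzMap.compCLM ℝ (Function.hasTemperateGrowth_norm_sq (EuclideanSpace ℝ n))
      ⟨1, 1, fun x => by
        rw [one_mul, pow_one, Real.norm_of_nonneg (by positivity)]
        nlinarith [sq_nonneg (‖x‖ - 1)]⟩ truncExpSchwartz)

lemma gaussSchwartz_apply (t : EuclideanSpace ℝ n) :
    gaussSchwartz n t = (Real.exp (-Real.pi * ‖t‖ ^ 2) : ℝ) := by
  have : gaussSchwartz n t = (truncExp (‖t‖ ^ 2) : ℝ) := by
    simp [gaussSchwartz]; rfl
  rw [this, truncExp_of_nonneg (by positivity)]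

lemma gaussSchwartz_ne_zero : gaussSchwartz n ≠ 0 := fun h => by
  have := DFunLike.congr_fun h 0
  simp [gaussSchwartz_apply] at this

lemma conj_gaussSchwartz (t : EuclideanSpace ℝ n) :
    conj (gaussSchwartz n t) = gaussSchwartz n t := by
  rw [gaussSchwartz_apply, Complex.conj_ofReal]

/-- The short-time Fourier transform of the Gaussian. -/
lemma exists_stft_gauss (n : Type) [Fintype n] : ∃ c : ℂ, c ≠ 0 ∧
    ∀ x ξ : EuclideanSpace ℝ n, stft (gaussSchwartz n) (asDist (gaussSchwartz n)) (x, ξ) =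
      c * Complex.exp (((-(Real.pi * ⟪x, ξ⟫) : ℝ) : ℂ) * Complex.I) *
        (Real.exp (-(Real.pi / 2) * (‖x‖ ^ 2 + ‖ξ‖ ^ 2)) : ℝ) := by
  refine ⟨(Real.pi / (2 * Real.pi : ℝ) : ℂ) ^ (Module.finrank ℝ (EuclideanSpace ℝ n) / 2 : ℂ), ?_,
    fun x ξ => ?_⟩
  · rw [Complex.cpow_ne_zero_iff]
    left
    exact div_ne_zero (by exact_mod_cast Real.pi_ne_zero)
      (by exact_mod_cast (by positivity : (2 * Real.pi : ℝ) ≠ 0))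
  have hb : 0 < ((2 * Real.pi : ℝ) : ℂ).re := by
    rw [Complex.ofReal_re]; positivity
  have h := GaussianFourier.integral_cexp_neg_mul_sq_norm_add hb (-2 * Real.pi * Complex.I) ξ
  rw [stft_asDist, schwartzInner]
  -- Shifting by `x / 2` makes the two Gaussians symmetric. The parallelogram law then separates `x`
  -- from `t`, and a Fourier integral of a Gaussian with parameter `2π` remains.
  rw [← integral_add_right_eq_self _ ((1 / 2 : ℝ) • x)]
  have e : ∀ t : EuclideanSpace ℝ n, gaussSchwartz n (t + (1 / 2 : ℝ) • x) *
      conj (tfShift x ξ (gaussSchwartz n) (t + (1 / 2 : ℝ) • x)) =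
      Complex.exp (((-(Real.pi * ⟪x, ξ⟫) : ℝ) : ℂ) * Complex.I) *
        (Real.exp (-(Real.pi / 2) * ‖x‖ ^ 2) : ℝ) *
      Complex.exp (-((2 * Real.pi : ℝ) : ℂ) * ‖t‖ ^ 2 + -2 * Real.pi * Complex.I * ⟪ξ, t⟫) := by
    intro t
    have e1 : t + (1 / 2 : ℝ) • x - x = t - (1 / 2 : ℝ) • x := by
      rw [add_sub_assoc, sub_eq_add_neg t]
      congr 1
      rw [sub_eq_iff_eq_add, ← sub_eq_neg_add, eq_sub_iff_add_eq, ← add_smul]; norm_num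
    have e2 : ‖t + (1 / 2 : ℝ) • x‖ ^ 2 + ‖t - (1 / 2 : ℝ) • x‖ ^ 2 =
        2 * ‖t‖ ^ 2 + (1 / 2) * ‖x‖ ^ 2 := by
      have := parallelogram_law_with_norm ℝ t ((1 / 2 : ℝ) • x)
      rw [norm_smul] at this
      norm_num at this
      linarith
    rw [tfShift_apply, map_mul, conj_modChar, e1, conj_gaussSchwartz, gaussSchwartz_apply,
      gaussSchwartz_apply, modChar, inner_neg_left, inner_add_right, inner_smul_right,
      real_inner_comm x ξ, ← mul_assoc, mul_right_comm, ← Complex.ofReal_mul, ← Real.exp_add,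
      ← mul_add, e2, Complex.ofReal_exp, Complex.ofReal_exp, ← Complex.exp_add, ← Complex.exp_add,
      ← Complex.exp_add]
    congr 1
    push_cast
    ring
  simp only [e]
  rw [integral_const_mul, h]
  have e3 : Complex.exp ((-2 * Real.pi * Complex.I) ^ 2 * ‖ξ‖ ^ 2 / (4 * ((2 * Real.pi : ℝ) : ℂ))) =
      (Real.exp (-(Real.pi / 2) * ‖ξ‖ ^ 2) : ℝ) := by
    rw [Complex.ofReal_exp]
    congr 1
    have : (Real.pi : ℂ) ≠ 0 := by exact_mod_cast Real.pi_ne_zero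
    push_cast
    rw [mul_pow, Complex.I_sq]
    field_simp
    ring
  rw [e3, mul_add, Real.exp_add]
  push_cast
  ring

end Gaussian

/-! ### Construction of tempered distributions -/

section Construction

open scoped ComplexConjugate

variable {n : Type} [Fintype n]

/-- A functional on Schwartz functions dominated by a continuous seminorm is a tempered
distribution. -/
lemma exists_temperedDistribution (Λ : 𝓢(EuclideanSpace ℝ n, ℂ) →ₗ[ℂ] ℂ)
    (q : Seminorm ℂ 𝓢(EuclideanSpace ℝ n, ℂ)) (hq : Continuous q) (h : ∀ Θ, ‖Λ Θ‖ ≤ q Θ) :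
    ∃ T : 𝓢'(EuclideanSpace ℝ n, ℂ), ∀ Θ, T Θ = Λ Θ := by
  have hc : Continuous Λ := by
    refine continuous_of_continuousAt_zero Λ ?_
    rw [ContinuousAt, map_zero]
    refine squeeze_zero_norm h ?_
    simpa using hq.tendsto 0
  exact ⟨ContinuousLinearMap.toPointwiseConvergenceCLM ℂ (RingHom.id ℂ) _ _ ⟨Λ, hc⟩, fun _ => rfl⟩

/-- Integration of a linear family of rapidly decaying functions against a function of polynomial
growth defines a tempered distribution. -/
lemma exists_temperedDistribution_integral {Z : Type*} [NormedAddCommGroup Z] [NormedSpace ℝ Z]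
    [FiniteDimensional ℝ Z] [MeasurableSpace Z] [BorelSpace Z] {μ : Measure Z}
    [μ.HasTemperateGrowth] {S : Z → ℂ} (hS : AEStronglyMeasurable S μ)
    (hSg : ∃ (C : ℝ) (N : ℕ), 0 ≤ C ∧ ∀ z, ‖S z‖ ≤ C * (1 + ‖z‖) ^ N)
    (K : 𝓢(EuclideanSpace ℝ n, ℂ) → Z → ℂ) (hadd : ∀ Θ Θ' z, K (Θ + Θ') z = K Θ z + K Θ' z)
    (hsmul : ∀ (c : ℂ) Θ z, K (c • Θ) z = c * K Θ z)
    (hK : ∀ Θ, AEStronglyMeasurable (K Θ) μ)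
    (hKd : ∀ N : ℕ, ∃ q : Seminorm ℂ 𝓢(EuclideanSpace ℝ n, ℂ), Continuous q ∧
      ∀ Θ z, (1 + ‖z‖) ^ N * ‖K Θ z‖ ≤ q Θ) :
    ∃ T : 𝓢'(EuclideanSpace ℝ n, ℂ), ∀ Θ, Integrable (fun z => S z * K Θ z) μ ∧
      T Θ = ∫ z, S z * K Θ z ∂μ := by
  obtain ⟨C, N, hC, hSg⟩ := hSg
  obtain ⟨M, hM⟩ := (inferInstance : μ.HasTemperateGrowth).exists_integrable
  obtain ⟨q, hq, hqK⟩ := hKd (N + M)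
  have hb : ∀ Θ z, ‖S z * K Θ z‖ ≤ C * q Θ * (1 + ‖z‖) ^ (-(M : ℝ)) := fun Θ z => by
    have h1 : (0 : ℝ) < 1 + ‖z‖ := by positivity
    rw [Real.rpow_neg h1.le, Real.rpow_natCast, ← div_eq_mul_inv, le_div_iff₀ (by positivity),
      norm_mul]
    calc ‖S z‖ * ‖K Θ z‖ * (1 + ‖z‖) ^ M ≤ C * (1 + ‖z‖) ^ N * ‖K Θ z‖ * (1 + ‖z‖) ^ M := by
          gcongr; exact hSg z
      _ = C * ((1 + ‖z‖) ^ (N + M) * ‖K Θ z‖) := by rw [pow_add]; ring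
      _ ≤ C * q Θ := by gcongr; exact hqK Θ z
  have hi : ∀ Θ, Integrable (fun z => S z * K Θ z) μ := fun Θ =>
    (hM.const_mul (C * q Θ)).mono' (hS.mul (hK Θ)) (Filter.Eventually.of_forall (hb Θ))
  set J := ∫ z, (1 + ‖z‖) ^ (-(M : ℝ)) ∂μ
  have hJ : 0 ≤ C * J := mul_nonneg hC (integral_nonneg fun z => by positivity)
  obtain ⟨T, hT⟩ := exists_temperedDistribution
    { toFun := fun Θ => ∫ z, S z * K Θ z ∂μ
      map_add' := fun Θ Θ' => by
        simp only [hadd, mul_add]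
        exact integral_add (hi Θ) (hi Θ')
      map_smul' := fun c Θ => by
        simp only [hsmul, mul_left_comm _ c, RingHom.id_apply, smul_eq_mul]
        exact integral_const_mul _ _ }
    (((C * J).toNNReal) • q) (hq.const_smul ((C * J).toNNReal)) (fun Θ => by
      calc ‖∫ z, S z * K Θ z ∂μ‖ ≤ ∫ z, C * q Θ * (1 + ‖z‖) ^ (-(M : ℝ)) ∂μ :=
            norm_integral_le_of_norm_le (hM.const_mul _) (Filter.Eventually.of_forall (hb Θ))
        _ = C * J * q Θ := by rw [integral_const_mul]; ring
        _ = _ := by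
            rw [smul_apply, NNReal.smul_def, Real.coe_toNNReal _ hJ]; rfl)
  exact ⟨T, fun Θ => ⟨hi Θ, hT Θ⟩⟩

/-- The complex conjugate of a tempered distribution. -/
lemma exists_conjDist (g : 𝓢'(EuclideanSpace ℝ n, ℂ)) :
    ∃ h : 𝓢'(EuclideanSpace ℝ n, ℂ), ∀ ψ, h ψ = conj (g (conjSchwartz ψ)) := by
  have hadd : ∀ ψ γ : 𝓢(EuclideanSpace ℝ n, ℂ),
      conjSchwartz (ψ + γ) = conjSchwartz ψ + conjSchwartz γ := fun ψ γ => by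
    ext t; simp [conjSchwartz_apply]
  refine ⟨ContinuousLinearMap.toPointwiseConvergenceCLM ℂ (RingHom.id ℂ) _ _
    { toFun := fun ψ => conj (g (conjSchwartz ψ))
      map_add' := fun ψ γ => by rw [hadd, map_add, map_add]
      map_smul' := fun c ψ => by
        rw [conjSchwartz_smul, map_smul, smul_eq_mul, map_mul, Complex.conj_conj]; rfl
      cont := RCLike.continuous_conj.comp (g.continuous.comp continuous_conjSchwartz) },
    fun _ => rfl⟩

/-- The composition of a tempered distribution with a linear isomorphism. -/
lemma exists_compDist (g : 𝓢'(EuclideanSpace ℝ n, ℂ))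
    (D : EuclideanSpace ℝ n ≃L[ℝ] EuclideanSpace ℝ n) :
    ∃ h : 𝓢'(EuclideanSpace ℝ n, ℂ), ∀ ψ,
      h ψ = g (SchwartzMap.compCLMOfContinuousLinearEquiv ℂ D ψ) :=
  ⟨ContinuousLinearMap.toPointwiseConvergenceCLM ℂ (RingHom.id ℂ) _ _
    { toFun := fun ψ => g (SchwartzMap.compCLMOfContinuousLinearEquiv ℂ D ψ)
      map_add' := fun ψ γ => by rw [map_add, map_add]
      map_smul' := fun c ψ => by rw [map_smul, map_smul]; rfl
      cont := g.continuous.comp (SchwartzMap.compCLMOfContinuousLinearEquiv ℂ D).continuous },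
    fun _ => rfl⟩

end Construction

/-! ### Tensor products -/

section Tensor

open scoped ComplexConjugate

variable {d : ℕ}

/-- The identification of `ℝᵈ × ℝᵈ` with `ℝ²ᵈ`. -/
noncomputable abbrev joinEquiv (d : ℕ) : (Rd d × Rd d) ≃L[ℝ] R2d d :=
  EuclideanSpace.sumEquivProd.symm

lemma joinPt_inl (x y : Rd d) (i : Fin d) : joinPt x y (Sum.inl i) = x i := rfl

lemma joinPt_inr (x y : Rd d) (i : Fin d) : joinPt x y (Sum.inr i) = y i := rfl

lemma joinPt_sub (x y x' y' : Rd d) : joinPt x y - joinPt x' y' = joinPt (x - x') (y - y') :=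
  ((joinEquiv d).map_sub (x, y) (x', y')).symm

lemma inner_joinPt (x y x' y' : Rd d) : ⟪joinPt x y, joinPt x' y'⟫ = ⟪x, x'⟫ + ⟪y, y'⟫ := by
  simp only [PiLp.inner_apply, Fintype.sum_sum_type, joinPt_inl, joinPt_inr]

lemma norm_sq_joinPt (x y : Rd d) : ‖joinPt x y‖ ^ 2 = ‖x‖ ^ 2 + ‖y‖ ^ 2 := by
  rw [← real_inner_self_eq_norm_sq, inner_joinPt, real_inner_self_eq_norm_sq,
    real_inner_self_eq_norm_sq]

lemma exists_eq_joinPt (u : R2d d) : ∃ x y : Rd d, u = joinPt x y :=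
  ⟨((joinEquiv d).symm u).1, ((joinEquiv d).symm u).2, ((joinEquiv d).apply_symm_apply u).symm⟩

lemma modChar_joinPt (ξ η x y : Rd d) :
    modChar (joinPt ξ η) (joinPt x y) = modChar ξ x * modChar η y := by
  rw [modChar, modChar, modChar, inner_joinPt, ← Complex.exp_add]
  congr 1
  push_cast
  ring

lemma rhoPhase_joinPt (x y ξ η : Rd d) :
    rhoPhase (joinPt x y) (joinPt ξ η) = rhoPhase x ξ * rhoPhase y η := by
  rw [rhoPhase, rhoPhase, rhoPhase, inner_joinPt, ← Complex.exp_add]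
  congr 1
  push_cast
  ring

/-- `Θ = φ ⊗ ψ`. -/
def IsSchwartzTensor (Θ : 𝓢(R2d d, ℂ)) (φ ψ : 𝓢(Rd d, ℂ)) : Prop :=
  ∀ x y, Θ (joinPt x y) = φ x * ψ y

variable {Θ Θ' : 𝓢(R2d d, ℂ)} {φ ψ φ' ψ' : 𝓢(Rd d, ℂ)}

lemma IsSchwartzTensor.conj (h : IsSchwartzTensor Θ φ ψ) :
    IsSchwartzTensor (conjSchwartz Θ) (conjSchwartz φ) (conjSchwartz ψ) := fun x y => by
  rw [conjSchwartz_apply, h, map_mul, conjSchwartz_apply, conjSchwartz_apply]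

lemma IsSchwartzTensor.tfShift (h : IsSchwartzTensor Θ φ ψ) (a₁ a₂ α₁ α₂ : Rd d) :
    IsSchwartzTensor (tfShift (joinPt a₁ a₂) (joinPt α₁ α₂) Θ) (tfShift a₁ α₁ φ)
      (tfShift a₂ α₂ ψ) := fun x y => by
  rw [tfShift_apply, joinPt_sub, h, modChar_joinPt, tfShift_apply, tfShift_apply]
  ring

lemma IsSchwartzTensor.rhoSchwartz (h : IsSchwartzTensor Θ φ ψ) (a₁ a₂ α₁ α₂ : Rd d) :
    IsSchwartzTensor (rhoSchwartz (joinPt a₁ a₂) (joinPt α₁ α₂) Θ) (rhoSchwartz a₁ α₁ φ)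
      (rhoSchwartz a₂ α₂ ψ) := fun x y => by
  change rhoPhase _ _ * _root_.tfShift _ _ Θ _ = (rhoPhase _ _ * _root_.tfShift _ _ φ _) *
    (rhoPhase _ _ * _root_.tfShift _ _ ψ _)
  rw [h.tfShift, rhoPhase_joinPt]
  ring

lemma exists_integral_joinPt (d : ℕ) : ∃ c : ℝ, 0 < c ∧ ∀ F : R2d d → ℂ,
    ∫ z : Rd d × Rd d, F (joinPt z.1 z.2) = c * ∫ u, F u :=
  exists_integral_comp_linearEquiv volume volume (joinEquiv d)

lemma exists_schwartzInner_tensor (d : ℕ) : ∃ c : ℂ, c ≠ 0 ∧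
    ∀ {Θ Θ' : 𝓢(R2d d, ℂ)} {φ ψ φ' ψ' : 𝓢(Rd d, ℂ)}, IsSchwartzTensor Θ φ ψ →
      IsSchwartzTensor Θ' φ' ψ' →
      schwartzInner Θ Θ' = c * (schwartzInner φ φ' * schwartzInner ψ ψ') := by
  obtain ⟨c, hc, h⟩ := exists_integral_joinPt d
  have hc' : (c : ℂ) ≠ 0 := by exact_mod_cast hc.ne'
  refine ⟨(c : ℂ)⁻¹, inv_ne_zero hc', fun {Θ Θ' φ ψ φ' ψ'} hΘ hΘ' => ?_⟩
  rw [eq_inv_mul_iff_mul_eq₀ hc', schwartzInner, ← h, schwartzInner, schwartzInner,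
    ← integral_prod_mul, ← Measure.volume_eq_prod]
  congr 1; ext z
  rw [hΘ, hΘ', map_mul]
  ring

lemma gaussSchwartz_joinPt (d : ℕ) :
    IsSchwartzTensor (gaussSchwartz (Fin d ⊕ Fin d)) (gaussSchwartz (Fin d))
      (gaussSchwartz (Fin d)) := fun x y => by
  rw [gaussSchwartz_apply, gaussSchwartz_apply, gaussSchwartz_apply, norm_sq_joinPt, mul_add,
    Real.exp_add, Complex.ofReal_mul]

/-- The identification of the product of two phase spaces with the phase space of `ℝ²ᵈ`. -/
noncomputable def phaseJoin (d : ℕ) :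
    ((Rd d × Rd d) × (Rd d × Rd d)) ≃L[ℝ] (R2d d × R2d d) where
  toFun w := (joinPt w.1.1 w.2.1, joinPt w.1.2 w.2.2)
  invFun z := ((((joinEquiv d).symm z.1).1, ((joinEquiv d).symm z.2).1),
    (((joinEquiv d).symm z.1).2, ((joinEquiv d).symm z.2).2))
  left_inv w := by simp [joinPt]
  right_inv z := Prod.ext ((joinEquiv d).apply_symm_apply z.1) ((joinEquiv d).apply_symm_apply z.2)
  map_add' w w' := Prod.ext ((joinEquiv d).map_add (w.1.1, w.2.1) (w'.1.1, w'.2.1))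
    ((joinEquiv d).map_add (w.1.2, w.2.2) (w'.1.2, w'.2.2))
  map_smul' c w := Prod.ext ((joinEquiv d).map_smul c (w.1.1, w.2.1))
    ((joinEquiv d).map_smul c (w.1.2, w.2.2))
  continuous_toFun := by
    refine Continuous.prodMk ((joinEquiv d).continuous.comp ?_)
      ((joinEquiv d).continuous.comp ?_) <;> fun_prop
  continuous_invFun := by
    have := (joinEquiv d).symm.continuous
    fun_prop

/-- The left side is a bilinear pairing, hence linear in `Θ'`, and can serve as the kernel of a
distribution. The right side makes Moyal's formula available. -/
lemma asDist_tfShift (γ Θ' : 𝓢(R2d d, ℂ)) (z : R2d d × R2d d) :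
    asDist (tfShift z.1 z.2 γ) Θ' = conj (stft γ (asDist (conjSchwartz Θ')) z) := by
  rw [stft_asDist, conj_schwartzInner, ← sesq_asDist, sesq, conjSchwartz_conjSchwartz]

lemma norm_asDist_tfShift (γ Θ' : 𝓢(R2d d, ℂ)) (z : R2d d × R2d d) :
    ‖asDist (tfShift z.1 z.2 γ) Θ'‖ = ‖stft (conjSchwartz γ) (asDist Θ') (z.1, -z.2)‖ := by
  rw [stft_asDist, ← conjSchwartz_tfShift, schwartzInner,
    SchwartzMap.toTemperedDistributionCLM_apply_apply volume]
  simp only [conjSchwartz_apply, Complex.conj_conj, smul_eq_mul]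

/-- The tensor product of tempered distributions. -/
lemma exists_isTensorConj (f g : 𝓢'(Rd d, ℂ)) : ∃ T : 𝓢'(R2d d, ℂ), IsTensorConj f g T := by
  obtain ⟨h, hh⟩ := exists_conjDist g
  set γ := gaussSchwartz (Fin d)
  set Γ := gaussSchwartz (Fin d ⊕ Fin d)
  have hΓ : IsSchwartzTensor Γ γ γ := gaussSchwartz_joinPt d
  obtain ⟨c₁, hc₁, h₁⟩ := exists_schwartzInner_tensor d
  have : (volume : Measure ((Rd d × Rd d) × (Rd d × Rd d))).IsAddHaarMeasure :=
    Measure.prod.instIsAddHaarMeasure _ _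
  obtain ⟨c₂, hc₂, h₂⟩ := exists_integral_comp_linearEquiv
    (volume : Measure ((Rd d × Rd d) × (Rd d × Rd d))) (volume : Measure (R2d d × R2d d))
    (phaseJoin d)
  have hN : schwartzInner γ γ ≠ 0 := schwartzInner_self_ne_zero gaussSchwartz_ne_zero
  obtain ⟨A₁, N₁, hA₁, hf⟩ := exists_norm_stft_le γ f
  obtain ⟨A₂, N₂, hA₂, hg⟩ := exists_norm_stft_le γ h
  -- The transform of the desired tensor product with Gaussian window should be the product of the
  -- two transforms. A multiple of the distribution is synthesised from this function of polynomial
  -- growth by the inversion formula.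
  set S : R2d d × R2d d → ℂ := fun z =>
    stft γ f ((phaseJoin d).symm z).1 * stft γ h ((phaseJoin d).symm z).2
  have hSc : Continuous S :=
    ((continuous_stft γ f).comp (continuous_fst.comp (phaseJoin d).symm.continuous)).mul
      ((continuous_stft γ h).comp (continuous_snd.comp (phaseJoin d).symm.continuous))
  have hSg : ∃ (C : ℝ) (N : ℕ), 0 ≤ C ∧ ∀ z, ‖S z‖ ≤ C * (1 + ‖z‖) ^ N := by
    set B := ‖((phaseJoin d).symm : (R2d d × R2d d) →L[ℝ] (Rd d × Rd d) × (Rd d × Rd d))‖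
    refine ⟨A₁ * (1 + B) ^ N₁ * (A₂ * (1 + B) ^ N₂), N₁ + N₂, by positivity, fun z => ?_⟩
    have hB : 1 + ‖(phaseJoin d).symm z‖ ≤ (1 + B) * (1 + ‖z‖) := by
      have h0 : 0 ≤ B := norm_nonneg _
      have h1 : ‖(phaseJoin d).symm z‖ ≤ B * ‖z‖ :=
        ((phaseJoin d).symm : (R2d d × R2d d) →L[ℝ] (Rd d × Rd d) × (Rd d × Rd d)).le_opNorm z
      nlinarith [norm_nonneg z]
    calc ‖S z‖ ≤ A₁ * (1 + ‖((phaseJoin d).symm z).1‖) ^ N₁ *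
          (A₂ * (1 + ‖((phaseJoin d).symm z).2‖) ^ N₂) := by
          rw [norm_mul]; gcongr
          · exact hf _
          · exact hg _
      _ ≤ A₁ * ((1 + B) * (1 + ‖z‖)) ^ N₁ * (A₂ * ((1 + B) * (1 + ‖z‖)) ^ N₂) := by
          gcongr
          · exact (add_le_add_right (norm_fst_le _) 1).trans hB
          · exact (add_le_add_right (norm_snd_le _) 1).trans hB
      _ = _ := by rw [mul_pow, mul_pow, pow_add]; ring
  obtain ⟨T, hT⟩ := exists_temperedDistribution_integral (μ := volume) hSc.aestronglyMeasurable hSg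
    (fun Θ z => asDist (tfShift z.1 z.2 Γ) Θ) (fun Θ Θ' z => map_add _ _ _)
    (fun c Θ z => map_smul _ _ _)
    (fun Θ => by
      simp only [asDist_tfShift]
      exact (RCLike.continuous_conj.comp (continuous_stft _ _)).aestronglyMeasurable)
    (fun N => by
      obtain ⟨q, hq, hb⟩ := exists_seminorm_stft_le N (conjSchwartz Γ)
      refine ⟨q, hq, fun Θ z => ?_⟩
      have := hb Θ (z.1, -z.2)
      rwa [← norm_asDist_tfShift, Prod.norm_mk, norm_neg, ← Prod.norm_def] at this)
  -- This is the normalisation of Moyal's formula for the two factors, corrected by the constants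
  -- relating the measures on the product and on the joint space.
  set κ : ℂ := (c₂ : ℂ)⁻¹ * conj c₁ * (schwartzInner γ γ * schwartzInner γ γ)
  have hκ : κ ≠ 0 := by
    refine mul_ne_zero (mul_ne_zero (inv_ne_zero (by exact_mod_cast hc₂.ne')) ?_)
      (mul_ne_zero hN hN)
    simpa using hc₁
  refine ⟨κ⁻¹ • T, fun φ ψ Θ hΘ => ?_⟩
  have hΘ' : IsSchwartzTensor Θ φ ψ := hΘ
  have hst : ∀ w, stft Γ (asDist (conjSchwartz Θ)) (phaseJoin d w) =
      c₁ * (stft γ (asDist (conjSchwartz φ)) w.1 * stft γ (asDist (conjSchwartz ψ)) w.2) := by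
    intro w
    rw [stft_asDist, stft_asDist, stft_asDist]
    exact h₁ hΘ'.conj (hΓ.tfShift _ _ _ _)
  have e : T Θ = κ * (f φ * conj (g (conjSchwartz ψ))) := by
    have hc₂' : (c₂ : ℂ) ≠ 0 := by exact_mod_cast hc₂.ne'
    rw [(hT Θ).2, ← hh, mul_assoc, mul_assoc, eq_inv_mul_iff_mul_eq₀ hc₂', ← h₂]
    simp only [asDist_tfShift, hst, S, ContinuousLinearEquiv.symm_apply_apply]
    have e1 := (integral_stft_mul_conj_stft f γ γ (conjSchwartz φ)).2
    have e2 := (integral_stft_mul_conj_stft h γ γ (conjSchwartz ψ)).2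
    rw [sesq, conjSchwartz_conjSchwartz] at e1 e2
    calc _ = ∫ w : (Rd d × Rd d) × (Rd d × Rd d), conj c₁ *
          ((stft γ f w.1 * conj (stft γ (asDist (conjSchwartz φ)) w.1)) *
            (stft γ h w.2 * conj (stft γ (asDist (conjSchwartz ψ)) w.2))) := by
          congr 1; ext w
          rw [map_mul, map_mul]; ring
      _ = _ := by
          rw [integral_const_mul, Measure.volume_eq_prod, integral_prod_mul
            (fun w => stft γ f w * conj (stft γ (asDist (conjSchwartz φ)) w))
            (fun w => stft γ h w * conj (stft γ (asDist (conjSchwartz ψ)) w)), e1, e2]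
          ring
  change κ⁻¹ * T Θ = _
  rw [e, inv_mul_cancel_left₀ hκ]

lemma IsTensorConj.sesq_eq {f g : 𝓢'(Rd d, ℂ)} {T : 𝓢'(R2d d, ℂ)} (hT : IsTensorConj f g T)
    (h : IsSchwartzTensor Θ φ ψ) : sesq T Θ = sesq f φ * conj (g ψ) := by
  rw [sesq, hT _ _ _ h.conj, conjSchwartz_conjSchwartz]; rfl

end Tensor

/-! ### The structure of totally Wigner-decomposable matrices -/

section WignerMatrix

variable {d : ℕ}

lemma applyMat_mul (B C : Matrix (Fin d) (Fin d) ℝ) (x : Rd d) :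
    applyMat (B * C) x = applyMat B (applyMat C x) := by
  simp [applyMat, Matrix.mulVec_mulVec]

lemma applyMat_one (x : Rd d) : applyMat 1 x = x := by simp [applyMat]

lemma applyMat_sub_left (B C : Matrix (Fin d) (Fin d) ℝ) (x : Rd d) :
    applyMat (B - C) x = applyMat B x - applyMat C x := by
  simp [applyMat, Matrix.sub_mulVec]

lemma inner_applyMat_transpose (B : Matrix (Fin d) (Fin d) ℝ) (x y : Rd d) :
    ⟪applyMat Bᵀ x, y⟫ = ⟪x, applyMat B y⟫ := by
  simp only [applyMat, EuclideanSpace.inner_eq_star_dotProduct, star_trivial]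
  rw [Matrix.mulVec_transpose, dotProduct_comm, ← Matrix.dotProduct_mulVec, dotProduct_comm]

/-- The continuous linear map `x ↦ B x`. -/
noncomputable def applyMatCLM (B : Matrix (Fin d) (Fin d) ℝ) : Rd d →L[ℝ] Rd d :=
  LinearMap.toContinuousLinearMap
    { toFun := applyMat B
      map_add' := fun x y => by simp [applyMat, Matrix.mulVec_add]
      map_smul' := fun c x => by simp [applyMat, Matrix.mulVec_smul] }

@[simp]
lemma applyMatCLM_apply (B : Matrix (Fin d) (Fin d) ℝ) (x : Rd d) :
    applyMatCLM B x = applyMat B x := rfl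

/-- The linear automorphism `x ↦ B x` for an invertible matrix `B`. -/
noncomputable def applyMatEquiv (B : Matrix (Fin d) (Fin d) ℝ) (hB : IsUnit B) :
    Rd d ≃L[ℝ] Rd d :=
  ContinuousLinearEquiv.equivOfInverse (applyMatCLM B) (applyMatCLM B⁻¹)
    (fun x => by
      rw [applyMatCLM_apply, applyMatCLM_apply, ← applyMat_mul,
        Matrix.nonsing_inv_mul _ ((Matrix.isUnit_iff_isUnit_det _).1 hB), applyMat_one])
    (fun x => by
      rw [applyMatCLM_apply, applyMatCLM_apply, ← applyMat_mul,
        Matrix.mul_nonsing_inv _ ((Matrix.isUnit_iff_isUnit_det _).1 hB), applyMat_one])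

lemma applyMatEquiv_apply (B : Matrix (Fin d) (Fin d) ℝ) (hB : IsUnit B) (x : Rd d) :
    applyMatEquiv B hB x = applyMat B x := rfl

lemma applyMatEquiv_symm_apply (B : Matrix (Fin d) (Fin d) ℝ) (hB : IsUnit B) (x : Rd d) :
    (applyMatEquiv B hB).symm x = applyMat B⁻¹ x := rfl

/-- The action of a totally Wigner-decomposable matrix with right-regular factor, in terms of
linear maps of `ℝᵈ`: here `P = L₁₁ - L₁₂ L₂₂⁻¹ L₂₁`, `Q = L₁₂⁻ᵀ`, `D = L₂₂ L₁₂⁻¹`, `R = L₁₁`, and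
`Dt` is the transpose of `D`. -/
structure WignerData (A : Mat4 d) (P Q D : Rd d ≃L[ℝ] Rd d) (R Dt : Rd d →L[ℝ] Rd d) : Prop where
  adj : ∀ u t, ⟪Dt u, t⟫ = ⟪u, D t⟫
  action : ∀ a₁ a₂ α₁ α₂, ∃ b₁ b₂ β₁ β₂,
    phaseFst A (joinPt a₁ a₂) (joinPt α₁ α₂) = joinPt b₁ β₂ ∧
    phaseSnd A (joinPt a₁ a₂) (joinPt α₁ α₂) = joinPt β₁ (-b₂) ∧
    P b₁ = a₁ - D.symm a₂ ∧ Q β₂ = α₁ + Dt α₂ ∧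
    (∀ ξ, ⟪b₂, ξ⟫ = ⟪Q ξ, a₁ - R b₁⟫) ∧ ∀ x, ⟪β₁, x⟫ = ⟪Q β₂, R x⟫ - ⟪α₂, D (P x)⟫

lemma matFT2_mul_matD (L : GL (Fin d ⊕ Fin d) ℝ) : matFT2 d * matD L =
    Matrix.fromBlocks
      (Matrix.fromBlocks (L⁻¹).val.toBlocks₁₁ (L⁻¹).val.toBlocks₁₂ 0 0)
      (Matrix.fromBlocks 0 0 L.val.toBlocks₁₂ᵀ L.val.toBlocks₂₂ᵀ)
      (Matrix.fromBlocks 0 0 (-(L⁻¹).val.toBlocks₂₁) (-(L⁻¹).val.toBlocks₂₂))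
      (Matrix.fromBlocks L.val.toBlocks₁₁ᵀ L.val.toBlocks₂₁ᵀ 0 0) := by
  have h1 : (L⁻¹).val = Matrix.fromBlocks (L⁻¹).val.toBlocks₁₁ (L⁻¹).val.toBlocks₁₂
    (L⁻¹).val.toBlocks₂₁ (L⁻¹).val.toBlocks₂₂ := (Matrix.fromBlocks_toBlocks _).symm
  have h2 : L.valᵀ = Matrix.fromBlocks L.val.toBlocks₁₁ᵀ L.val.toBlocks₂₁ᵀ
    L.val.toBlocks₁₂ᵀ L.val.toBlocks₂₂ᵀ := by
    rw [← Matrix.fromBlocks_transpose, Matrix.fromBlocks_toBlocks]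
  rw [matFT2, matD, h2]
  conv_lhs => rw [h1]
  simp [Matrix.fromBlocks_multiply]

lemma toLp_mulVec_joinPt (B₁₁ B₁₂ B₂₁ B₂₂ : Matrix (Fin d) (Fin d) ℝ) (x y : Rd d) :
    (WithLp.toLp 2 (Matrix.fromBlocks B₁₁ B₁₂ B₂₁ B₂₂ *ᵥ (joinPt x y).ofLp) : R2d d) =
      joinPt (applyMat B₁₁ x + applyMat B₁₂ y) (applyMat B₂₁ x + applyMat B₂₂ y) := by
  rw [Matrix.fromBlocks_mulVec]
  ext i
  rcases i with i | i <;> rfl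

/-- Put `(b₁, b₂) = L⁻¹(a₁, a₂)`. Eliminating `b₂` from `a = L b` through the invertible `L₂₂` gives
`P b₁ = a₁ - L₁₂L₂₂⁻¹a₂`. The relations for `β₁` and `β₂` come from the rows of `Lᵀ`. The last four
clauses identify the matrices in the hypotheses on the weights with `P`, `Q`, `D⁻¹` and `Dᵀ`. -/
lemma exists_wignerData {A : Mat4 d} {L : GL (Fin d ⊕ Fin d) ℝ}
    (hA : IsTotallyWignerDecomposable A L) (hL : IsBlockRightRegular L) :
    ∃ (P Q D : Rd d ≃L[ℝ] Rd d) (R Dt : Rd d →L[ℝ] Rd d), WignerData A P Q D R Dt ∧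
      (∀ x, applyMat ((blk33 A)ᵀ - (blk23 A)ᵀ * ((blk24 A)ᵀ)⁻¹ * (blk34 A)ᵀ) x = P x) ∧
      (∀ ξ, applyMat ((blk23 A)⁻¹) ξ = Q ξ) ∧
      (∀ x, applyMat ((blk23 A)ᵀ * ((blk24 A)ᵀ)⁻¹) x = D.symm x) ∧
      (∀ ξ, applyMat ((blk23 A)⁻¹ * blk24 A) ξ = Dt ξ) := by
  obtain ⟨-, hA⟩ := hA
  rw [matFT2_mul_matD] at hA
  obtain ⟨h12, h22⟩ := hL
  set L₁₁ := L.val.toBlocks₁₁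
  set L₁₂ := L.val.toBlocks₁₂
  set L₂₁ := L.val.toBlocks₂₁
  set L₂₂ := L.val.toBlocks₂₂
  have hLb : L.val = Matrix.fromBlocks L₁₁ L₁₂ L₂₁ L₂₂ := (Matrix.fromBlocks_toBlocks _).symm
  have e23 : blk23 A = L₁₂ᵀ := by simp [hA, blk23]
  have e24 : blk24 A = L₂₂ᵀ := by simp [hA, blk24]
  have e33 : blk33 A = L₁₁ᵀ := by simp [hA, blk33]
  have e34 : blk34 A = L₂₁ᵀ := by simp [hA, blk34]
  have d12 := (Matrix.isUnit_iff_isUnit_det _).1 h12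
  have d22 := (Matrix.isUnit_iff_isUnit_det _).1 h22
  -- This is the Schur complement of `L₂₂` in the invertible matrix `L`.
  have hP : IsUnit (L₁₁ - L₁₂ * L₂₂⁻¹ * L₂₁) := by
    let _ := L₂₂.invertibleOfIsUnitDet d22
    have := L.isUnit
    rw [hLb, Matrix.isUnit_fromBlocks_iff_of_invertible₂₂, Matrix.invOf_eq_nonsing_inv] at this
    exact this
  have hQ : IsUnit (L₁₂ᵀ)⁻¹ := by
    rw [Matrix.isUnit_nonsing_inv_iff]
    exact (Matrix.isUnit_transpose _).2 h12
  have hD : IsUnit (L₂₂ * L₁₂⁻¹) := h22.mul (Matrix.isUnit_nonsing_inv_iff.2 h12)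
  have hQi : ∀ ξ y, ⟪applyMat (L₁₂ᵀ)⁻¹ ξ, applyMat L₁₂ y⟫ = ⟪ξ, y⟫ := fun ξ y => by
    rw [← inner_applyMat_transpose, ← applyMat_mul, Matrix.mul_nonsing_inv, applyMat_one]
    rwa [Matrix.det_transpose]
  have hDs : ∀ x, (applyMatEquiv _ hD).symm x = applyMat L₁₂ (applyMat L₂₂⁻¹ x) := fun x => by
    rw [applyMatEquiv_symm_apply, Matrix.mul_inv_rev, Matrix.nonsing_inv_nonsing_inv _ d12,
      applyMat_mul]
  refine ⟨applyMatEquiv _ hP, applyMatEquiv _ hQ, applyMatEquiv _ hD, applyMatCLM L₁₁,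
    applyMatCLM ((L₁₂ᵀ)⁻¹ * L₂₂ᵀ), ⟨fun u t => ?_, fun a₁ a₂ α₁ α₂ => ?_⟩, fun x => ?_, fun ξ => ?_,
    fun x => ?_, fun ξ => ?_⟩
  · rw [applyMatEquiv_apply, applyMatCLM_apply, ← Matrix.transpose_nonsing_inv,
      ← Matrix.transpose_mul, inner_applyMat_transpose]
  · obtain ⟨b₁, b₂, hb⟩ := exists_eq_joinPt
      (WithLp.toLp 2 ((L⁻¹).val *ᵥ (joinPt a₁ a₂).ofLp) : R2d d)
    have hLb' : (WithLp.toLp 2 (L.val *ᵥ (joinPt b₁ b₂).ofLp) : R2d d) = joinPt a₁ a₂ := by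
      rw [← hb, Matrix.mulVec_mulVec, ← Units.val_mul, mul_inv_cancel, Units.val_one,
        Matrix.one_mulVec]
    rw [hLb, toLp_mulVec_joinPt] at hLb'
    have hinj := Prod.ext_iff.1 ((joinEquiv d).injective hLb')
    have ha₁ : applyMat L₁₁ b₁ + applyMat L₁₂ b₂ = a₁ := hinj.1
    have ha₂ : applyMat L₂₁ b₁ + applyMat L₂₂ b₂ = a₂ := hinj.2
    rw [← Matrix.fromBlocks_toBlocks (L⁻¹).val, toLp_mulVec_joinPt] at hb
    have hinj' := Prod.ext_iff.1 ((joinEquiv d).injective hb)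
    have hb₁ : applyMat (L⁻¹).val.toBlocks₁₁ a₁ + applyMat (L⁻¹).val.toBlocks₁₂ a₂ = b₁ := hinj'.1
    have hb₂ : applyMat (L⁻¹).val.toBlocks₂₁ a₁ + applyMat (L⁻¹).val.toBlocks₂₂ a₂ = b₂ := hinj'.2
    have hfst : phaseFst A (joinPt a₁ a₂) (joinPt α₁ α₂) =
        joinPt b₁ (applyMat L₁₂ᵀ α₁ + applyMat L₂₂ᵀ α₂) := by
      rw [phaseFst, hA, Matrix.toBlocks_fromBlocks₁₁, Matrix.toBlocks_fromBlocks₁₂, WithLp.toLp_add,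
        toLp_mulVec_joinPt, toLp_mulVec_joinPt, hb₁]
      refine ((joinEquiv d).map_add _ _).symm.trans (congrArg (joinEquiv d) ?_)
      simp [applyMat]
    have hsnd : phaseSnd A (joinPt a₁ a₂) (joinPt α₁ α₂) =
        joinPt (applyMat L₁₁ᵀ α₁ + applyMat L₂₁ᵀ α₂) (-b₂) := by
      rw [phaseSnd, hA, Matrix.toBlocks_fromBlocks₂₁, Matrix.toBlocks_fromBlocks₂₂, WithLp.toLp_add,
        toLp_mulVec_joinPt, toLp_mulVec_joinPt, ← hb₂]
      refine ((joinEquiv d).map_add _ _).symm.trans (congrArg (joinEquiv d) ?_)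
      simp [applyMat, Matrix.neg_mulVec]
      abel
    have hQβ : applyMat (L₁₂ᵀ)⁻¹ (applyMat L₁₂ᵀ α₁ + applyMat L₂₂ᵀ α₂) =
        α₁ + applyMat ((L₁₂ᵀ)⁻¹ * L₂₂ᵀ) α₂ := by
      rw [← applyMatCLM_apply, map_add, applyMatCLM_apply, applyMatCLM_apply, ← applyMat_mul,
        Matrix.nonsing_inv_mul _ (by rwa [Matrix.det_transpose]), applyMat_one, applyMat_mul]
    refine ⟨b₁, b₂, _, _, hfst, hsnd, ?_, ?_, fun ξ => ?_, fun x => ?_⟩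
    · rw [hDs, ← ha₁, ← ha₂, applyMatEquiv_apply, applyMat_sub_left, applyMat_mul, applyMat_mul]
      simp only [← applyMatCLM_apply, map_add]
      simp only [applyMatCLM_apply]
      rw [← applyMat_mul L₂₂⁻¹ L₂₂, Matrix.nonsing_inv_mul _ d22, applyMat_one]
      abel
    · exact hQβ
    · rw [applyMatEquiv_apply, applyMatCLM_apply, ← ha₁, add_sub_cancel_left, hQi, real_inner_comm]
    · simp only [applyMatEquiv_apply, applyMatCLM_apply]
      rw [hQβ, inner_add_left, inner_add_left, inner_applyMat_transpose, inner_applyMat_transpose,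
        ← Matrix.transpose_nonsing_inv, ← Matrix.transpose_mul, inner_applyMat_transpose,
        ← applyMat_mul, ← applyMat_mul]
      -- The identity `D P = D L₁₁ - L₂₁` is also the reason why the window is seen at `D(t - Px)`.
      have : L₂₂ * L₁₂⁻¹ * (L₁₁ - L₁₂ * L₂₂⁻¹ * L₂₁) = L₂₂ * L₁₂⁻¹ * L₁₁ - L₂₁ := by
        rw [Matrix.mul_sub, Matrix.mul_assoc L₁₂, ← Matrix.mul_assoc (L₂₂ * L₁₂⁻¹) L₁₂,
          Matrix.mul_assoc L₂₂ L₁₂⁻¹ L₁₂, Matrix.nonsing_inv_mul _ d12, Matrix.mul_one,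
          ← Matrix.mul_assoc, Matrix.mul_nonsing_inv _ d22, Matrix.one_mul]
      rw [this, applyMat_sub_left, inner_sub_right]
      ring
  · rw [e33, e23, e24, e34, applyMatEquiv_apply]
    simp only [Matrix.transpose_transpose]
  · rw [e23, applyMatEquiv_apply]
  · rw [e23, e24, hDs, Matrix.transpose_transpose, Matrix.transpose_transpose, applyMat_mul]
  · rw [e23, e24, applyMatCLM_apply]

end WignerMatrix

/-! ### The metaplectic operator on Gaussians -/

section GaussianPair

open scoped ComplexConjugate

variable {d : ℕ}

/-- The number `e^{ir}`. -/
noncomputable def expI (r : ℝ) : ℂ := Complex.exp ((r : ℂ) * Complex.I)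

lemma expI_add (r s : ℝ) : expI (r + s) = expI r * expI s := by
  rw [expI, expI, expI, ← Complex.exp_add]; congr 1; push_cast; ring

lemma norm_expI (r : ℝ) : ‖expI r‖ = 1 := Complex.norm_exp_ofReal_mul_I r

lemma expI_mul_conj (r : ℝ) : expI r * conj (expI r) = 1 := by
  rw [Complex.mul_conj, Complex.normSq_eq_norm_sq, norm_expI]; simp

lemma conj_expI (r : ℝ) : conj (expI r) = expI (-r) := by
  rw [expI, expI, ← Complex.exp_conj, map_mul, Complex.conj_ofReal, Complex.conj_I]
  congr 1; push_cast; ring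

lemma modChar_eq_expI (ξ t : Rd d) : modChar ξ t = expI (2 * Real.pi * ⟪ξ, t⟫) := rfl

lemma rhoPhase_eq_expI (x ξ : Rd d) : rhoPhase x ξ = expI (-(Real.pi * ⟪x, ξ⟫)) := rfl

lemma continuous_expI : Continuous expI := by
  unfold expI; fun_prop

/-- The chirp `e^{2πi Qξ·Rx}`. -/
noncomputable def chirp (Q : Rd d ≃L[ℝ] Rd d) (R : Rd d →L[ℝ] Rd d) (z : Rd d × Rd d) : ℂ :=
  expI (2 * Real.pi * ⟪Q z.2, R z.1⟫)

lemma continuous_chirp (Q : Rd d ≃L[ℝ] Rd d) (R : Rd d →L[ℝ] Rd d) : Continuous (chirp Q R) := by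
  unfold chirp
  exact continuous_expI.comp (by fun_prop)

/-- The short-time Fourier transform of the Gaussian with respect to itself. -/
noncomputable def gaussStft (d : ℕ) (z : Rd d × Rd d) : ℂ :=
  stft (gaussSchwartz (Fin d)) (asDist (gaussSchwartz (Fin d))) z

/-- Up to a quadratic phase, the transform of the Gaussian with itself is a Gaussian with half the
exponent, whence the dilation by `1/√2`. The chirp and this phase have temperate growth, so the
product is Schwartz. -/
lemma exists_chirp_gauss (P Q : Rd d ≃L[ℝ] Rd d) (R : Rd d →L[ℝ] Rd d) :
    ∃ (Φ : 𝓢(R2d d, ℂ)) (c : ℂ), c ≠ 0 ∧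
      ∀ x ξ, Φ (joinPt x ξ) = c * chirp Q R (x, ξ) * gaussStft d (P x, Q ξ) := by
  obtain ⟨c, hc, h⟩ := exists_stft_gauss (Fin d)
  let p₁ : R2d d →L[ℝ] Rd d :=
    (ContinuousLinearMap.fst ℝ (Rd d) (Rd d)).comp (joinEquiv d).symm.toContinuousLinearMap
  let p₂ : R2d d →L[ℝ] Rd d :=
    (ContinuousLinearMap.snd ℝ (Rd d) (Rd d)).comp (joinEquiv d).symm.toContinuousLinearMap
  have hp₁ : ∀ x ξ : Rd d, p₁ (joinPt x ξ) = x := fun x ξ =>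
    congrArg Prod.fst ((joinEquiv d).symm_apply_apply (x, ξ))
  have hp₂ : ∀ x ξ : Rd d, p₂ (joinPt x ξ) = ξ := fun x ξ =>
    congrArg Prod.snd ((joinEquiv d).symm_apply_apply (x, ξ))
  let θ : R2d d → ℝ := fun u => 2 * Real.pi * ⟪Q (p₂ u), R (p₁ u)⟫ - Real.pi * ⟪P (p₁ u), Q (p₂ u)⟫
  have hin : ∀ S T : R2d d →L[ℝ] Rd d, Function.HasTemperateGrowth fun u => ⟪S u, T u⟫ :=
    fun S T => (innerSL ℝ).bilinear_hasTemperateGrowth S.hasTemperateGrowth T.hasTemperateGrowth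
  have hθ : Function.HasTemperateGrowth θ :=
    ((Function.HasTemperateGrowth.const (2 * Real.pi)).mul
      (hin (Q.toContinuousLinearMap.comp p₂) (R.comp p₁))).sub
      ((Function.HasTemperateGrowth.const Real.pi).mul
        (hin (P.toContinuousLinearMap.comp p₁) (Q.toContinuousLinearMap.comp p₂)))
  have hχ : Function.HasTemperateGrowth fun u => expI (θ u) := hasTemperateGrowth_exp_mul_I.comp hθ
  have hs : (√2)⁻¹ ≠ 0 := inv_ne_zero (by positivity)
  let e : R2d d ≃L[ℝ] R2d d :=
    (((joinEquiv d).symm.trans (P.prodCongr Q)).trans (joinEquiv d)).trans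
      (LinearEquiv.smulOfNeZero ℝ (R2d d) (√2)⁻¹ hs).toContinuousLinearEquiv
  have he : ∀ x ξ : Rd d, e (joinPt x ξ) = (√2)⁻¹ • joinPt (P x) (Q ξ) := fun x ξ => by
    change (√2)⁻¹ • (joinEquiv d) ((P.prodCongr Q) ((joinEquiv d).symm (joinEquiv d (x, ξ)))) = _
    rw [(joinEquiv d).symm_apply_apply]; rfl
  refine ⟨SchwartzMap.smulLeftCLM ℂ (fun u => expI (θ u))
    (SchwartzMap.compCLMOfContinuousLinearEquiv ℂ e (gaussSchwartz (Fin d ⊕ Fin d))), c⁻¹,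
    inv_ne_zero hc, fun x ξ => ?_⟩
  have hn : ‖e (joinPt x ξ)‖ ^ 2 = 1 / 2 * (‖P x‖ ^ 2 + ‖Q ξ‖ ^ 2) := by
    rw [he, norm_smul, mul_pow, norm_sq_joinPt, norm_inv, inv_pow, Real.norm_of_nonneg (by positivity),
      Real.sq_sqrt (by norm_num)]
    ring
  rw [SchwartzMap.smulLeftCLM_apply_apply hχ, gaussStft, h, smul_eq_mul,
    SchwartzMap.compCLMOfContinuousLinearEquiv_apply, Function.comp_apply, gaussSchwartz_apply, hn]
  have h1 : expI (θ (joinPt x ξ)) =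
      chirp Q R (x, ξ) * Complex.exp (((-(Real.pi * ⟪P x, Q ξ⟫) : ℝ) : ℂ) * Complex.I) := by
    simp only [θ, hp₁, hp₂, sub_eq_add_neg]
    rw [expI_add]; rfl
  rw [h1, show -Real.pi * (1 / 2 * (‖P x‖ ^ 2 + ‖Q ξ‖ ^ 2)) =
    -(Real.pi / 2) * (‖P x‖ ^ 2 + ‖Q ξ‖ ^ 2) by ring]
  field_simp

lemma tfShift_tfShift (x ξ y η : Rd d) (φ : 𝓢(Rd d, ℂ)) :
    tfShift x ξ (tfShift y η φ) = modChar η (-x) • tfShift (x + y) (ξ + η) φ := by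
  ext t
  change _ = modChar η (-x) * tfShift (x + y) (ξ + η) φ t
  rw [tfShift_apply, tfShift_apply, tfShift_apply, sub_eq_add_neg t x, modChar_add_right,
    modChar_add, ← sub_eq_add_neg, sub_sub]
  ring

lemma tfShift_smul (x ξ : Rd d) (c : ℂ) (φ : 𝓢(Rd d, ℂ)) :
    tfShift x ξ (c • φ) = c • tfShift x ξ φ := by
  ext t
  change tfShift x ξ (c • φ) t = c * tfShift x ξ φ t
  rw [tfShift_apply, tfShift_apply, smul_apply, smul_eq_mul]
  ring

lemma schwartzInner_smul_left (c : ℂ) (ψ γ : 𝓢(Rd d, ℂ)) :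
    schwartzInner (c • ψ) γ = c * schwartzInner ψ γ := by
  rw [← conj_schwartzInner, schwartzInner_smul_right, map_mul, Complex.conj_conj,
    conj_schwartzInner]

variable {A : Mat4 d} {P Q D : Rd d ≃L[ℝ] Rd d} {R Dt : Rd d →L[ℝ] Rd d}

/-- Covariance of the functions `chirp · (V_γ φ) ∘ (P, Q)`. -/
lemma WignerData.rhoSchwartz_apply (H : WignerData A P Q D R Dt) {Φ : 𝓢(R2d d, ℂ)} {c : ℂ}
    (hΦ : ∀ x ξ, Φ (joinPt x ξ) = c * chirp Q R (x, ξ) * gaussStft d (P x, Q ξ))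
    (a₁ a₂ α₁ α₂ x ξ : Rd d) :
    rhoSchwartz (phaseFst A (joinPt a₁ a₂) (joinPt α₁ α₂)) (phaseSnd A (joinPt a₁ a₂) (joinPt α₁ α₂))
      Φ (joinPt x ξ) = c * chirp Q R (x, ξ) *
        stft (rhoSchwartz (D.symm a₂) (-Dt α₂) (gaussSchwartz (Fin d)))
          (asDist (rhoSchwartz a₁ α₁ (gaussSchwartz (Fin d)))) (P x, Q ξ) := by
  obtain ⟨b₁, b₂, β₁, β₂, hf, hs, hP, hQ, hb, hβ⟩ := H.action a₁ a₂ α₁ α₂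
  have hr : stft (rhoSchwartz (D.symm a₂) (-Dt α₂) (gaussSchwartz (Fin d)))
      (asDist (rhoSchwartz a₁ α₁ (gaussSchwartz (Fin d)))) (P x, Q ξ) =
      rhoPhase a₁ α₁ * conj (rhoPhase (D.symm a₂) (-Dt α₂)) * conj (modChar (-Dt α₂) (-P x)) *
        modChar (α₁ - (Q ξ + -Dt α₂)) a₁ * gaussStft d (P (x - b₁), Q (ξ - β₂)) := by
    rw [stft_asDist, rhoSchwartz, rhoSchwartz, schwartzInner_smul_left, tfShift_smul,
      schwartzInner_smul_right, tfShift_tfShift, schwartzInner_smul_right,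
      schwartzInner_tfShift_tfShift, gaussStft, stft_asDist, map_sub, map_sub, hP, hQ]
    rw [show P x - (a₁ - D.symm a₂) = P x + D.symm a₂ - a₁ by abel,
      show Q ξ - (α₁ + Dt α₂) = Q ξ + -Dt α₂ - α₁ by abel]
    ring
  have hl : rhoSchwartz (phaseFst A (joinPt a₁ a₂) (joinPt α₁ α₂))
      (phaseSnd A (joinPt a₁ a₂) (joinPt α₁ α₂)) Φ (joinPt x ξ) =
      rhoPhase b₁ β₁ * rhoPhase β₂ (-b₂) * (modChar β₁ x * modChar (-b₂) ξ *
        (c * chirp Q R (x - b₁, ξ - β₂) * gaussStft d (P (x - b₁), Q (ξ - β₂)))) := by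
    rw [hf, hs]
    change rhoPhase _ _ * tfShift _ _ Φ (joinPt x ξ) = _
    rw [rhoPhase_joinPt, tfShift_apply, modChar_joinPt, joinPt_sub, hΦ]
  rw [hl, hr]
  -- Both sides have modulus one, so the claim is an identity between real exponents. The relations
  -- of `H.action` and the adjointness of `Dt` and `D` turn all inner products into ones between
  -- `a₁, a₂, α₁, α₂, x, ξ` and `b₁`.
  have key : rhoPhase b₁ β₁ * rhoPhase β₂ (-b₂) * (modChar β₁ x * modChar (-b₂) ξ) *
      chirp Q R (x - b₁, ξ - β₂) = chirp Q R (x, ξ) * (rhoPhase a₁ α₁ *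
        conj (rhoPhase (D.symm a₂) (-Dt α₂)) * conj (modChar (-Dt α₂) (-P x)) *
        modChar (α₁ - (Q ξ + -Dt α₂)) a₁) := by
    simp only [chirp, modChar_eq_expI, rhoPhase_eq_expI, conj_expI, ← expI_add]
    congr 1
    have e1 : ⟪b₁, β₁⟫ = ⟪α₁, R b₁⟫ + ⟪Dt α₂, R b₁⟫ - (⟪Dt α₂, a₁⟫ - ⟪Dt α₂, D.symm a₂⟫) := by
      rw [real_inner_comm, hβ, ← H.adj, hP, hQ, inner_add_left, inner_sub_right]
    have e2 : ⟪β₂, b₂⟫ = ⟪α₁, a₁⟫ + ⟪Dt α₂, a₁⟫ - (⟪α₁, R b₁⟫ + ⟪Dt α₂, R b₁⟫) := by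
      rw [real_inner_comm, hb, hQ, inner_sub_right, inner_add_left, inner_add_left]
    have e3 : ⟪β₁, x⟫ = ⟪α₁, R x⟫ + ⟪Dt α₂, R x⟫ - ⟪Dt α₂, P x⟫ := by
      rw [hβ, ← H.adj, hQ, inner_add_left]
    have e4 : ⟪b₂, ξ⟫ = ⟪Q ξ, a₁⟫ - ⟪Q ξ, R b₁⟫ := by rw [hb, inner_sub_right]
    have e5 : ⟪Q (ξ - β₂), R (x - b₁)⟫ = ⟪Q ξ, R x⟫ - ⟪Q ξ, R b₁⟫ -
        (⟪α₁, R x⟫ + ⟪Dt α₂, R x⟫ - (⟪α₁, R b₁⟫ + ⟪Dt α₂, R b₁⟫)) := by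
      rw [map_sub, map_sub, hQ, inner_sub_left, inner_sub_right, inner_sub_right, inner_add_left,
        inner_add_left]
    simp only [inner_neg_left, inner_neg_right, inner_sub_left, inner_add_left, neg_neg]
    rw [e1, e2, e3, e4, e5, real_inner_comm α₁ a₁, real_inner_comm (Dt α₂) (D.symm a₂)]
    ring
  linear_combination c * gaussStft d (P (x - b₁), Q (ξ - β₂)) * key

/-- The function `F` has the same inner products with short-time Fourier transforms of Schwartz
functions as `V_g f` would have by Moyal's identity. -/
def IsWeakStft (f g : 𝓢'(Rd d, ℂ)) (F : Rd d × Rd d → ℂ) : Prop :=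
  ∀ φ γ : 𝓢(Rd d, ℂ), ∫ z, F z * conj (stft γ (asDist φ) z) = sesq f φ * conj (sesq g γ)

lemma isWeakStft_stft (f : 𝓢'(Rd d, ℂ)) (g : 𝓢(Rd d, ℂ)) :
    IsWeakStft f (asDist g) (stft g f) := fun φ γ => by
  rw [(integral_stft_mul_conj_stft f g γ φ).2, sesq_asDist, conj_schwartzInner]

lemma exists_integral_prodCongr (P Q : Rd d ≃L[ℝ] Rd d) : ∃ c : ℝ, 0 < c ∧
    ∀ F : Rd d × Rd d → ℂ, ∫ z : Rd d × Rd d, F (P z.1, Q z.2) = c * ∫ z, F z :=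
  exists_integral_comp_linearEquiv volume volume (P.prodCongr Q)

/-- The chirp cancels against its conjugate in the covariance formula. Substituting `(P, Q)` then
leaves exactly the pairing that `IsWeakStft` evaluates. -/
lemma WignerData.exists_integral_eq (H : WignerData A P Q D R Dt) {Φ : 𝓢(R2d d, ℂ)} {c : ℂ}
    (hc : c ≠ 0) (hΦ : ∀ x ξ, Φ (joinPt x ξ) = c * chirp Q R (x, ξ) * gaussStft d (P x, Q ξ)) :
    ∃ κ : ℂ, κ ≠ 0 ∧ ∀ {f g : 𝓢'(Rd d, ℂ)} {F : Rd d × Rd d → ℂ}, IsWeakStft f g F →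
      ∀ a₁ a₂ α₁ α₂, ∫ z : Rd d × Rd d, chirp Q R z * F (P z.1, Q z.2) *
        conj (rhoSchwartz (phaseFst A (joinPt a₁ a₂) (joinPt α₁ α₂))
          (phaseSnd A (joinPt a₁ a₂) (joinPt α₁ α₂)) Φ (joinPt z.1 z.2)) =
        κ * (sesq f (rhoSchwartz a₁ α₁ (gaussSchwartz (Fin d))) *
          conj (sesq g (rhoSchwartz (D.symm a₂) (-Dt α₂) (gaussSchwartz (Fin d))))) := by
  obtain ⟨k, hk, h⟩ := exists_integral_prodCongr P Q
  refine ⟨conj c * k, mul_ne_zero (by simpa using hc) (by exact_mod_cast hk.ne'),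
    fun {f g F} hF a₁ a₂ α₁ α₂ => ?_⟩
  rw [← hF, mul_assoc, ← h, ← integral_const_mul]
  congr 1; ext ⟨x, ξ⟩
  have hχ : chirp Q R (x, ξ) * conj (chirp Q R (x, ξ)) = 1 := expI_mul_conj _
  rw [H.rhoSchwartz_apply hΦ, map_mul, map_mul]
  linear_combination (conj c * F (P x, Q ξ) *
    conj (stft (rhoSchwartz (D.symm a₂) (-Dt α₂) (gaussSchwartz (Fin d)))
      (asDist (rhoSchwartz a₁ α₁ (gaussSchwartz (Fin d)))) (P x, Q ξ))) * hχ

/-- The Gaussian `g ∘ D⁻¹`. -/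
noncomputable def gaussComp (D : Rd d ≃L[ℝ] Rd d) : 𝓢(Rd d, ℂ) :=
  SchwartzMap.compCLMOfContinuousLinearEquiv ℂ D.symm (gaussSchwartz (Fin d))

lemma gaussComp_apply (D : Rd d ≃L[ℝ] Rd d) (t : Rd d) :
    gaussComp D t = gaussSchwartz (Fin d) (D.symm t) := rfl

lemma exists_gauss_tensor (D : Rd d ≃L[ℝ] Rd d) :
    ∃ Ψ : 𝓢(R2d d, ℂ), IsSchwartzTensor Ψ (gaussSchwartz (Fin d)) (gaussComp D) := by
  let e : R2d d ≃L[ℝ] R2d d :=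
    ((joinEquiv d).symm.trans ((ContinuousLinearEquiv.refl ℝ (Rd d)).prodCongr D.symm)).trans
      (joinEquiv d)
  refine ⟨SchwartzMap.compCLMOfContinuousLinearEquiv ℂ e (gaussSchwartz (Fin d ⊕ Fin d)),
    fun x y => ?_⟩
  have he : e (joinPt x y) = joinPt x (D.symm y) := by
    change (joinEquiv d) (((ContinuousLinearEquiv.refl ℝ (Rd d)).prodCongr D.symm)
      ((joinEquiv d).symm (joinEquiv d (x, y)))) = _
    rw [(joinEquiv d).symm_apply_apply]; rfl
  rw [SchwartzMap.compCLMOfContinuousLinearEquiv_apply, Function.comp_apply, he,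
    gaussSchwartz_joinPt]; rfl

/-- Composition with `D` turns the shift `(a, α)` into `(D⁻¹a, Dᵀα)`, and conjugation reverses the
frequency; the Gaussian itself is real. This converts the conjugated second tensor factor into a
window. -/
lemma WignerData.rhoSchwartz_gaussComp (H : WignerData A P Q D R Dt) (a α t : Rd d) :
    rhoSchwartz a α (gaussComp D) (D t) =
      conj (rhoSchwartz (D.symm a) (-Dt α) (gaussSchwartz (Fin d)) t) := by
  change rhoPhase _ _ * tfShift _ _ _ _ = conj (rhoPhase _ _ * tfShift _ _ _ _)
  rw [tfShift_apply, tfShift_apply, gaussComp_apply, map_sub, D.symm_apply_apply, map_mul, map_mul,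
    conj_gaussSchwartz, conj_modChar, neg_neg, modChar_eq_expI, modChar_eq_expI, ← H.adj,
    rhoPhase_eq_expI, rhoPhase_eq_expI, conj_expI, inner_neg_right, real_inner_comm (Dt α), H.adj α (D.symm a),
    D.apply_symm_apply, real_inner_comm a α]
  simp only [mul_neg, neg_neg]

lemma WignerData.exists_schwartzInner_gaussComp (H : WignerData A P Q D R Dt) :
    ∃ k : ℂ, k ≠ 0 ∧ ∀ a α, conj (schwartzInner (gaussSchwartz (Fin d))
      (rhoSchwartz (D.symm a) (-Dt α) (gaussSchwartz (Fin d)))) =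
      k * schwartzInner (gaussComp D) (rhoSchwartz a α (gaussComp D)) := by
  obtain ⟨k, hk, h⟩ := exists_integral_comp_linearEquiv volume volume D
  refine ⟨k, by exact_mod_cast hk.ne', fun a α => ?_⟩
  rw [conj_schwartzInner, schwartzInner, schwartzInner, ← h]
  congr 1; ext t
  rw [H.rhoSchwartz_gaussComp, Complex.conj_conj, conj_gaussSchwartz, gaussComp_apply,
    D.symm_apply_apply, mul_comm]

variable {U : Lp ℂ 2 (volume : Measure (R2d d)) ≃ₗᵢ[ℂ] Lp ℂ 2 (volume : Measure (R2d d))}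

/-- A metaplectic operator for a totally Wigner-decomposable matrix maps a Gaussian to a chirped
Gaussian. -/
lemma WignerData.exists_gaussian_pair (H : WignerData A P Q D R Dt) (hU : IsMetaplectic A U) :
    ∃ (Ψ Φ : 𝓢(R2d d, ℂ)) (c : ℂ), Ψ ≠ 0 ∧ Φ ≠ 0 ∧ c ≠ 0 ∧
      Φ.toLp 2 volume = U (Ψ.toLp 2 volume) ∧
      IsSchwartzTensor Ψ (gaussSchwartz (Fin d)) (gaussComp D) ∧
      ∀ x ξ, Φ (joinPt x ξ) = c * chirp Q R (x, ξ) * gaussStft d (P x, Q ξ) := by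
  obtain ⟨Ψ, hΨ⟩ := exists_gauss_tensor D
  obtain ⟨Φ, c, hc, hΦ⟩ := exists_chirp_gauss P Q R
  have hΨ0 : Ψ ≠ 0 := fun h => by
    have := hΨ 0 0
    rw [h, gaussComp_apply, D.symm.map_zero, gaussSchwartz_apply] at this
    simp at this
  have hΦ0 : Φ ≠ 0 := fun h => by
    have h1 := hΦ 0 0
    rw [h, P.map_zero, Q.map_zero] at h1
    have h2 : gaussStft d (0, 0) ≠ 0 := by
      have : gaussStft d (0, 0) = schwartzInner (gaussSchwartz (Fin d)) (gaussSchwartz (Fin d)) := by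
        rw [gaussStft, stft_asDist]
        congr 1
        ext t
        simp [tfShift_apply, modChar]
      rw [this]
      exact schwartzInner_self_ne_zero gaussSchwartz_ne_zero
    have h3 : chirp Q R (0, 0) ≠ 0 := norm_ne_zero_iff.1 (by rw [chirp, norm_expI]; norm_num)
    exact mul_ne_zero (mul_ne_zero hc h3) h2 h1.symm
  obtain ⟨κ, hκ, hI⟩ := H.exists_integral_eq hc hΦ
  obtain ⟨k, hk, hD⟩ := H.exists_schwartzInner_gaussComp
  obtain ⟨j, hj, hJ⟩ := exists_integral_joinPt d
  obtain ⟨l, hl, hL⟩ := exists_schwartzInner_tensor d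
  have hj' : (j : ℂ) ≠ 0 := by exact_mod_cast hj.ne'
  -- The ambiguity function of `Φ` is the weak formula for `f = g =` Gaussian. It factors into two
  -- Gaussian ambiguity functions, as does that of `Ψ`; `κ` collects the constants.
  obtain ⟨s, hs, hs'⟩ := hU.exists_smul_eq (Ψ := Ψ) hΦ0 (κ := (j : ℂ)⁻¹ * (c * (κ * (k * l⁻¹))))
    (fun x ξ => by
      obtain ⟨a₁, a₂, rfl⟩ := exists_eq_joinPt x
      obtain ⟨α₁, α₂, rfl⟩ := exists_eq_joinPt ξ
      have h1 := hI (isWeakStft_stft (asDist (gaussSchwartz (Fin d))) (gaussSchwartz (Fin d)))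
        a₁ a₂ α₁ α₂
      rw [sesq_asDist, sesq_asDist, hD] at h1
      rw [hL hΨ (hΨ.rhoSchwartz a₁ a₂ α₁ α₂), mul_assoc, eq_inv_mul_iff_mul_eq₀ hj', schwartzInner,
        ← hJ]
      have h2 : ∀ z : Rd d × Rd d, Φ (joinPt z.1 z.2) *
          conj (rhoSchwartz (phaseFst A (joinPt a₁ a₂) (joinPt α₁ α₂))
            (phaseSnd A (joinPt a₁ a₂) (joinPt α₁ α₂)) Φ (joinPt z.1 z.2)) =
          c * (chirp Q R z * stft (gaussSchwartz (Fin d)) (asDist (gaussSchwartz (Fin d)))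
            (P z.1, Q z.2) * conj (rhoSchwartz (phaseFst A (joinPt a₁ a₂) (joinPt α₁ α₂))
            (phaseSnd A (joinPt a₁ a₂) (joinPt α₁ α₂)) Φ (joinPt z.1 z.2))) := fun z => by
        nth_rewrite 1 [hΦ]
        rw [gaussStft]
        ring
      simp only [h2]
      rw [integral_const_mul, h1]
      field_simp)
  refine ⟨Ψ, s • Φ, s * c, hΨ0, smul_ne_zero hs hΦ0, mul_ne_zero hs hc, ?_, hΨ, fun x ξ => ?_⟩
  · rw [hs']
    exact (SchwartzMap.toLpCLM ℂ ℂ 2 volume).map_smul s Φ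
  · rw [smul_apply, hΦ, smul_eq_mul]; ring

end GaussianPair

/-! ### Construction of the Wigner distribution -/

section WignerConstruction

open scoped ComplexConjugate

variable {d : ℕ}

lemma norm_le_norm_joinPt (z : Rd d × Rd d) : ‖z‖ ≤ ‖joinPt z.1 z.2‖ := by
  have h := norm_sq_joinPt z.1 z.2
  refine max_le (abs_le_of_sq_le_sq' ?_ (norm_nonneg _)).2 (abs_le_of_sq_le_sq' ?_ (norm_nonneg _)).2
  · nlinarith [sq_nonneg ‖z.2‖]
  · nlinarith [sq_nonneg ‖z.1‖]

lemma continuous_joinPt : Continuous fun z : Rd d × Rd d => joinPt z.1 z.2 :=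
  (joinEquiv d).continuous

lemma SchwartzMap.exists_seminorm_joinPt (d N : ℕ) : ∃ q : Seminorm ℂ 𝓢(R2d d, ℂ), Continuous q ∧
    ∀ Θ (z : Rd d × Rd d), (1 + ‖z‖) ^ N * ‖Θ (joinPt z.1 z.2)‖ ≤ q Θ := by
  have hcs : ∀ k l, Continuous (SchwartzMap.seminorm ℂ k l : Seminorm ℂ 𝓢(R2d d, ℂ)) := fun k l =>
    (schwartz_withSeminorms ℂ (R2d d) ℂ).continuous_seminorm (k, l)
  refine ⟨(2 ^ N : NNReal) • (SchwartzMap.seminorm ℂ N 0 + SchwartzMap.seminorm ℂ 0 0),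
    ((hcs N 0).add (hcs 0 0)).const_smul (2 ^ N : NNReal), fun Θ z => ?_⟩
  have h := SchwartzMap.one_add_norm_pow_mul_le N 0 Θ (joinPt z.1 z.2)
  rw [norm_iteratedFDeriv_zero] at h
  calc (1 + ‖z‖) ^ N * ‖Θ (joinPt z.1 z.2)‖
      ≤ (1 + ‖joinPt z.1 z.2‖) ^ N * ‖Θ (joinPt z.1 z.2)‖ := by
        gcongr; exact norm_le_norm_joinPt z
    _ ≤ _ := h
    _ = _ := by
        rw [smul_apply, NNReal.smul_def]; simp

lemma exists_growth_comp {V W : Type*} [NormedAddCommGroup V] [NormedSpace ℝ V]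
    [NormedAddCommGroup W] [NormedSpace ℝ W] (e : V →L[ℝ] W) {F : W → ℂ}
    (hF : ∃ (C : ℝ) (N : ℕ), 0 ≤ C ∧ ∀ z, ‖F z‖ ≤ C * (1 + ‖z‖) ^ N) :
    ∃ (C : ℝ) (N : ℕ), 0 ≤ C ∧ ∀ z, ‖F (e z)‖ ≤ C * (1 + ‖z‖) ^ N := by
  obtain ⟨C, N, hC, h⟩ := hF
  refine ⟨C * (1 + ‖e‖) ^ N, N, by positivity, fun z => (h _).trans ?_⟩
  rw [mul_assoc, ← mul_pow]
  gcongr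
  nlinarith [e.le_opNorm z, norm_nonneg e, norm_nonneg z]

variable {A : Mat4 d} {P Q D : Rd d ≃L[ℝ] Rd d} {R Dt : Rd d →L[ℝ] Rd d}
  {U : Lp ℂ 2 (volume : Measure (R2d d)) ≃ₗᵢ[ℂ] Lp ℂ 2 (volume : Measure (R2d d))}

/-- A distribution whose short-time Fourier transform with window `f` is weakly given by a function
`F` yields a metaplectic Wigner distribution given by a function. -/
lemma WignerData.exists_isMetaplecticImage (H : WignerData A P Q D R Dt) (hU : IsMetaplectic A U)
    {f g g' : 𝓢'(Rd d, ℂ)} {T : 𝓢'(R2d d, ℂ)} (hT : IsTensorConj f g T)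
    (hg : ∀ ψ, g' ψ = g (SchwartzMap.compCLMOfContinuousLinearEquiv ℂ D.symm ψ))
    {F : Rd d × Rd d → ℂ} (hFm : AEStronglyMeasurable F volume)
    (hFg : ∃ (C : ℝ) (N : ℕ), 0 ≤ C ∧ ∀ z, ‖F z‖ ≤ C * (1 + ‖z‖) ^ N)
    (hF : IsWeakStft f g' F) :
    ∃ (W : 𝓢'(R2d d, ℂ)) (κ : ℂ), κ ≠ 0 ∧ IsMetaplecticImage U T W ∧ ∀ Θ : 𝓢(R2d d, ℂ),
      Integrable (fun z : Rd d × Rd d =>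
        κ * (chirp Q R z * F (P z.1, Q z.2)) * Θ (joinPt z.1 z.2)) ∧
      W Θ = ∫ z : Rd d × Rd d, κ * (chirp Q R z * F (P z.1, Q z.2)) * Θ (joinPt z.1 z.2) := by
  obtain ⟨Ψ, Φ, c, hΨ0, hΦ0, hc, hUΦ, hΨ, hΦ⟩ := H.exists_gaussian_pair hU
  obtain ⟨κ, hκ, hI⟩ := H.exists_integral_eq hc hΦ
  obtain ⟨C, N, hC, hg₁⟩ := exists_growth_comp (P.prodCongr Q : (Rd d × Rd d) →L[ℝ] Rd d × Rd d) hFg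
  have hm : AEStronglyMeasurable (fun z : Rd d × Rd d => F (P z.1, Q z.2)) volume :=
    hFm.comp_quasiMeasurePreserving
      (quasiMeasurePreserving_linearEquiv volume volume (P.prodCongr Q))
  -- `W` is defined by the expected density, with the factor `κ⁻¹` chosen to compensate the constant
  -- in the weak formula.
  obtain ⟨W, hW⟩ := exists_temperedDistribution_integral (μ := (volume : Measure (Rd d × Rd d)))
    (S := fun z : Rd d × Rd d => κ⁻¹ * (chirp Q R z * F (P z.1, Q z.2)))
    (((continuous_chirp Q R).aestronglyMeasurable.mul hm).const_mul _)
    ⟨‖κ⁻¹‖ * C, N, by positivity, fun z => by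
      rw [norm_mul, norm_mul, chirp, norm_expI, one_mul, mul_assoc]
      exact mul_le_mul_of_nonneg_left (hg₁ z) (norm_nonneg _)⟩
    (fun (Θ : 𝓢(R2d d, ℂ)) z => Θ (joinPt z.1 z.2)) (fun Θ Θ' z => rfl) (fun c Θ z => rfl)
    (fun Θ => (Θ.continuous.comp continuous_joinPt).aestronglyMeasurable)
    (SchwartzMap.exists_seminorm_joinPt d)
  -- It suffices to compare `W` and `T` on the orbit of the Gaussian pair. There only pure tensors
  -- occur, and on those `T` is known.
  refine ⟨W, κ⁻¹, inv_ne_zero hκ, hU.isMetaplecticImage hΨ0 hUΦ fun x ξ => ?_, hW⟩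
  obtain ⟨a₁, a₂, rfl⟩ := exists_eq_joinPt x
  obtain ⟨α₁, α₂, rfl⟩ := exists_eq_joinPt ξ
  have e : sesq g' (rhoSchwartz (D.symm a₂) (-Dt α₂) (gaussSchwartz (Fin d))) =
      g (rhoSchwartz a₂ α₂ (gaussComp D)) := by
    rw [sesq, hg]
    congr 1
    ext t
    change conjSchwartz _ (D.symm t) = _
    rw [conjSchwartz_apply, ← H.rhoSchwartz_gaussComp, D.apply_symm_apply]
  rw [hT.sesq_eq (hΨ.rhoSchwartz a₁ a₂ α₁ α₂), ← e]
  refine mul_left_cancel₀ hκ ?_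
  rw [← hI hF, sesq, (hW _).2, ← integral_const_mul]
  congr 1; ext z
  rw [conjSchwartz_apply]
  field_simp

/-- Because `A` is onto, the distribution `T` prescribes the image on the entire orbit of `Φ`, which
determines it. This uniqueness allows a given density to be compared with the constructed one. -/
lemma IsMetaplecticImage.eq_of_orbit (hU : IsMetaplectic A U) {Ψ Φ : 𝓢(R2d d, ℂ)}
    (hΦ : Φ ≠ 0) (h₀ : Φ.toLp 2 volume = U (Ψ.toLp 2 volume)) {T W W' : 𝓢'(R2d d, ℂ)}
    (h : IsMetaplecticImage U T W) (h' : IsMetaplecticImage U T W') (Θ : 𝓢(R2d d, ℂ)) :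
    W Θ = W' Θ := by
  have := sesq_eq_of_rhoSchwartz (W := W) (W' := W') hΦ (fun x ξ => by
    obtain ⟨z, hz⟩ := (phaseEquiv A hU.isUnit_det).surjective (x, ξ)
    have h1 : phaseFst A z.1 z.2 = x := congrArg Prod.fst hz
    have h2 : phaseSnd A z.1 z.2 = ξ := congrArg Prod.snd hz
    rw [← h1, ← h2, h.sesq_rhoSchwartz hU h₀, h'.sesq_rhoSchwartz hU h₀]) (conjSchwartz Θ)
  rwa [sesq, sesq, conjSchwartz_conjSchwartz] at this

/-- Test with the Gaussian: it never vanishes, so its continuous inverse can be multiplied back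
locally. -/
lemma locallyIntegrable_of_integrable_mul_schwartz {F : Rd d × Rd d → ℂ}
    (hF : ∀ Θ : 𝓢(R2d d, ℂ), Integrable fun z : Rd d × Rd d => F z * Θ (joinPt z.1 z.2)) :
    LocallyIntegrable F volume := by
  set G : Rd d × Rd d → ℂ := fun z => gaussSchwartz (Fin d ⊕ Fin d) (joinPt z.1 z.2)
  have hG : ∀ z, G z ≠ 0 := fun z => by
    simp only [G, gaussSchwartz_apply]
    exact_mod_cast (Real.exp_pos _).ne'
  have hGc : Continuous G := (gaussSchwartz _).continuous.comp continuous_joinPt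
  have h := (hF (gaussSchwartz (Fin d ⊕ Fin d))).locallyIntegrable.mul_continuous (hGc.inv₀ hG)
  refine h.congr (Filter.Eventually.of_forall fun z => ?_)
  exact mul_inv_cancel_right₀ (hG z) (F z)

lemma ae_eq_of_integral_mul_schwartz {F F' : Rd d × Rd d → ℂ}
    (hF : ∀ Θ : 𝓢(R2d d, ℂ), Integrable fun z : Rd d × Rd d => F z * Θ (joinPt z.1 z.2))
    (hF' : ∀ Θ : 𝓢(R2d d, ℂ), Integrable fun z : Rd d × Rd d => F' z * Θ (joinPt z.1 z.2))
    (h : ∀ Θ : 𝓢(R2d d, ℂ), ∫ z : Rd d × Rd d, F z * Θ (joinPt z.1 z.2) =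
      ∫ z : Rd d × Rd d, F' z * Θ (joinPt z.1 z.2)) : F =ᵐ[volume] F' := by
  refine ae_eq_of_integral_contDiff_smul_eq (locallyIntegrable_of_integrable_mul_schwartz hF)
    (locallyIntegrable_of_integrable_mul_schwartz hF') fun g hg hgs => ?_
  let Θ : 𝓢(R2d d, ℂ) := HasCompactSupport.toSchwartzMap
    (f := fun u => ((g ((joinEquiv d).symm u) : ℝ) : ℂ))
    ((hgs.comp_homeomorph (joinEquiv d).symm.toHomeomorph).comp_left (g := fun r : ℝ => (r : ℂ)) rfl)
    (Complex.ofRealCLM.contDiff.comp (hg.comp (joinEquiv d).symm.contDiff))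
  have hΘ : ∀ z : Rd d × Rd d, Θ (joinPt z.1 z.2) = g z := fun z => by
    change ((g ((joinEquiv d).symm (joinEquiv d z)) : ℝ) : ℂ) = _
    rw [(joinEquiv d).symm_apply_apply]
  have := h Θ
  simp only [hΘ] at this
  simpa only [Complex.real_smul, mul_comm] using this

end WignerConstruction

/-! ### Mixed norms under the substitution by `P` and `Q` -/

section Transfer

variable {d : ℕ} {p q : ℝ≥0∞} {v m : Rd d × Rd d → ℝ} {P Q : Rd d ≃L[ℝ] Rd d}

/-- The substitution acts on each variable separately, so it changes a mixed norm by at most a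
constant factor, and so does its inverse. The equivalence of weights moves it off `m`. -/
lemma mixedENorm_lt_top_comp_iff (hp : 0 < p) (hm : IsModerateWeight v m)
    (hmE : WeightEquiv (fun z : Rd d × Rd d => m (P z.1, Q z.2)) m) {F : Rd d × Rd d → ℂ}
    (hF : Measurable F) :
    mixedENorm p q (fun z => ‖F (P z.1, Q z.2)‖ₑ * ENNReal.ofReal (m z)) < ∞ ↔
      mixedENorm p q (fun z => ‖F z‖ₑ * ENNReal.ofReal (m z)) < ∞ := by
  obtain ⟨c, C, hc, hcC, hE⟩ := hmE
  have hE₁ : ∀ z : Rd d × Rd d, ENNReal.ofReal (m z) ≤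
      ENNReal.ofReal c⁻¹ * ENNReal.ofReal (m (P z.1, Q z.2)) := fun z => by
    rw [← ENNReal.ofReal_mul (by positivity)]
    refine ENNReal.ofReal_le_ofReal ?_
    rw [inv_mul_eq_div, le_div_iff₀ hc, mul_comm]
    exact (hE z).1
  have hE₂ : ∀ z : Rd d × Rd d, ENNReal.ofReal (m (P z.1, Q z.2)) ≤
      ENNReal.ofReal C * ENNReal.ofReal (m z) := fun z => by
    rw [← ENNReal.ofReal_mul (by linarith)]
    exact ENNReal.ofReal_le_ofReal (hE z).2
  have hmm : Measurable fun z => ENNReal.ofReal (m z) :=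
    ENNReal.measurable_ofReal.comp hm.continuous.measurable
  have hB : Measurable fun z => ‖F z‖ₑ * ENNReal.ofReal (m z) := hF.enorm.mul hmm
  have hPQ : Measurable fun z : Rd d × Rd d => (P z.1, Q z.2) :=
    (P.prodCongr Q).continuous.measurable
  constructor
  · intro h
    obtain ⟨K, hK, hKb⟩ := exists_mixedENorm_comp_linearEquiv_le p q hp.ne' P.symm Q.symm
    have h1 := hKb _ ((hF.comp hPQ).enorm.mul hmm)
    refine mixedENorm_lt_top_of_le_mul hp.ne' (c := ENNReal.ofReal C) ENNReal.ofReal_ne_top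
      (B := fun z => ‖F z‖ₑ * ENNReal.ofReal (m (P.symm z.1, Q.symm z.2))) ?_ (fun z => ?_) ?_
    · exact hF.enorm.mul (hmm.comp (P.symm.prodCongr Q.symm).continuous.measurable)
    · have := hE₂ (P.symm z.1, Q.symm z.2)
      simp only [P.apply_symm_apply, Q.apply_symm_apply] at this
      rw [mul_left_comm]
      exact mul_le_mul' le_rfl this
    · refine lt_of_le_of_lt ?_ (ENNReal.mul_lt_top hK.lt_top h)
      refine le_trans (le_of_eq ?_) h1
      simp
  · intro h
    obtain ⟨K, hK, hKb⟩ := exists_mixedENorm_comp_linearEquiv_le p q hp.ne' P Q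
    refine mixedENorm_lt_top_of_le_mul hp.ne' (c := ENNReal.ofReal c⁻¹) ENNReal.ofReal_ne_top
      (hB.comp hPQ) (fun z => ?_) ((hKb _ hB).trans_lt (ENNReal.mul_lt_top hK.lt_top h))
    rw [Function.comp_apply, mul_left_comm]
    exact mul_le_mul' le_rfl (hE₁ z)

end Transfer

/-! ### Membership of the Wigner distribution; Schwartz windows -/

section WignerMembership

variable {d : ℕ} {p q : ℝ≥0∞} {v m : Rd d × Rd d → ℝ}
  {A : Mat4 d} {P Q D : Rd d ≃L[ℝ] Rd d} {R Dt : Rd d →L[ℝ] Rd d}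
  {U : Lp ℂ 2 (volume : Measure (R2d d)) ≃ₗᵢ[ℂ] Lp ℂ 2 (volume : Measure (R2d d))}

lemma Filter.EventuallyEq.mul_enorm_ofReal {F G : Rd d × Rd d → ℂ} (h : F =ᵐ[volume] G)
    (m : Rd d × Rd d → ℝ) : (fun z => ‖F z‖ₑ * ENNReal.ofReal (m z)) =ᵐ[volume]
      fun z => ‖G z‖ₑ * ENNReal.ofReal (m z) :=
  h.mono fun z hz => congrArg (fun c : ℂ => ‖c‖ₑ * ENNReal.ofReal (m z)) hz

lemma mixedENorm_chirp_lt_top_iff (hp : 0 < p) (hm : IsModerateWeight v m)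
    (hmE : WeightEquiv (fun z : Rd d × Rd d => m (P z.1, Q z.2)) m) {F : Rd d × Rd d → ℂ}
    (hF : Measurable F) {κ : ℂ} (hκ : κ ≠ 0) :
    mixedENorm p q (fun z => ‖κ * (chirp Q R z * F (P z.1, Q z.2))‖ₑ * ENNReal.ofReal (m z)) < ∞ ↔
      mixedENorm p q (fun z => ‖F z‖ₑ * ENNReal.ofReal (m z)) < ∞ := by
  have hχ : ∀ z, ‖κ * (chirp Q R z * F (P z.1, Q z.2))‖ₑ = ‖κ‖ₑ * ‖F (P z.1, Q z.2)‖ₑ := fun z => by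
    rw [enorm_mul, enorm_mul, chirp, ← ofReal_norm (expI _), norm_expI]; simp
  have hmm : Measurable fun z => ENNReal.ofReal (m z) :=
    ENNReal.measurable_ofReal.comp hm.continuous.measurable
  have hPQ : Measurable fun z : Rd d × Rd d => (P z.1, Q z.2) :=
    (P.prodCongr Q).continuous.measurable
  have hB : Measurable fun z => ‖F (P z.1, Q z.2)‖ₑ * ENNReal.ofReal (m z) :=
    (hF.comp hPQ).enorm.mul hmm
  rw [← mixedENorm_lt_top_comp_iff hp hm hmE hF]
  simp only [hχ, mul_assoc]
  constructor
  · refine mixedENorm_lt_top_of_le_mul hp.ne' (c := ‖κ‖ₑ⁻¹) (by simpa using hκ) (hB.const_mul _)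
      fun z => ?_
    rw [← mul_assoc, ENNReal.inv_mul_cancel (by simpa using hκ) (by simp), one_mul]
  · exact mixedENorm_lt_top_of_le_mul hp.ne' (by simp) hB fun z => le_rfl

/-- If a function `F` of at most polynomial growth is weakly the short-time Fourier transform of
`f` with window `g ∘ D`, then `W_A(f, g) ∈ L^{p,q}_m` if and only if `F ∈ L^{p,q}_m`. -/
lemma WignerData.wignerMemMixedLp_iff (H : WignerData A P Q D R Dt) (hU : IsMetaplectic A U)
    (hp : 0 < p) (hm : IsModerateWeight v m)
    (hmE : WeightEquiv (fun z : Rd d × Rd d => m (P z.1, Q z.2)) m) {f g g' : 𝓢'(Rd d, ℂ)}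
    (hg : ∀ ψ, g' ψ = g (SchwartzMap.compCLMOfContinuousLinearEquiv ℂ D.symm ψ))
    {F : Rd d × Rd d → ℂ} (hFm : Measurable F)
    (hFg : ∃ (C : ℝ) (N : ℕ), 0 ≤ C ∧ ∀ z, ‖F z‖ ≤ C * (1 + ‖z‖) ^ N) (hF : IsWeakStft f g' F) :
    WignerMemMixedLp U p q m f g ↔
      mixedENorm p q (fun z => ‖F z‖ₑ * ENNReal.ofReal (m z)) < ∞ := by
  have hm0 : ∀ z, 0 ≤ m z := fun z => (hm.pos z).le
  constructor
  · rintro ⟨W₀, ⟨T, hT, hW₀⟩, F₀, ⟨hF₀m, hF₀⟩, hWF₀⟩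
    obtain ⟨W, κ, hκ, hW, hWF⟩ := H.exists_isMetaplecticImage hU hT hg hFm.aestronglyMeasurable hFg hF
    obtain ⟨Ψ, Φ, c, -, hΦ0, -, hUΦ, -, -⟩ := H.exists_gaussian_pair hU
    -- The given density and the constructed one represent the same distribution, hence agree almost
    -- everywhere.
    have hae := ae_eq_of_integral_mul_schwartz (fun Θ => (hWF Θ).1) (fun Θ => (hWF₀ Θ).1)
      fun Θ => by
        rw [← (hWF Θ).2, ← (hWF₀ Θ).2, hW.eq_of_orbit hU hΦ0 hUΦ hW₀]
    rw [← mixedENorm_chirp_lt_top_iff (R := R) hp hm hmE hFm hκ]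
    rw [mixedNorm_eq_mixedENorm p q m hm0] at hF₀
    rwa [mixedENorm_congr_ae (hae.mul_enorm_ofReal m)]
  · intro h
    obtain ⟨T, hT⟩ := exists_isTensorConj f g
    obtain ⟨W, κ, hκ, hW, hWF⟩ := H.exists_isMetaplecticImage hU hT hg hFm.aestronglyMeasurable hFg hF
    refine ⟨W, ⟨T, hT, hW⟩, _, ⟨?_, ?_⟩, hWF⟩
    · exact (((continuous_chirp Q R).measurable.mul
        (hFm.comp (P.prodCongr Q).continuous.measurable)).const_mul κ).aestronglyMeasurable
    · rw [mixedNorm_eq_mixedENorm p q m hm0]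
      exact (mixedENorm_chirp_lt_top_iff hp hm hmE hFm hκ).2 h

/-- The distribution obtained by composing test functions with `D⁻¹` is again a Schwartz function,
namely `g ∘ D` divided by the Jacobian constant of `D`. -/
lemma exists_asDist_comp {g : 𝓢(Rd d, ℂ)} (hg : g ≠ 0) (D : Rd d ≃L[ℝ] Rd d) :
    ∃ g' : 𝓢(Rd d, ℂ), g' ≠ 0 ∧ ∀ ψ,
      asDist g' ψ = asDist g (SchwartzMap.compCLMOfContinuousLinearEquiv ℂ D.symm ψ) := by
  obtain ⟨c, hc, h⟩ := exists_integral_comp_linearEquiv volume volume D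
  have hc' : (c : ℂ) ≠ 0 := by exact_mod_cast hc.ne'
  refine ⟨(c : ℂ)⁻¹ • SchwartzMap.compCLMOfContinuousLinearEquiv ℂ D g, fun h0 => hg ?_, fun ψ => ?_⟩
  · have h1 := (smul_eq_zero.1 h0).resolve_left (inv_ne_zero hc')
    ext t
    simpa using DFunLike.congr_fun h1 (D.symm t)
  · rw [asDist, asDist, SchwartzMap.toTemperedDistributionCLM_apply_apply volume,
      SchwartzMap.toTemperedDistributionCLM_apply_apply volume]
    have := h fun t => SchwartzMap.compCLMOfContinuousLinearEquiv ℂ D.symm ψ t • g t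
    rw [← inv_mul_eq_iff_eq_mul₀ hc', ← integral_const_mul] at this
    rw [← this]
    congr 1; ext t
    change ψ t • ((c : ℂ)⁻¹ * g (D t)) = (c : ℂ)⁻¹ * (ψ (D.symm (D t)) * g (D t))
    rw [D.symm_apply_apply, smul_eq_mul]; ring

/-- For Schwartz `g` the transformed window is Schwartz, so its ordinary transform of `f` can be
taken as the weak one, and a change of window in both directions concludes. -/
theorem WignerData.memModulation_iff_of_schwartz (H : WignerData A P Q D R Dt)
    (hU : IsMetaplectic A U) (hp : 0 < p) (hq : 0 < q) (hvg : HasPolynomialGrowth v)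
    (hm : IsModerateWeight v m)
    (hmE : WeightEquiv (fun z : Rd d × Rd d => m (P z.1, Q z.2)) m) {φ g : 𝓢(Rd d, ℂ)}
    (hφ : φ ≠ 0) (hg : g ≠ 0) (f : 𝓢'(Rd d, ℂ)) :
    MemModulation φ p q m f ↔ WignerMemMixedLp U p q m f (asDist g) := by
  obtain ⟨g', hg', hgg'⟩ := exists_asDist_comp hg D
  rw [H.wignerMemMixedLp_iff hU hp hm hmE hgg' (continuous_stft g' f).measurable
    (exists_norm_stft_le g' f) (isWeakStft_stft f g'), ← memModulation_iff hm]
  exact ⟨fun h => h.change_window hp hq hvg hm hφ g', fun h => h.change_window hp hq hvg hm hg' φ⟩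

end WignerMembership

/-! ### From the Wigner distribution back to the modulation space -/

section Necessity

open scoped ComplexConjugate

variable {d : ℕ} {p q : ℝ≥0∞} {v m : Rd d × Rd d → ℝ}
  {A : Mat4 d} {P Q D : Rd d ≃L[ℝ] Rd d} {R Dt : Rd d →L[ℝ] Rd d}
  {U : Lp ℂ 2 (volume : Measure (R2d d)) ≃ₗᵢ[ℂ] Lp ℂ 2 (volume : Measure (R2d d))}

lemma conjSchwartz_rhoSchwartz (x ξ : Rd d) (φ : 𝓢(Rd d, ℂ)) :
    conjSchwartz (rhoSchwartz x ξ φ) = rhoSchwartz x (-ξ) (conjSchwartz φ) := by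
  rw [rhoSchwartz, rhoSchwartz, conjSchwartz_smul, conjSchwartz_tfShift, rhoPhase_eq_expI,
    rhoPhase_eq_expI, conj_expI, inner_neg_right, mul_neg]

/-- A distribution vanishing on the orbit of a nonzero Schwartz function is zero. One point of
nonvanishing is all that is needed of `g` to recover `f`. -/
lemma exists_apply_rhoSchwartz_ne_zero {g : 𝓢'(Rd d, ℂ)} (hg : g ≠ 0) {θ : 𝓢(Rd d, ℂ)}
    (hθ : θ ≠ 0) : ∃ a α, g (rhoSchwartz a α θ) ≠ 0 := by
  by_contra! h
  refine hg (ContinuousLinearMap.ext fun ψ => ?_)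
  have h1 := sesq_eq_of_rhoSchwartz (W := g) (W' := 0) (φ := conjSchwartz θ)
    (fun h0 => hθ (by rw [← conjSchwartz_conjSchwartz θ, h0]; ext t; simp [conjSchwartz_apply]))
    (fun x ξ => by
      rw [sesq, conjSchwartz_rhoSchwartz, conjSchwartz_conjSchwartz, h]; rfl) (conjSchwartz ψ)
  rwa [sesq, sesq, conjSchwartz_conjSchwartz] at h1

lemma gaussComp_ne_zero (D : Rd d ≃L[ℝ] Rd d) : gaussComp D ≠ 0 := fun h => by
  have := DFunLike.congr_fun h 0
  rw [gaussComp_apply, D.symm.map_zero, gaussSchwartz_apply] at this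
  simp at this

lemma lintegral_schwartz_joinPt_lt_top (Φ : 𝓢(R2d d, ℂ)) (k : Rd d × Rd d) {K : ℝ} (hK : 0 ≤ K) :
    ∫⁻ t : Rd d × Rd d, ‖Φ (joinPt (t.1 + k.1) (t.2 + k.2))‖ₑ * bracket t ^ K < ∞ := by
  obtain ⟨M, hM, hMi⟩ := exists_lintegral_bracket_lt_top (volume : Measure (Rd d × Rd d))
  obtain ⟨N, hN⟩ := exists_nat_ge (M + K)
  obtain ⟨s, -, hs⟩ := SchwartzMap.exists_seminorm_joinPt d N
  have : (volume : Measure (Rd d × Rd d)).IsAddHaarMeasure := Measure.prod.instIsAddHaarMeasure _ _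
  have hb : ∀ t : Rd d × Rd d, ‖Φ (joinPt t.1 t.2)‖ₑ ≤
      ENNReal.ofReal (s Φ) * bracket t ^ (-(N : ℝ)) := fun t => by
    rw [bracket_rpow_eq_ofReal, ← ENNReal.ofReal_mul (apply_nonneg s Φ), ← ofReal_norm]
    refine ENNReal.ofReal_le_ofReal ?_
    rw [Real.rpow_neg (by positivity), Real.rpow_natCast, ← div_eq_mul_inv,
      le_div_iff₀ (by positivity), mul_comm]
    exact hs Φ t
  calc ∫⁻ t : Rd d × Rd d, ‖Φ (joinPt (t.1 + k.1) (t.2 + k.2))‖ₑ * bracket t ^ K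
      ≤ ∫⁻ t : Rd d × Rd d, ENNReal.ofReal (s Φ) * bracket k ^ K *
          bracket (t + k) ^ (-(N - K)) := lintegral_mono fun t => by
        have h1 : bracket t ^ K ≤ bracket (t + k) ^ K * bracket k ^ K := by
          rw [← ENNReal.mul_rpow_of_nonneg _ _ hK]
          refine ENNReal.rpow_le_rpow ?_ hK
          have := bracket_add_le (t + k) (-k)
          rwa [add_neg_cancel_right, bracket_neg] at this
        refine (mul_le_mul' (hb (t + k)) h1).trans (le_of_eq ?_)
        rw [show -((N : ℝ) - K) = -N + K by ring, ← bracket_rpow_mul]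
        ring
    _ = ENNReal.ofReal (s Φ) * bracket k ^ K * ∫⁻ t : Rd d × Rd d, bracket t ^ (-(N - K)) := by
        rw [lintegral_const_mul' _ _ (ENNReal.mul_ne_top ENNReal.ofReal_ne_top
          (ENNReal.rpow_ne_top_of_nonneg hK (bracket_ne_top k))),
          lintegral_add_right_eq_self (fun t : Rd d × Rd d => bracket t ^ (-((N : ℝ) - K)))]
    _ < ∞ := ENNReal.mul_lt_top (ENNReal.mul_lt_top ENNReal.ofReal_lt_top
        (ENNReal.rpow_lt_top_of_nonneg hK (bracket_ne_top k))) (hMi _ (by linarith))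

/-- The short-time Fourier transform of `f` is dominated by a convolution of the function
representing `W_A(f, g)` with a Schwartz function. -/
lemma WignerData.exists_enorm_stft_le (H : WignerData A P Q D R Dt) (hU : IsMetaplectic A U)
    {f g : 𝓢'(Rd d, ℂ)} (hg : g ≠ 0) {T W : 𝓢'(R2d d, ℂ)} (hT : IsTensorConj f g T)
    (hW : IsMetaplecticImage U T W) {F : Rd d × Rd d → ℂ}
    (hWF : ∀ Θ : 𝓢(R2d d, ℂ), W Θ = ∫ z : Rd d × Rd d, F z * Θ (joinPt z.1 z.2)) :
    ∃ (Φ : 𝓢(R2d d, ℂ)) (k : Rd d × Rd d) (c : ℝ≥0∞), c ≠ ∞ ∧ ∀ z : Rd d × Rd d,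
      ‖stft (gaussSchwartz (Fin d)) f (P z.1, Q z.2)‖ₑ ≤
        c * ∫⁻ t : Rd d × Rd d, ‖Φ (joinPt (t.1 + k.1) (t.2 + k.2))‖ₑ * ‖F (z + t)‖ₑ := by
  obtain ⟨Ψ, Φ, -, -, -, -, hUΦ, hΨ, -⟩ := H.exists_gaussian_pair hU
  obtain ⟨a, α, hga⟩ := exists_apply_rhoSchwartz_ne_zero hg (gaussComp_ne_zero D)
  have : (volume : Measure (Rd d × Rd d)).IsAddHaarMeasure := Measure.prod.instIsAddHaarMeasure _ _
  refine ⟨Φ, (P.symm (D.symm a), -Q.symm (Dt α)), ‖g (rhoSchwartz a α (gaussComp D))‖ₑ⁻¹,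
    by simpa using hga, fun z => ?_⟩
  -- The coordinates `(a, α)` belonging to `g` stay fixed while those of `f` are `(P z.1, Q z.2)`.
  -- The centre `(b₁, β₂)` of the shifted `Φ` is then `z` minus the fixed vector `k`, so the pairing
  -- is bounded by a convolution.
  obtain ⟨b₁, b₂, β₁, β₂, hf, hs, hP, hQ, -, -⟩ := H.action (P z.1) a (Q z.2) α
  have hb₁ : b₁ = z.1 - P.symm (D.symm a) := by
    apply P.injective; rw [hP, map_sub, P.apply_symm_apply]
  have hβ₂ : β₂ = z.2 + Q.symm (Dt α) := by
    apply Q.injective; rw [hQ, map_add, Q.apply_symm_apply]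
  have h1 := hW.sesq_rhoSchwartz hU hUΦ (joinPt (P z.1) a) (joinPt (Q z.2) α)
  rw [hT.sesq_eq (hΨ.rhoSchwartz _ _ _ _), sesq_rhoSchwartz f, sesq, hWF] at h1
  have h2 : ‖stft (gaussSchwartz (Fin d)) f (P z.1, Q z.2)‖ₑ *
      ‖g (rhoSchwartz a α (gaussComp D))‖ₑ ≤ ∫⁻ u : Rd d × Rd d,
        ‖Φ (joinPt (u.1 - b₁) (u.2 - β₂))‖ₑ * ‖F u‖ₑ := by
    have h3 : ‖stft (gaussSchwartz (Fin d)) f (P z.1, Q z.2)‖ₑ *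
        ‖g (rhoSchwartz a α (gaussComp D))‖ₑ = ‖conj (rhoPhase (P z.1) (Q z.2)) *
          stft (gaussSchwartz (Fin d)) f (P z.1, Q z.2) *
          conj (g (rhoSchwartz a α (gaussComp D)))‖ₑ := by
      simp only [← ofReal_norm, norm_mul, RCLike.norm_conj, norm_rhoPhase, one_mul]
      rw [ENNReal.ofReal_mul (norm_nonneg _)]
    rw [h3, ← h1]
    refine (enorm_integral_le_lintegral_enorm _).trans (lintegral_mono fun u => le_of_eq ?_)
    rw [enorm_mul, mul_comm, hf, hs]
    congr 1
    rw [← ofReal_norm, ← ofReal_norm, conjSchwartz_apply, RCLike.norm_conj, coe_rhoSchwartz,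
      norm_schrodingerRep, joinPt_sub]
  rw [← mul_comm, ← div_eq_mul_inv, ENNReal.le_div_iff_mul_le (Or.inl (by simpa using hga))
    (Or.inl (by simp))]
  refine h2.trans (le_of_eq ?_)
  rw [← lintegral_add_left_eq_self _ z]
  congr 1; ext t
  rw [hb₁, hβ₂, Prod.fst_add, Prod.snd_add]
  rw [show z.1 + t.1 - (z.1 - P.symm (D.symm a)) = t.1 + P.symm (D.symm a) by abel,
    show z.2 + t.2 - (z.2 + Q.symm (Dt α)) = t.2 + -Q.symm (Dt α) by abel]

/-- Moderateness moves the weight inside the convolution at the price of a power of the bracket. The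
Schwartz kernel absorbs this power, and Young's inequality bounds the norm. -/
theorem WignerData.memModulation_of_wigner (H : WignerData A P Q D R Dt) (hU : IsMetaplectic A U)
    (hp : 1 ≤ p) (hq : 1 ≤ q) (hvg : HasPolynomialGrowth v) (hm : IsModerateWeight v m)
    (hmE : WeightEquiv (fun z : Rd d × Rd d => m (P z.1, Q z.2)) m) (φ : 𝓢(Rd d, ℂ))
    {f g : 𝓢'(Rd d, ℂ)} (hg : g ≠ 0) (h : WignerMemMixedLp U p q m f g) :
    MemModulation φ p q m f := by
  have hp0 : 0 < p := zero_lt_one.trans_le hp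
  have hq0 : 0 < q := zero_lt_one.trans_le hq
  obtain ⟨W, ⟨T, hT, hW⟩, F, ⟨hFm, hF⟩, hWF⟩ := h
  rw [mixedNorm_eq_mixedENorm p q m fun z => (hm.pos z).le,
    mixedENorm_congr_ae (hFm.ae_eq_mk.mul_enorm_ofReal m)] at hF
  have hWF' : ∀ Θ : 𝓢(R2d d, ℂ), W Θ = ∫ z : Rd d × Rd d, hFm.mk F z * Θ (joinPt z.1 z.2) :=
    fun Θ => by
      rw [(hWF Θ).2]
      exact integral_congr_ae (hFm.ae_eq_mk.mul (ae_eq_refl _))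
  obtain ⟨Φ, k, c, hc, hb⟩ := H.exists_enorm_stft_le hU hg hT hW hWF'
  obtain ⟨C, K, hC, hK, hmK⟩ := hm.exists_ofReal_le hvg
  refine MemModulation.change_window hp0 hq0 hvg hm (gaussSchwartz_ne_zero (n := Fin d)) φ ?_
  rw [memModulation_iff hm, ← mixedENorm_lt_top_comp_iff hp0 hm hmE (continuous_stft _ _).measurable]
  have hmm : Measurable fun z => ENNReal.ofReal (m z) :=
    ENNReal.measurable_ofReal.comp hm.continuous.measurable
  have hΦm : Measurable fun t : Rd d × Rd d =>
      ‖Φ (joinPt (t.1 + k.1) (t.2 + k.2))‖ₑ * bracket t ^ K :=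
    (Φ.continuous.comp (continuous_joinPt.comp (continuous_id.add continuous_const))).measurable.enorm.mul
      (measurable_bracket.pow_const _)
  refine (mixedENorm_le_of_le_lintegral hp hq (hΦm.const_mul (c * C))
    (hFm.stronglyMeasurable_mk.measurable.enorm.mul hmm) fun z => ?_).trans_lt
    (ENNReal.mul_lt_top ?_ hF)
  · calc ‖stft (gaussSchwartz (Fin d)) f (P z.1, Q z.2)‖ₑ * ENNReal.ofReal (m z)
        ≤ (c * ∫⁻ t : Rd d × Rd d, ‖Φ (joinPt (t.1 + k.1) (t.2 + k.2))‖ₑ * ‖hFm.mk F (z + t)‖ₑ) *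
            ENNReal.ofReal (m z) := mul_le_mul' (hb z) le_rfl
      _ = ∫⁻ t : Rd d × Rd d, c * (‖Φ (joinPt (t.1 + k.1) (t.2 + k.2))‖ₑ * ‖hFm.mk F (z + t)‖ₑ) *
            ENNReal.ofReal (m z) := by
          rw [← lintegral_const_mul' _ _ hc, lintegral_mul_const' _ _ ENNReal.ofReal_ne_top]
      _ ≤ _ := lintegral_mono fun t => by
          have := hmK z (z + t)
          rw [add_sub_cancel_left] at this
          refine (mul_le_mul' le_rfl this).trans (le_of_eq ?_)
          rw [Pi.mul_apply]
          ring
  · rw [lintegral_const_mul' _ _ (ENNReal.mul_ne_top hc hC)]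
    exact ENNReal.mul_lt_top (ENNReal.mul_lt_top hc.lt_top hC.lt_top)
      (lintegral_schwartz_joinPt_lt_top Φ k hK)

end Necessity

/-! ### The transform with a window in the weighted Feichtinger algebra -/

section WeakStft

open scoped ComplexConjugate

variable {d : ℕ} {p q : ℝ≥0∞} {v m : Rd d × Rd d → ℝ}

lemma mixedENorm_one_one {B : Rd d × Rd d → ℝ≥0∞} (hB : Measurable B) :
    mixedENorm 1 1 B = ∫⁻ z, B z := by
  rw [mixedENorm, eLpNorm_one_eq_lintegral_enorm, Measure.volume_eq_prod,
    lintegral_prod_symm _ hB.aemeasurable]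
  simp only [eLpNorm_one_eq_lintegral_enorm, enorm_eq_self]

lemma exists_growth_of_enorm_le {V : Type*} [NormedAddCommGroup V] {F : V → ℂ} {B : ℝ≥0∞} {K : ℝ}
    (hB : B ≠ ∞) (h : ∀ z, ‖F z‖ₑ ≤ B * bracket z ^ K) :
    ∃ (C : ℝ) (N : ℕ), 0 ≤ C ∧ ∀ z, ‖F z‖ ≤ C * (1 + ‖z‖) ^ N := by
  obtain ⟨N, hN⟩ := exists_nat_ge K
  refine ⟨B.toReal, N, ENNReal.toReal_nonneg, fun z => ?_⟩
  have h1 := (h z).trans (mul_le_mul' le_rfl (bracket_rpow_le_rpow z hN))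
  rw [bracket_rpow_eq_ofReal, Real.rpow_natCast, ← ofReal_norm, ← ENNReal.ofReal_toReal hB,
    ← ENNReal.ofReal_mul ENNReal.toReal_nonneg] at h1
  exact (ENNReal.ofReal_le_ofReal_iff (by positivity)).1 h1

lemma lintegral_enorm_stft_mul_bracket_lt_top (γ φ : 𝓢(Rd d, ℂ)) {K : ℝ} :
    ∫⁻ z : Rd d × Rd d, ‖stft γ (asDist φ) z‖ₑ * bracket z ^ K < ∞ := by
  obtain ⟨M, hM, hMi⟩ := exists_lintegral_bracket_lt_top (volume : Measure (Rd d × Rd d))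
  obtain ⟨N, hN⟩ := exists_nat_ge (M + K)
  obtain ⟨C, hC, h⟩ := exists_norm_stft_asDist_le N γ φ
  calc ∫⁻ z : Rd d × Rd d, ‖stft γ (asDist φ) z‖ₑ * bracket z ^ K
      ≤ ∫⁻ z : Rd d × Rd d, ENNReal.ofReal C * bracket z ^ (-(N - K)) := lintegral_mono fun z => by
        have h1 := ENNReal.ofReal_le_ofReal (h z)
        rw [ofReal_norm, ENNReal.ofReal_mul hC, ← bracket_rpow_eq_ofReal] at h1
        refine (mul_le_mul' h1 le_rfl).trans (le_of_eq ?_)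
        rw [mul_assoc, bracket_rpow_mul]
        congr 2; ring
    _ < ∞ := by
        rw [lintegral_const_mul' _ _ ENNReal.ofReal_ne_top]
        exact ENNReal.mul_lt_top ENNReal.ofReal_lt_top (hMi _ (by linarith))

/-- Write `z = -u + (z + u)`. Moderateness yields `v (-u)`, and the evenness of `v` up to a constant
replaces it by `v u`. -/
lemma IsModerateWeight.exists_ofReal_le_mul_add (hm : IsModerateWeight v m)
    (hev : ∃ C : ℝ, ∀ z, v (-z) ≤ C * v z) :
    ∃ C : ℝ≥0∞, C ≠ ∞ ∧ ∀ z u, ENNReal.ofReal (m z) ≤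
      C * ENNReal.ofReal (v u) * ENNReal.ofReal (m (z + u)) := by
  obtain ⟨C, hC, h⟩ := hm.moderate
  obtain ⟨E, hE⟩ := hev
  have hv0 : ∀ z, 0 ≤ v z := fun z => by
    have h1 := h z 0
    have h2 := hm.pos (z + 0)
    have h3 := hm.pos 0
    by_contra! h4
    nlinarith [mul_pos (mul_pos hC (neg_pos.2 h4)) h3]
  refine ⟨ENNReal.ofReal (C * E), ENNReal.ofReal_ne_top, fun z u => ?_⟩
  rw [mul_assoc, ← ENNReal.ofReal_mul (hv0 u), ← ENNReal.ofReal_mul' (mul_nonneg (hv0 u) (hm.pos _).le)]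
  refine ENNReal.ofReal_le_ofReal ?_
  have h1 := h (-u) (z + u)
  rw [show -u + (z + u) = z by abel] at h1
  calc m z ≤ C * v (-u) * m (z + u) := h1
    _ ≤ C * (E * v u) * m (z + u) := by
        have := hm.pos (z + u)
        gcongr
        exact hE u
    _ = _ := by ring

/-- The integrand in the representation of `V_g f` as an integral over the phase space. -/
noncomputable def stftKernel (φ₀ : 𝓢(Rd d, ℂ)) (f g : 𝓢'(Rd d, ℂ)) (z u : Rd d × Rd d) : ℂ :=
  stft φ₀ f (z + u) * conj (modChar (-u.2) z.1 * stft φ₀ g u)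

lemma continuous_stftKernel (φ₀ : 𝓢(Rd d, ℂ)) (f g : 𝓢'(Rd d, ℂ)) :
    Continuous fun w : (Rd d × Rd d) × (Rd d × Rd d) => stftKernel φ₀ f g w.1 w.2 := by
  have h1 : Continuous fun w : (Rd d × Rd d) × (Rd d × Rd d) => modChar (-w.2.2) w.1.1 := by
    unfold modChar; fun_prop
  exact ((continuous_stft φ₀ f).comp (continuous_fst.add continuous_snd)).mul
    (Complex.continuous_conj.comp (h1.mul ((continuous_stft φ₀ g).comp continuous_snd)))

lemma enorm_stftKernel (φ₀ : 𝓢(Rd d, ℂ)) (f g : 𝓢'(Rd d, ℂ)) (z u : Rd d × Rd d) :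
    ‖stftKernel φ₀ f g z u‖ₑ = ‖stft φ₀ f (z + u)‖ₑ * ‖stft φ₀ g u‖ₑ := by
  rw [stftKernel, enorm_mul]
  congr 1
  rw [← ofReal_norm, ← ofReal_norm, RCLike.norm_conj, norm_mul, norm_modChar, one_mul]

lemma stft_tfShift_neg (γ φ : 𝓢(Rd d, ℂ)) (z u : Rd d × Rd d) :
    stft (tfShift (-u.1) (-u.2) γ) (asDist φ) (z + u) =
      modChar (-u.2) (z.1 + u.1) * stft γ (asDist φ) z := by
  rw [stft_asDist, stft_asDist, tfShift_tfShift, schwartzInner_smul_right, conj_modChar, neg_neg,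
    Prod.fst_add, Prod.snd_add, add_neg_cancel_right, add_neg_cancel_right]
  congr 1
  simp only [modChar, inner_neg_left, inner_neg_right]

lemma schwartzInner_tfShift_neg (γ φ₀ : 𝓢(Rd d, ℂ)) (u : Rd d × Rd d) :
    schwartzInner (tfShift (-u.1) (-u.2) γ) φ₀ = modChar u.2 u.1 * stft φ₀ (asDist γ) u := by
  have h := schwartzInner_tfShift_tfShift γ φ₀ (-u.1) (-u.2) 0 0
  have h0 : tfShift 0 0 φ₀ = φ₀ := by ext t; simp [tfShift_apply, modChar]
  rw [h0] at h
  rw [h, stft_asDist, sub_zero, zero_sub, zero_sub, neg_neg, neg_neg]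
  congr 1
  simp [modChar]

/-- For fixed `u` the translation and the phase are absorbed into the window, `γ` becoming `π(-u)γ`.
Moyal's formula for `f` then applies, and the product of windows left over is `V_{φ₀} γ (u)` up to a
phase. -/
lemma integral_stftKernel_mul (φ₀ γ φ : 𝓢(Rd d, ℂ)) (f g : 𝓢'(Rd d, ℂ)) (u : Rd d × Rd d) :
    ∫ z, stftKernel φ₀ f g z u * conj (stft γ (asDist φ) z) =
      sesq f φ * conj (stft φ₀ g u * conj (stft φ₀ (asDist γ) u)) := by
  have : (volume : Measure (Rd d × Rd d)).IsAddHaarMeasure := Measure.prod.instIsAddHaarMeasure _ _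
  have h1 : ∀ z, stftKernel φ₀ f g z u * conj (stft γ (asDist φ) z) =
      conj (stft φ₀ g u) * conj (modChar u.2 u.1) * (stft φ₀ f (z + u) *
        conj (stft (tfShift (-u.1) (-u.2) γ) (asDist φ) (z + u))) := fun z => by
    have h2 : modChar u.2 u.1 * modChar (-u.2) u.1 = 1 := by
      rw [← modChar_add]; simp [modChar]
    have h3 : conj (modChar u.2 u.1) * conj (modChar (-u.2) u.1) = 1 := by
      rw [← map_mul, h2, map_one]
    rw [stft_tfShift_neg, stftKernel, modChar_add_right]
    simp only [map_mul]
    linear_combination -(stft φ₀ f (z + u) * conj (modChar (-u.2) z.1) * conj (stft φ₀ g u) *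
      conj (stft γ (asDist φ) z)) * h3
  have h4 : conj (modChar u.2 u.1) * modChar u.2 u.1 = 1 := by
    rw [conj_modChar, ← modChar_add]; simp [modChar]
  simp only [h1]
  rw [integral_const_mul, integral_add_right_eq_self (fun w => stft φ₀ f w *
    conj (stft (tfShift (-u.1) (-u.2) γ) (asDist φ) w)) u, (integral_stft_mul_conj_stft _ _ _ _).2,
    schwartzInner_tfShift_neg, map_mul, Complex.conj_conj]
  linear_combination (conj (stft φ₀ g u) * sesq f φ * stft φ₀ (asDist γ) u) * h4

/-- For `f ∈ M^{p,q}_m` and `g ∈ M¹_v`, the short-time Fourier transform `V_g f` is well-defined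
in the weak sense, and belongs to `L^{p,q}_m`. -/
theorem MemModulation.exists_isWeakStft (hp : 1 ≤ p) (hq : 1 ≤ q) (hvg : HasPolynomialGrowth v)
    (hvc : Continuous v) (hm : IsModerateWeight v m) (hev : ∃ C : ℝ, ∀ z, v (-z) ≤ C * v z)
    {φ₀ : 𝓢(Rd d, ℂ)} (hφ₀ : φ₀ ≠ 0) {f g : 𝓢'(Rd d, ℂ)} (hf : MemModulation φ₀ p q m f)
    (hg : ∫⁻ u, ‖stft φ₀ g u‖ₑ * ENNReal.ofReal (v u) < ∞) :
    ∃ F : Rd d × Rd d → ℂ, Measurable F ∧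
      (∃ (C : ℝ) (N : ℕ), 0 ≤ C ∧ ∀ z, ‖F z‖ ≤ C * (1 + ‖z‖) ^ N) ∧ IsWeakStft f g F ∧
      mixedENorm p q (fun z => ‖F z‖ₑ * ENNReal.ofReal (m z)) < ∞ := by
  obtain ⟨C₁, hC₁, h₁⟩ := hm.exists_ofReal_le_mul_add hev
  obtain ⟨C₂, hC₂, h₂⟩ := hf.exists_enorm_le hp hq hvg hm hφ₀
  obtain ⟨C₃, K, hC₃, hK, h₃⟩ := hm.exists_ofReal_le hvg
  set c : ℂ := (schwartzInner φ₀ φ₀)⁻¹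
  set J := ∫⁻ u, ‖stft φ₀ g u‖ₑ * ENNReal.ofReal (v u)
  set m₀ := ENNReal.ofReal (m 0)
  have hm₀ : m₀ ≠ 0 := by simpa [m₀] using hm.pos 0
  set B := C₁ * C₂ * C₃ * m₀⁻¹
  have hB : B ≠ ∞ := ENNReal.mul_ne_top (ENNReal.mul_ne_top (ENNReal.mul_ne_top hC₁ hC₂) hC₃)
    (ENNReal.inv_ne_top.2 hm₀)
  have hmm : Measurable fun z => ENNReal.ofReal (m z) :=
    ENNReal.measurable_ofReal.comp hm.continuous.measurable
  have hvm : Measurable fun z => ENNReal.ofReal (v z) :=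
    ENNReal.measurable_ofReal.comp hvc.measurable
  have hkm : Measurable fun u => ‖stft φ₀ g u‖ₑ * ENNReal.ofReal (v u) :=
    (continuous_stft φ₀ g).measurable.enorm.mul hvm
  -- The weighted transform of `f` is bounded by `C₂`. The chain `m 0 ≲ ⟨z⟩^K m z ≲ ⟨z⟩^K v u · m (z
  -- + u)` removes the weight and produces the constants of `B`.
  have hb : ∀ z u, ‖stft φ₀ f (z + u)‖ₑ ≤ B * bracket z ^ K * ENNReal.ofReal (v u) := fun z u => by
    have e1 : ‖stft φ₀ f (z + u)‖ₑ * m₀ ≤ C₁ * C₂ * C₃ * bracket z ^ K * ENNReal.ofReal (v u) :=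
      calc ‖stft φ₀ f (z + u)‖ₑ * m₀
          ≤ ‖stft φ₀ f (z + u)‖ₑ * (C₃ * bracket z ^ K *
              (C₁ * ENNReal.ofReal (v u) * ENNReal.ofReal (m (z + u)))) := by
            refine mul_le_mul' le_rfl (((h₃ 0 z).trans (le_of_eq ?_)).trans
              (mul_le_mul' le_rfl (h₁ z u)))
            rw [sub_zero]
        _ = C₃ * bracket z ^ K * (C₁ * ENNReal.ofReal (v u)) *
              (‖stft φ₀ f (z + u)‖ₑ * ENNReal.ofReal (m (z + u))) := by ring
        _ ≤ C₃ * bracket z ^ K * (C₁ * ENNReal.ofReal (v u)) * C₂ := mul_le_mul' le_rfl (h₂ _)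
        _ = _ := by ring
    calc ‖stft φ₀ f (z + u)‖ₑ = ‖stft φ₀ f (z + u)‖ₑ * m₀ * m₀⁻¹ := by
          rw [mul_assoc, ENNReal.mul_inv_cancel hm₀ ENNReal.ofReal_ne_top, mul_one]
      _ ≤ C₁ * C₂ * C₃ * bracket z ^ K * ENNReal.ofReal (v u) * m₀⁻¹ := mul_le_mul' e1 le_rfl
      _ = _ := by simp only [B]; ring
  have hkb : ∀ z u, ‖stftKernel φ₀ f g z u‖ₑ ≤
      B * bracket z ^ K * (‖stft φ₀ g u‖ₑ * ENNReal.ofReal (v u)) := fun z u => by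
    rw [enorm_stftKernel]
    refine (mul_le_mul' (hb z u) le_rfl).trans (le_of_eq (by ring))
  have hint : ∀ z, ‖c * ∫ u, stftKernel φ₀ f g z u‖ₑ ≤
      ‖c‖ₑ * ∫⁻ u, ‖stft φ₀ f (z + u)‖ₑ * ‖stft φ₀ g u‖ₑ := fun z => by
    rw [enorm_mul]
    refine mul_le_mul' le_rfl ((enorm_integral_le_lintegral_enorm _).trans (le_of_eq ?_))
    simp only [enorm_stftKernel]
  refine ⟨fun z => c * ∫ u, stftKernel φ₀ f g z u, ?_, ?_, fun φ γ => ?_, ?_⟩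
  · exact ((continuous_stftKernel φ₀ f g).stronglyMeasurable.integral_prod_right'
      (ν := volume)).measurable.const_mul c
  · refine exists_growth_of_enorm_le (B := ‖c‖ₑ * (B * J)) (K := K)
      (ENNReal.mul_ne_top (by simp) (ENNReal.mul_ne_top hB hg.ne)) fun z => (hint z).trans ?_
    rw [mul_assoc]
    refine mul_le_mul' le_rfl ?_
    calc ∫⁻ u, ‖stft φ₀ f (z + u)‖ₑ * ‖stft φ₀ g u‖ₑ
        ≤ ∫⁻ u, B * bracket z ^ K * (‖stft φ₀ g u‖ₑ * ENNReal.ofReal (v u)) :=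
          lintegral_mono fun u => by rw [← enorm_stftKernel]; exact hkb z u
      _ = B * J * bracket z ^ K := by
          rw [lintegral_const_mul' _ _ (ENNReal.mul_ne_top hB
            (ENNReal.rpow_ne_top_of_nonneg hK (bracket_ne_top z)))]
          ring
  -- Fubini is justified because the kernel is at most `⟨z⟩^K` times an integrable function of `u`,
  -- while `V_γ φ` decays rapidly in `z`.
  · have hI : Integrable (Function.uncurry fun z u =>
        stftKernel φ₀ f g z u * conj (stft γ (asDist φ) z))
        ((volume : Measure (Rd d × Rd d)).prod volume) := by
      refine ⟨((continuous_stftKernel φ₀ f g).mul (Complex.continuous_conj.comp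
        ((continuous_stft γ _).comp continuous_fst))).aestronglyMeasurable, ?_⟩
      rw [hasFiniteIntegral_iff_enorm]
      calc ∫⁻ w : (Rd d × Rd d) × (Rd d × Rd d), ‖stftKernel φ₀ f g w.1 w.2 *
              conj (stft γ (asDist φ) w.1)‖ₑ ∂(volume.prod volume)
          ≤ ∫⁻ w : (Rd d × Rd d) × (Rd d × Rd d),
              (B * (‖stft γ (asDist φ) w.1‖ₑ * bracket w.1 ^ K)) *
              (‖stft φ₀ g w.2‖ₑ * ENNReal.ofReal (v w.2)) ∂(volume.prod volume) :=
            lintegral_mono fun w => by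
              rw [enorm_mul, show ‖conj (stft γ (asDist φ) w.1)‖ₑ = ‖stft γ (asDist φ) w.1‖ₑ by
                rw [← ofReal_norm, ← ofReal_norm, RCLike.norm_conj]]
              exact (mul_le_mul' (hkb w.1 w.2) le_rfl).trans (le_of_eq (by ring))
        _ = B * (∫⁻ z, ‖stft γ (asDist φ) z‖ₑ * bracket z ^ K) * J := by
            rw [lintegral_prod_mul (f := fun z => B * (‖stft γ (asDist φ) z‖ₑ * bracket z ^ K))
              (((continuous_stft γ _).measurable.enorm.mul
                (measurable_bracket.pow_const _)).const_mul _).aemeasurable hkm.aemeasurable,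
              lintegral_const_mul' _ _ hB]
        _ < ∞ := ENNReal.mul_lt_top (ENNReal.mul_lt_top hB.lt_top
            (lintegral_enorm_stft_mul_bracket_lt_top γ φ)) hg
    have e1 : ∀ z, c * (∫ u, stftKernel φ₀ f g z u) * conj (stft γ (asDist φ) z) =
        c * ∫ u, stftKernel φ₀ f g z u * conj (stft γ (asDist φ) z) := fun z => by
      rw [integral_mul_const, mul_assoc]
    simp only [e1]
    -- After the swap the integral over `z` is Moyal's formula for `f`, and the remaining one over
    -- `u` is Moyal's formula for `g`; `c` cancels `⟨φ₀, φ₀⟩`.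
    rw [integral_const_mul, integral_integral_swap hI]
    simp only [integral_stftKernel_mul]
    rw [integral_const_mul, integral_conj, (integral_stft_mul_conj_stft _ _ _ _).2, map_mul,
      conj_schwartzInner]
    have : c * schwartzInner φ₀ φ₀ = 1 := inv_mul_cancel₀ (schwartzInner_self_ne_zero hφ₀)
    linear_combination (sesq f φ * conj (sesq g γ)) * this
  · rw [memModulation_iff hm] at hf
    -- This is Young's inequality with the kernel `|V_{φ₀} g| v`, integrable by hypothesis.
    refine (mixedENorm_le_of_le_lintegral hp hq (hkm.const_mul (‖c‖ₑ * C₁))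
      (enorm_stft_mul_measurable hm φ₀ f) fun z => ?_).trans_lt (ENNReal.mul_lt_top ?_ hf)
    · calc ‖c * ∫ u, stftKernel φ₀ f g z u‖ₑ * ENNReal.ofReal (m z)
          ≤ ‖c‖ₑ * (∫⁻ u, ‖stft φ₀ f (z + u)‖ₑ * ‖stft φ₀ g u‖ₑ) * ENNReal.ofReal (m z) :=
            mul_le_mul' (hint z) le_rfl
        _ = ∫⁻ u, ‖c‖ₑ * (‖stft φ₀ f (z + u)‖ₑ * ‖stft φ₀ g u‖ₑ) * ENNReal.ofReal (m z) := by
            rw [← lintegral_const_mul' _ _ (by simp), lintegral_mul_const' _ _ ENNReal.ofReal_ne_top]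
        _ ≤ _ := lintegral_mono fun u =>
            (mul_le_mul' le_rfl (h₁ z u)).trans (le_of_eq (by ring))
    · rw [lintegral_const_mul' _ _ (ENNReal.mul_ne_top (by simp) hC₁)]
      exact ENNReal.mul_lt_top (ENNReal.mul_lt_top (by simp) hC₁.lt_top) hg

end WeakStft

/-! ### From the modulation space to the Wigner distribution -/

section Sufficiency

open scoped ComplexConjugate

variable {d : ℕ} {p q : ℝ≥0∞} {v m : Rd d × Rd d → ℝ}
  {A : Mat4 d} {P Q D : Rd d ≃L[ℝ] Rd d} {R Dt : Rd d →L[ℝ] Rd d}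
  {U : Lp ℂ 2 (volume : Measure (R2d d)) ≃ₗᵢ[ℂ] Lp ℂ 2 (volume : Measure (R2d d))}

/-- The adjoint of a surjective map is injective, and an injective endomorphism of a
finite-dimensional space is an automorphism. -/
lemma WignerData.exists_dualEquiv (H : WignerData A P Q D R Dt) :
    ∃ E : Rd d ≃L[ℝ] Rd d, ∀ α, E α = Dt α := by
  have hinj : Function.Injective (Dt : Rd d →ₗ[ℝ] Rd d) := by
    rw [← LinearMap.ker_eq_bot, LinearMap.ker_eq_bot']
    intro u hu
    have h := H.adj u (D.symm u)
    rw [D.apply_symm_apply, show Dt u = 0 from hu, inner_zero_left] at h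
    exact inner_self_eq_zero.1 h.symm
  exact ⟨(LinearEquiv.ofInjectiveEndo (Dt : Rd d →ₗ[ℝ] Rd d) hinj).toContinuousLinearEquiv,
    fun α => rfl⟩

lemma WignerData.norm_stft_comp (H : WignerData A P Q D R Dt) {g g' : 𝓢'(Rd d, ℂ)}
    (hg : ∀ ψ, g' ψ = g (SchwartzMap.compCLMOfContinuousLinearEquiv ℂ D.symm ψ)) (a α : Rd d) :
    ‖stft (gaussSchwartz (Fin d)) g' (D.symm a, Dt α)‖ =
      ‖stft (conjSchwartz (gaussComp D)) g (a, α)‖ := by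
  have h1 : sesq g' (rhoSchwartz (D.symm a) (Dt α) (gaussSchwartz (Fin d))) =
      sesq g (rhoSchwartz a α (conjSchwartz (gaussComp D))) := by
    rw [sesq, sesq, hg]
    congr 1
    ext t
    rw [conjSchwartz_rhoSchwartz a α, conjSchwartz_conjSchwartz]
    change conjSchwartz _ (D.symm t) = _
    have := H.rhoSchwartz_gaussComp a (-α) (D.symm t)
    rw [D.apply_symm_apply, map_neg, neg_neg] at this
    rw [conjSchwartz_apply, this]
  have h2 := congrArg norm h1
  rwa [sesq_rhoSchwartz, sesq_rhoSchwartz, norm_mul, norm_mul, RCLike.norm_conj, RCLike.norm_conj,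
    norm_rhoPhase, norm_rhoPhase, one_mul, one_mul] at h2

/-- The transform of `g'` at `(D⁻¹a, Dᵀα)` has the modulus of a transform of `g` at `(a, α)`. The
equivalence of `v` under this substitution therefore gives `g'` the `M¹_v` bound of `g`, after a
change of window. -/
lemma WignerData.lintegral_stft_comp_lt_top (H : WignerData A P Q D R Dt)
    (hvg : HasPolynomialGrowth v) (hv : IsModerateWeight v v)
    (hvE : WeightEquiv (fun z : Rd d × Rd d => v (D.symm z.1, Dt z.2)) v) {φ : 𝓢(Rd d, ℂ)}
    (hφ : φ ≠ 0) {g g' : 𝓢'(Rd d, ℂ)} (hgM : MemModulation φ 1 1 v g)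
    (hg : ∀ ψ, g' ψ = g (SchwartzMap.compCLMOfContinuousLinearEquiv ℂ D.symm ψ)) :
    ∫⁻ u, ‖stft (gaussSchwartz (Fin d)) g' u‖ₑ * ENNReal.ofReal (v u) < ∞ := by
  have hw := (memModulation_iff hv _ _).1
    (hgM.change_window one_pos one_pos hvg hv hφ (conjSchwartz (gaussComp D)))
  rw [mixedENorm_one_one (enorm_stft_mul_measurable hv _ _)] at hw
  obtain ⟨c, C, hc, hcC, hE⟩ := hvE
  obtain ⟨E, hDt⟩ := H.exists_dualEquiv
  have : (volume : Measure (Rd d × Rd d)).IsAddHaarMeasure := Measure.prod.instIsAddHaarMeasure _ _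
  obtain ⟨k, hk0, hk, hI⟩ := exists_lintegral_comp_linearEquiv
    (volume : Measure (Rd d × Rd d)) volume (D.symm.prodCongr E)
  have h1 := hI fun u => ‖stft (gaussSchwartz (Fin d)) g' u‖ₑ * ENNReal.ofReal (v u)
  have h2 : k * ∫⁻ u, ‖stft (gaussSchwartz (Fin d)) g' u‖ₑ * ENNReal.ofReal (v u) < ∞ := by
    rw [← h1]
    calc _ ≤ ∫⁻ z, ENNReal.ofReal C *
          (‖stft (conjSchwartz (gaussComp D)) g z‖ₑ * ENNReal.ofReal (v z)) :=
          lintegral_mono fun z => by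
            have e1 : ‖stft (gaussSchwartz (Fin d)) g' (D.symm z.1, E z.2)‖ₑ =
                ‖stft (conjSchwartz (gaussComp D)) g z‖ₑ := by
              rw [hDt, ← ofReal_norm, ← ofReal_norm, H.norm_stft_comp hg]
            have e2 : ENNReal.ofReal (v (D.symm z.1, E z.2)) ≤
                ENNReal.ofReal C * ENNReal.ofReal (v z) := by
              rw [hDt, ← ENNReal.ofReal_mul (by linarith)]
              exact ENNReal.ofReal_le_ofReal (hE z).2
            exact (mul_le_mul' e1.le e2).trans_eq (mul_left_comm _ _ _)
      _ < ∞ := by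
          rw [lintegral_const_mul' _ _ ENNReal.ofReal_ne_top]
          exact ENNReal.mul_lt_top ENNReal.ofReal_lt_top hw
  exact ENNReal.lt_top_of_mul_ne_top_right h2.ne hk0

theorem WignerData.wigner_of_memModulation (H : WignerData A P Q D R Dt) (hU : IsMetaplectic A U)
    (hp : 1 ≤ p) (hq : 1 ≤ q) (hvg : HasPolynomialGrowth v) (hv : IsModerateWeight v v)
    (hev : ∃ C : ℝ, ∀ z, v (-z) ≤ C * v z)
    (hvE : WeightEquiv (fun z : Rd d × Rd d => v (D.symm z.1, Dt z.2)) v)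
    (hm : IsModerateWeight v m)
    (hmE : WeightEquiv (fun z : Rd d × Rd d => m (P z.1, Q z.2)) m) {φ : 𝓢(Rd d, ℂ)} (hφ : φ ≠ 0)
    {f g : 𝓢'(Rd d, ℂ)} (hg : MemModulation φ 1 1 v g) (hf : MemModulation φ p q m f) :
    WignerMemMixedLp U p q m f g := by
  have hp0 : 0 < p := zero_lt_one.trans_le hp
  have hq0 : 0 < q := zero_lt_one.trans_le hq
  obtain ⟨g', hg'⟩ := exists_compDist g D.symm
  obtain ⟨F, hFm, hFg, hF, hFM⟩ := MemModulation.exists_isWeakStft hp hq hvg hv.continuous hm hev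
    (gaussSchwartz_ne_zero (n := Fin d)) (hf.change_window hp0 hq0 hvg hm hφ _)
    (H.lintegral_stft_comp_lt_top hvg hv hvE hφ hg hg')
  exact (H.wignerMemMixedLp_iff hU hp0 hm hmE hg' hFm hFg hF).2 hFM

end Sufficiency

/-! ### The theorem -/

theorem theorem4p7 (d : ℕ)
    (A : Mat4 d) (L : GL (Fin d ⊕ Fin d) ℝ)
    (hA : IsTotallyWignerDecomposable A L) (hL : IsBlockRightRegular L)
    (p q : ℝ≥0∞) (hp : 0 < p) (hq : 0 < q)
    (v m : Rd d × Rd d → ℝ)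
    (hv : IsSubmultiplicativeWeight v) (hvg : HasPolynomialGrowth v)
    (hm : IsModerateWeight v m)
    (hmA : WeightEquiv
      (fun z : Rd d × Rd d =>
        m (applyMat ((blk33 A)ᵀ - (blk23 A)ᵀ * ((blk24 A)ᵀ)⁻¹ * (blk34 A)ᵀ) z.1,
          applyMat ((blk23 A)⁻¹) z.2)) m)
    -- the metaplectic operator `μ(A)` (any choice of the phase factor)
    (U : Lp ℂ 2 (volume : Measure (R2d d)) ≃ₗᵢ[ℂ] Lp ℂ 2 (volume : Measure (R2d d)))
    (hU : IsMetaplectic A U)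
    -- the window by which the modulation spaces are defined
    (φ : 𝓢(Rd d, ℂ)) (hφ : φ ≠ 0) :
    (∀ g : 𝓢(Rd d, ℂ), g ≠ 0 → ∀ f : 𝓢'(Rd d, ℂ),
      MemModulation φ p q m f ↔
        WignerMemMixedLp U p q m f (SchwartzMap.toTemperedDistributionCLM (Rd d) ℂ volume g)) ∧
    (1 ≤ p → 1 ≤ q → (∃ C : ℝ, ∀ z, v (-z) ≤ C * v z) →
      WeightEquiv
        (fun z : Rd d × Rd d =>
          v (applyMat ((blk23 A)ᵀ * ((blk24 A)ᵀ)⁻¹) z.1,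
            applyMat ((blk23 A)⁻¹ * blk24 A) z.2)) v →
      ∀ g : 𝓢'(Rd d, ℂ), g ≠ 0 → MemModulation φ 1 1 v g → ∀ f : 𝓢'(Rd d, ℂ),
        MemModulation φ p q m f ↔ WignerMemMixedLp U p q m f g) := by
  -- A submultiplicative weight is moderate with respect to itself, so the window change also covers
  -- `M¹_v`.
  have hv' : IsModerateWeight v v :=
    ⟨hv.continuous, hv.pos, 1, one_pos, fun z w => by rw [one_mul]; exact hv.submul z w⟩
  obtain ⟨P, Q, D, R, Dt, H, hP, hQ, hD, hDt⟩ := exists_wignerData hA hL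
  simp only [hP, hQ] at hmA
  refine ⟨fun g hg f => H.memModulation_iff_of_schwartz hU hp hq hvg hm hmA hφ hg f,
    fun hp1 hq1 hev hvE g hg hgM f => ?_⟩
  simp only [hD, hDt] at hvE
  exact ⟨H.wigner_of_memModulation hU hp1 hq1 hvg hv' hev hvE hm hmA hφ hgM,
    H.memModulation_of_wigner hU hp1 hq1 hvg hm hmA φ hg⟩
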